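/- **Theorem.** Suppose that quantum-accessible pseudorandom functions exist, that $\mathcal F=(G_0,f,f^{-1})$ is an injective trapdoor function that is secure against quantum adversaries, and that $\mathcal E_S=(E_S,D_S)$ is a symmetric encryption scheme that is CCA secure against quantum adversaries. Let $O:\{0,1\}^{d(n)}\to\{0,1\}^n$ be a random oracle, where $\{0,1\}^{d(n)}$ is the domain of $f$ and $\{0,1\}^n$ is the key space of $\mathcal E_S$. Then the hybrid encryption scheme $\mathcal E=(G,E,D)$ with $$G=G_0,\qquad E^O(\mathsf{pk},m)=\bigl(f(\mathsf{pk},r),\,E_S(O(r),m)\bigr)\ \text{ for uniformly random } r,\qquad D^O(\mathsf{sk},(y,c))=D_S\bigl(O(f^{-1}(\mathsf{sk},y)),c\bigr)$$ is CCA secure against quantum adversaries in the quantum-accessible random oracle model. Here the notions are as follows. *Adversaries and algorithms.* A polynomial-time quantum adversary is a sequence, indexed by the security parameter $n$, of circuits on polynomially many qubits made of polynomially many Hadamard, phase, $\pi/8$ and CNOT gates, one-qubit measurements and oracle queries. A quantum query to $O$ applies $|x,y\rangle\mapsto|x,y\oplus O(x)\rangle$; in a classical query the query register is measured first. Efficient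 classical algorithms are polynomial-size Boolean circuit families (with uniform random bits as additional input, where randomized) on inputs and outputs of polynomial length. A function $\epsilon(n)$ is negligible if for every $c$, $\epsilon(n)<n^{-c}$ for all large $n$. A game with threshold $\alpha$ is hard for quantum computers if for every polynomial-time quantum adversary $\Pr[\text{win}]-\alpha$ is negligible. *Pseudorandom functions.* A quantum-accessible PRF is an efficiently computable $F:\{0,1\}^n\times\{0,1\}^n\to\{0,1\}^n$ such that for every polynomial-time quantum adversary $A$ with quantum oracle access, $|\Pr_k[A^{F(k,\cdot)}=1]-\Pr_R[A^{R}=1]|$ is negligible, where $k\in\{0,1\}^n$ and $R:\{0,1\}^n\to\{0,1\}^n$ are uniformly random. *Injective trapdoor functions.* $G_0$, $f$, $f^{-1}$ are efficient and $f^{-1}(\mathsf{sk},f(\mathsf{pk},x))=x$ for all $(\mathsf{sk},\mathsf{pk})$ generated by $G_0$ and all $x\in\{0,1\}^{d(n)}$. $\mathcal F$ is secure if it is hard (with $\alpha=0$) to find, given $\mathsf{pk}$ and $y=f(\mathsf{pk},x)$ for uniform $x$, a preimage of $y$ under $f(\mathsf{pk},\cdot)$. *CCA security.* $E_S$ and $D_S$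 are efficient, $E_S$ may be randomized, $D_S$ may reject, and $D_S(k,E_S(k,m))=m$. In the symmetric game the challenger picks a uniform key $k\in\{0,1\}^n$ and a uniform bit $b$; in the asymmetric game it picks $(\mathsf{sk},\mathsf{pk})$ by $G$, a uniform bit $b$ and a uniform function $O$, and sends $\mathsf{pk}$. The adversary may make classical decryption queries, one classical challenge query $(m_0,m_1)$ with $m_0,m_1$ of equal length, answered by an encryption $c^*$ of $m_b$, and, in the symmetric game, classical encryption queries and, in the asymmetric game, quantum queries to $O$. It outputs a bit $b'$ and wins if $b'=b$ and it made only allowed queries: at most one challenge query, no decryption query on $c^*$ after the challenge query, and, in the asymmetric game for $\mathcal E$, decryption queries $(y,c)$ only on ciphertexts, that is, with $y$ in the range of $f(\mathsf{pk},\cdot)$. CCA security means that the game is hard with $\alpha=\tfrac12$. -/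

import Mathlib

namespace QROM

noncomputable section

/-! ## Bit strings, negligible functions, polynomial bounds -/

/-- Bit strings of length `n`. -/
abbrev Bits (n : ℕ) : Type := Fin n → Bool

/-- The first `a` bits of a string of `a + b` bits. -/
def leftBits {a b : ℕ} (z : Bits (a + b)) : Bits a := fun i => z (Fin.castAdd b i)

/-- The last `b` bits of a string of `a + b` bits. -/
def rightBits {a b : ℕ} (z : Bits (a + b)) : Bits b := fun i => z (Fin.natAdd a i)

/-- An optional string as a flag followed by a string; `none` (that is, `⊥`) becomes `00…0`. -/
def encodeOption {m : ℕ} : Option (Bits m) → Bits (m + 1)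
  | none => fun _ => false
  | some x => Fin.cons (α := fun _ => Bool) true x

/-- `ε` is eventually below every inverse polynomial. -/
def Negligible (ε : ℕ → ℝ) : Prop :=
  ∀ c : ℕ, ∀ᶠ n : ℕ in Filter.atTop, ε n < ((n : ℝ) ^ c)⁻¹

/-- `s` is bounded by a polynomial. -/
def PolyBounded (s : ℕ → ℕ) : Prop :=
  ∃ p : Polynomial ℕ, ∀ n, s n ≤ p.eval n

/-- The average of `g` over a finite type, i.e. its expectation at a uniform argument. -/
def uniformAvg {α : Type} [Fintype α] (g : α → ℝ) : ℝ :=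
  (∑ a, g a) / Fintype.card α

/-! ## Efficient classical algorithms: polynomial-size Boolean circuits -/

/-- A Boolean circuit with `a` inputs and `b` outputs. The wires `0, …, a - 1` carry the input;
each gate `(i, j)` adds one wire, carrying the NAND of wires `i` and `j`. A wire that does not
exist is read as the constant `false`. -/
structure Circuit (a b : ℕ) where
  gates : List (ℕ × ℕ)
  out : Fin b → ℕ

/-- The values of all wires. -/
def Circuit.wires {a b : ℕ} (C : Circuit a b) (x : Bits a) : List Bool :=
  C.gates.foldl (fun w g => w ++ [!(w.getD g.1 false && w.getD g.2 false)]) (List.ofFn x)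

/-- The function computed by a circuit. -/
def Circuit.eval {a b : ℕ} (C : Circuit a b) (x : Bits a) : Bits b :=
  fun j => (C.wires x).getD (C.out j) false

/-- The functions `φ n`, with polynomially long inputs and outputs, are computed by circuits of
polynomial size. -/
def Efficient {a b : ℕ → ℕ} (φ : ∀ n, Bits (a n) → Bits (b n)) : Prop :=
  PolyBounded a ∧ PolyBounded b ∧
    ∃ s : ℕ → ℕ, PolyBounded s ∧
      ∀ n, ∃ C : Circuit (a n) (b n), C.gates.length ≤ s n ∧ ∀ x, C.eval x = φ n x

/-- `Efficient` for functions of two arguments. -/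
def Efficient₂ {a b c : ℕ → ℕ} (φ : ∀ n, Bits (a n) → Bits (b n) → Bits (c n)) : Prop :=
  Efficient (a := fun n => a n + b n) (b := c) fun n z => φ n (leftBits z) (rightBits z)

/-- `Efficient` for functions of three arguments. -/
def Efficient₃ {a b c d : ℕ → ℕ}
    (φ : ∀ n, Bits (a n) → Bits (b n) → Bits (c n) → Bits (d n)) : Prop :=
  Efficient (a := fun n => a n + b n + c n) (b := d) fun n z =>
    φ n (leftBits (leftBits z)) (rightBits (leftBits z)) (rightBits z)

/-! ## Quantum circuits with oracles -/

/-- A (not necessarily normalized) state of `k` qubits, by its amplitudes in the computational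
basis. -/
abbrev QState (k : ℕ) : Type := Bits k → ℂ

/-- The universal gate set: Hadamard, phase, `π/8` and CNOT. -/
inductive Gate (k : ℕ) : Type where
  | hadamard (i : Fin k)
  | phase (i : Fin k)
  | piEighth (i : Fin k)
  | cnot (control target : Fin k) (h : control ≠ target)

/-- The unitary action of a gate. -/
def Gate.apply {k : ℕ} : Gate k → QState k → QState k
  | .hadamard i, ψ => fun x =>
      (ψ (Function.update x i false) + (if x i then -1 else 1) * ψ (Function.update x i true))
        / (Real.sqrt 2 : ℂ)
  | .phase i, ψ => fun x => (if x i then Complex.I else 1) * ψ x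
  | .piEighth i, ψ => fun x =>
      (if x i then Complex.exp (Complex.I * Real.pi / 4) else 1) * ψ x
  | .cnot c t _, ψ => fun x => ψ (Function.update x t (xor (x t) (x c)))

/-- What an adversary can talk to: oracles `QIdx` that it may query in superposition, and oracles
`CIdx` of the challenger that accept only classical queries; with their input and output
lengths. -/
structure Interface where
  QIdx : Type
  qIn : QIdx → ℕ
  qOut : QIdx → ℕ
  CIdx : Type
  cIn : CIdx → ℕ
  cOut : CIdx → ℕ

/-- One step of a quantum adversary on `k` qubits: a gate, the measurement of a qubit in the
computational basis, a quantum oracle query or a classical query. The embedding in a query selects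
distinct wires for the query register and the response register. -/
inductive Instr (I : Interface) (k : ℕ) : Type where
  | gate (g : Gate k)
  | measure (i : Fin k)
  | oracle (i : I.QIdx) (e : Fin (I.qIn i) ⊕ Fin (I.qOut i) ↪ Fin k)
  | query (i : I.CIdx) (e : Fin (I.cIn i) ⊕ Fin (I.cOut i) ↪ Fin k)

/-- A quantum adversary for one value of the security parameter, with input of `inp` bits and
output of `out` bits. The qubits `output` are measured at the end. -/
structure Adversary (I : Interface) (inp out : ℕ) where
  qubits : ℕ
  input : Fin inp ↪ Fin qubits
  output : Fin out ↪ Fin qubits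
  code : List (Instr I qubits)

/-- A sequence of adversaries, indexed by the security parameter, runs in polynomial time if it
uses polynomially many qubits and polynomially many gates, measurements and queries. -/
def PolyTime {I : ℕ → Interface} {inp out : ℕ → ℕ} (A : ∀ n, Adversary (I n) (inp n) (out n)) :
    Prop :=
  PolyBounded fun n => (A n).qubits + (A n).code.length

/-- The content of the query register. -/
def queryBits {a b k : ℕ} (e : Fin a ⊕ Fin b ↪ Fin k) (x : Bits k) : Bits a :=
  fun j => x (e (Sum.inl j))

/-- XOR of `v` into the response register. -/
def xorResponse {a b k : ℕ} (e : Fin a ⊕ Fin b ↪ Fin k) (v : Bits b) (x : Bits k) : Bits k :=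
  fun w => xor (x w) (decide (∃ j, e (Sum.inr j) = w ∧ v j = true))

/-- The unitary `|x, y⟩ ↦ |x, y ⊕ F x⟩`. -/
def applyOracle {a b k : ℕ} (F : Bits a → Bits b) (e : Fin a ⊕ Fin b ↪ Fin k) (ψ : QState k) :
    QState k :=
  fun x => ψ (xorResponse e (F (queryBits e x)) x)

/-- The unitary `|x, y⟩ ↦ |x, y ⊕ v⟩` for a fixed response `v`. -/
def applyResponse {a b k : ℕ} (v : Bits b) (e : Fin a ⊕ Fin b ↪ Fin k) (ψ : QState k) : QState k :=
  fun x => ψ (xorResponse e v x)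

/-- Measuring the query register with outcome `q`; the squared norm of the resulting vector is the
probability of that outcome. -/
def projectQuery {a b k : ℕ} (q : Bits a) (e : Fin a ⊕ Fin b ↪ Fin k) (ψ : QState k) : QState k :=
  fun x => if queryBits e x = q then ψ x else 0

/-- Measuring qubit `i` with outcome `v`. -/
def projectQubit {k : ℕ} (i : Fin k) (v : Bool) (ψ : QState k) : QState k :=
  fun x => if x i = v then ψ x else 0

/-- The basis state with input `v` on the input wires and `0` elsewhere. -/
def startState {inp k : ℕ} (e : Fin inp ↪ Fin k) (v : Bits inp) : QState k :=
  fun x => if x = (fun w => decide (∃ j, e j = w ∧ v j = true)) then 1 else 0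

/-! ## Games -/

/-- A game played by a quantum adversary with a classical challenger, for one value of the security
parameter. The challenger samples `coins` uniformly, sends `input coins` to the adversary, answers
its classical queries (`answer`, with fresh uniform randomness for each query, from its current
state, which it updates), and finally decides whether the adversary has won. -/
structure Game (I : Interface) (inp out : ℕ) where
  Coins : Type
  fintypeCoins : Fintype Coins
  State : Type
  start : State
  input : Coins → Bits inp
  oracle : Coins → ∀ i : I.QIdx, Bits (I.qIn i) → Bits (I.qOut i)
  answerCoins : I.CIdx → ℕ
  answer : Coins → State → ∀ i : I.CIdx, Bits (I.cIn i) → Bits (answerCoins i) →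
    Bits (I.cOut i) × State
  wins : Coins → State → Bits out → Prop

attribute [instance] Game.fintypeCoins

/-- The probability of winning when the steps `code` remain, the state of the challenger is `s` and
the state of the adversary is `ψ` (all scaled by the squared norm of `ψ`). -/
def Game.run {I : Interface} {inp out k : ℕ} (G : Game I inp out) (r : G.Coins)
    (output : Fin out ↪ Fin k) : List (Instr I k) → G.State → QState k → ℝ
  | [], s, ψ => by
      classical exact ∑ x : Bits k, if G.wins r s (fun j => x (output j)) then ‖ψ x‖ ^ 2 else 0
  | .gate g :: code, s, ψ => G.run r output code s (g.apply ψ)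
  | .measure i :: code, s, ψ => ∑ v : Bool, G.run r output code s (projectQubit i v ψ)
  | .oracle i e :: code, s, ψ => G.run r output code s (applyOracle (G.oracle r i) e ψ)
  | .query i e :: code, s, ψ =>
      ∑ q : Bits (I.cIn i), uniformAvg fun w : Bits (G.answerCoins i) =>
        G.run r output code (G.answer r s i q w).2
          (applyResponse (G.answer r s i q w).1 e (projectQuery q e ψ))

/-- The probability that the adversary `A` wins the game `G`. -/
def Game.winProb {I : Interface} {inp out : ℕ} (G : Game I inp out) (A : Adversary I inp out) :
    ℝ :=
  uniformAvg fun r : G.Coins =>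
    G.run r A.output A.code G.start (startState A.input (G.input r))

/-- The problem `(G, α)` is hard for quantum computers: no polynomial-time quantum adversary wins
with probability exceeding `α` by a non-negligible amount. -/
def QuantumHard {I : ℕ → Interface} {inp out : ℕ → ℕ} (G : ∀ n, Game (I n) (inp n) (out n))
    (α : ℝ) : Prop :=
  ∀ A : ∀ n, Adversary (I n) (inp n) (out n), PolyTime A →
    Negligible fun n => (G n).winProb (A n) - α

/-! ## Quantum-accessible pseudorandom functions -/

/-- Access to one quantum oracle from `a` bits to `b` bits and nothing else. -/
def oracleInterface (a b : ℕ) : Interface where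
  QIdx := Unit
  qIn _ := a
  qOut _ := b
  CIdx := Empty
  cIn := Empty.elim
  cOut := Empty.elim

/-- A distinguisher has quantum access to the function `F key` for a uniform `key`; "winning" means
that it outputs `1`. -/
def distinguishGame {K : Type} [inst : Fintype K] {a b : ℕ} (F : K → Bits a → Bits b) :
    Game (oracleInterface a b) 0 1 where
  Coins := K
  fintypeCoins := inst
  State := Unit
  start := ()
  input _ := Fin.elim0
  oracle key _ := F key
  answerCoins := fun i => nomatch i
  answer := fun _ _ i => nomatch i
  wins _ _ z := z 0 = true

/-- `F n key` is a quantum-accessible pseudorandom function from `n` bits to `n` bits with keys of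
`n` bits: it is efficiently computable, and polynomial-time quantum algorithms with superposition
access cannot distinguish it from a uniformly random function. -/
def IsQuantumPRF (F : ∀ n, Bits n → Bits n → Bits n) : Prop :=
  Efficient₂ F ∧
    ∀ D : ∀ n, Adversary (oracleInterface n n) 0 1, PolyTime D →
      Negligible fun n =>
        |(distinguishGame (F n)).winProb (D n) -
          (distinguishGame (id : (Bits n → Bits n) → Bits n → Bits n)).winProb (D n)|

/-! ## Injective trapdoor functions -/

/-- An injective trapdoor function with domain `{0,1}^(domLen n)`. On all key pairs `(pk, sk)`
generated by `keyGen`, the algorithm `inv sk` inverts `f pk`; in particular `f pk` is injective.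
Nothing is required of `inv sk` outside the range of `f pk`. -/
structure TrapdoorFunction where
  keyCoins : ℕ → ℕ
  pkLen : ℕ → ℕ
  skLen : ℕ → ℕ
  domLen : ℕ → ℕ
  rangeLen : ℕ → ℕ
  keyGen : ∀ n, Bits (keyCoins n) → Bits (pkLen n) × Bits (skLen n)
  f : ∀ n, Bits (pkLen n) → Bits (domLen n) → Bits (rangeLen n)
  inv : ∀ n, Bits (skLen n) → Bits (rangeLen n) → Bits (domLen n)
  inv_f : ∀ n (w : Bits (keyCoins n)) (x : Bits (domLen n)),
    inv n (keyGen n w).2 (f n (keyGen n w).1 x) = x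
  efficient_keyGen : Efficient (a := keyCoins) (b := fun n => pkLen n + skLen n)
    fun n w => Fin.append (keyGen n w).1 (keyGen n w).2
  efficient_f : Efficient₂ f
  efficient_inv : Efficient₂ inv

/-- No oracles. -/
def noInterface : Interface where
  QIdx := Empty
  qIn := Empty.elim
  qOut := Empty.elim
  CIdx := Empty
  cIn := Empty.elim
  cOut := Empty.elim

/-- The inversion game: given a public key and a random element `y` of the range of `f pk` (the
image of a uniform element of the domain), find a preimage of `y`. -/
def TrapdoorFunction.invGame (T : TrapdoorFunction) (n : ℕ) :
    Game noInterface (T.pkLen n + T.rangeLen n) (T.domLen n) where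
  Coins := Bits (T.keyCoins n) × Bits (T.domLen n)
  fintypeCoins := inferInstance
  State := Unit
  start := ()
  input r := Fin.append (T.keyGen n r.1).1 (T.f n (T.keyGen n r.1).1 r.2)
  oracle := fun _ i => nomatch i
  answerCoins := fun i => nomatch i
  answer := fun _ _ i => nomatch i
  wins r _ x := T.f n (T.keyGen n r.1).1 x = T.f n (T.keyGen n r.1).1 r.2

/-- Security of a trapdoor function against quantum adversaries. -/
def TrapdoorFunction.QuantumSecure (T : TrapdoorFunction) : Prop :=
  QuantumHard T.invGame 0

/-! ## Chosen ciphertext security -/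

/-- What the challenger remembers in a chosen ciphertext attack: the challenge ciphertext, once
there is one, and whether all queries so far were legal. -/
structure CCAState (ct : ℕ) where
  challenge : Option (Bits ct)
  legal : Prop

/-- A symmetric encryption scheme with keys of `n` bits. Encryption is randomized; decryption may
return `none`, that is, reject. Messages are given as blocks of `msgLen n` bits, which may encode
strings of varying length: `msgSize` is the length that a ciphertext need not hide. -/
structure SymScheme where
  msgLen : ℕ → ℕ
  ctLen : ℕ → ℕ
  encCoins : ℕ → ℕ
  msgSize : ∀ n, Bits (msgLen n) → ℕ
  enc : ∀ n, Bits n → Bits (msgLen n) → Bits (encCoins n) → Bits (ctLen n)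
  dec : ∀ n, Bits n → Bits (ctLen n) → Option (Bits (msgLen n))
  dec_enc : ∀ n k m w, dec n k (enc n k m w) = some m
  efficient_enc : Efficient₃ enc
  efficient_dec : Efficient₂ (c := fun n => msgLen n + 1) fun n k c => encodeOption (dec n k c)

/-- Kinds of classical queries in the symmetric game. -/
inductive SymQuery : Type where
  | enc
  | dec
  | challenge

/-- The classical queries of the symmetric game. -/
def SymScheme.interface (S : SymScheme) (n : ℕ) : Interface where
  QIdx := Empty
  qIn := Empty.elim
  qOut := Empty.elim
  CIdx := SymQuery
  cIn
    | .enc => S.msgLen n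
    | .dec => S.ctLen n
    | .challenge => S.msgLen n + S.msgLen n
  cOut
    | .enc => S.ctLen n
    | .dec => S.msgLen n + 1
    | .challenge => S.ctLen n

/-- The symmetric chosen ciphertext attack game. The challenger samples a key and a bit. The
adversary may ask for encryptions and decryptions, and for one challenge on two messages of the
same length. It wins if it outputs the bit and did not ask for the decryption of the challenge
ciphertext after the challenge. -/
def SymScheme.ccaGame (S : SymScheme) (n : ℕ) : Game (S.interface n) 0 1 where
  Coins := Bits n × Bool
  fintypeCoins := inferInstance
  State := CCAState (S.ctLen n)
  start := ⟨none, True⟩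
  input _ := Fin.elim0
  oracle := fun _ i => nomatch i
  answerCoins
    | .enc => S.encCoins n
    | .dec => 0
    | .challenge => S.encCoins n
  answer r s
    | .enc => fun m w => (S.enc n r.1 m w, s)
    | .dec => fun c _ =>
        (encodeOption (S.dec n r.1 c), ⟨s.challenge, s.legal ∧ s.challenge ≠ some c⟩)
    | .challenge => fun m w =>
        let c := S.enc n r.1 (if r.2 then rightBits m else leftBits m) w
        (c, ⟨some c, s.legal ∧ s.challenge = none ∧
          S.msgSize n (leftBits m) = S.msgSize n (rightBits m)⟩)
  wins r s z := s.legal ∧ z 0 = r.2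

/-- Chosen ciphertext security of a symmetric scheme against quantum adversaries. -/
def SymScheme.QuantumCCASecure (S : SymScheme) : Prop :=
  QuantumHard S.ccaGame (1 / 2)

/-- An asymmetric encryption scheme that uses a random oracle from `roIn n` bits to `roOut n` bits.
`ctSpace n pk` is the set of ciphertexts, on which decryption is defined; what `dec` returns
elsewhere is irrelevant. -/
structure AsymScheme where
  roIn : ℕ → ℕ
  roOut : ℕ → ℕ
  keyCoins : ℕ → ℕ
  pkLen : ℕ → ℕ
  skLen : ℕ → ℕ
  msgLen : ℕ → ℕ
  ctLen : ℕ → ℕ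
  encCoins : ℕ → ℕ
  msgSize : ∀ n, Bits (msgLen n) → ℕ
  keyGen : ∀ n, Bits (keyCoins n) → Bits (pkLen n) × Bits (skLen n)
  ctSpace : ∀ n, Bits (pkLen n) → Set (Bits (ctLen n))
  enc : ∀ n, (Bits (roIn n) → Bits (roOut n)) →
    Bits (pkLen n) → Bits (msgLen n) → Bits (encCoins n) → Bits (ctLen n)
  dec : ∀ n, (Bits (roIn n) → Bits (roOut n)) →
    Bits (skLen n) → Bits (ctLen n) → Option (Bits (msgLen n))
  enc_mem : ∀ n O w m u, enc n O (keyGen n w).1 m u ∈ ctSpace n (keyGen n w).1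
  dec_enc : ∀ n O w m u, dec n O (keyGen n w).2 (enc n O (keyGen n w).1 m u) = some m

/-- Kinds of classical queries in the asymmetric game. -/
inductive AsymQuery : Type where
  | dec
  | challenge

/-- The oracles of the asymmetric game: the random oracle, which may be queried in superposition,
and the classical queries. -/
def AsymScheme.interface (E : AsymScheme) (n : ℕ) : Interface where
  QIdx := Unit
  qIn _ := E.roIn n
  qOut _ := E.roOut n
  CIdx := AsymQuery
  cIn
    | .dec => E.ctLen n
    | .challenge => E.msgLen n + E.msgLen n
  cOut
    | .dec => E.msgLen n + 1
    | .challenge => E.ctLen n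

/-- The asymmetric chosen ciphertext attack game in the quantum-accessible random oracle model. The
challenger samples a key pair, a bit and a random oracle, and sends the public key. The adversary
has quantum access to the random oracle, and may ask for decryptions of ciphertexts and for one
challenge on two messages of the same length. It wins if it outputs the bit and did not ask for
the decryption of the challenge ciphertext after the challenge. -/
def AsymScheme.ccaGame (E : AsymScheme) (n : ℕ) : Game (E.interface n) (E.pkLen n) 1 where
  Coins := Bits (E.keyCoins n) × Bool × (Bits (E.roIn n) → Bits (E.roOut n))
  fintypeCoins := inferInstance
  State := CCAState (E.ctLen n)
  start := ⟨none, True⟩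
  input r := (E.keyGen n r.1).1
  oracle r _ := r.2.2
  answerCoins
    | .dec => 0
    | .challenge => E.encCoins n
  answer r s
    | .dec => fun c _ =>
        (encodeOption (E.dec n r.2.2 (E.keyGen n r.1).2 c),
          ⟨s.challenge, s.legal ∧ s.challenge ≠ some c ∧ c ∈ E.ctSpace n (E.keyGen n r.1).1⟩)
    | .challenge => fun m w =>
        let c := E.enc n r.2.2 (E.keyGen n r.1).1 (if r.2.1 then rightBits m else leftBits m) w
        (c, ⟨some c, s.legal ∧ s.challenge = none ∧
          E.msgSize n (leftBits m) = E.msgSize n (rightBits m)⟩)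
  wins r s z := s.legal ∧ z 0 = r.2.1

/-- Chosen ciphertext security of an asymmetric scheme against quantum adversaries, in the
quantum-accessible random oracle model. -/
def AsymScheme.QuantumCCASecure (E : AsymScheme) : Prop :=
  QuantumHard E.ccaGame (1 / 2)

/-! ## Hybrid encryption -/

theorem leftBits_append {a b : ℕ} (x : Bits a) (y : Bits b) :
    leftBits (Fin.append x y) = x := by
  funext i; simp [leftBits]

theorem rightBits_append {a b : ℕ} (x : Bits a) (y : Bits b) :
    rightBits (Fin.append x y) = y := by
  funext i; simp [rightBits]

/-- Hybrid encryption: `E^O(pk, m) = (f(pk, r), E_S(O(r), m))` for a random `r`, and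
`D^O(sk, (y, c)) = D_S(O(f⁻¹(sk, y)), c)`. A ciphertext under `pk` is a pair `(y, c)` with `y` in
the range of `f pk`. -/
def hybrid (T : TrapdoorFunction) (S : SymScheme) : AsymScheme where
  roIn := T.domLen
  roOut := fun n => n
  keyCoins := T.keyCoins
  pkLen := T.pkLen
  skLen := T.skLen
  msgLen := S.msgLen
  ctLen := fun n => T.rangeLen n + S.ctLen n
  encCoins := fun n => T.domLen n + S.encCoins n
  msgSize := S.msgSize
  keyGen := T.keyGen
  ctSpace := fun n pk => {c | leftBits c ∈ Set.range (T.f n pk)}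
  enc := fun n O pk m w =>
    Fin.append (T.f n pk (leftBits w)) (S.enc n (O (leftBits w)) m (rightBits w))
  dec := fun n O sk c => S.dec n (O (T.inv n sk (leftBits c))) (rightBits c)
  enc_mem := by
    intro n O w m u
    exact ⟨leftBits u, (leftBits_append _ _).symm⟩
  dec_enc := by
    intro n O w m u
    rw [leftBits_append, rightBits_append, T.inv_f, S.dec_enc]

end

end QROM

/-!
The proof reduces an attack on the hybrid scheme to an attack on the symmetric scheme or on the
trapdoor function, by non-uniform reductions: whatever the challenger samples and a reduction does not
need to be random is fixed to its best value (`exists_uniformAvg_le`).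

Write `p = f pk`, which is injective, and let `y = p r` be the first part of the challenge ciphertext.
A random oracle `O` has the same distribution as `H ∘ p` for a random function `H` on the whole of
`{0,1}^(rangeLen n)` (`uniformAvg_comp_injective`). In terms of `H`, a ciphertext `(y', c)` is decrypted
with the key `H y'`, so that the secret key is no longer needed; only ciphertexts with `y'` in the range
of `p` have to be decrypted correctly (`winProb_hybrid`).

*Replacing the key.* Resampling the value of `H` at `y` as an independent key `κ` changes nothing. If
afterwards the random oracle, but not decryption and encryption, goes back to the old `H`, then the
adversary notices this only through its queries to the random oracle at `r`. Here the winning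
probability, as a function of the state of the adversary, is a positive quadratic form, hence
`run (ψ + φ) ≤ (1 + t) run ψ + (1 + 1/t) run φ`; applied at every query this gives
`FixedGame.run_le_of_agree`, a one-way to hiding lemma in which the square root of the usual bound is
replaced by a free parameter `t`. It is linear in the probabilities, so it can be averaged.

*Hashing.* The function `H` has exponential size, but the winning probability with `q` queries is a
polynomial of degree at most `2q` in the indicators of the events `H x = v`
(`HashedGame.run_mem_lowDegree`). Its average is the same for a `2q`-wise independent hash function, for
instance a random polynomial of degree less than `2q` over a finite field
(`exists_boundedIndependent`), which is computed by a small circuit.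

*The reductions.* Classical circuits are evaluated reversibly on an adversary's register
(`exists_clean_circuit`, `exists_gates_extend`), and the state of a simulation is that of the simulated
adversary together with some classical data and a clean workspace (`simState`).
If the adversary queries `r`, then measuring its query inverts the trapdoor function
(`exists_inverter`). If `κ` is independent of the oracle, then `κ` may be the key of the symmetric game:
decryption queries `(y, c)` are passed on to the symmetric challenger, and for other queries, since the
circuit has to make a query in any case, the complement of the challenge ciphertext is decrypted there
(`exists_dec_code`, `exists_symAdversary`).

With `t` a suitable inverse polynomial, the two reductions bound the advantage (`exists_reductions`,
`reduction_bound`).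
-/

namespace QROM

noncomputable section

/-! ### Averages, polynomial bounds -/

section Averages

variable {α β : Type} [Fintype α] [Fintype β]

theorem uniformAvg_mono {g h : α → ℝ} (H : ∀ a, g a ≤ h a) : uniformAvg g ≤ uniformAvg h := by
  unfold uniformAvg
  gcongr with a
  exact H a

theorem uniformAvg_nonneg {g : α → ℝ} (H : ∀ a, 0 ≤ g a) : 0 ≤ uniformAvg g := by
  unfold uniformAvg
  exact div_nonneg (Finset.sum_nonneg fun a _ => H a) (Nat.cast_nonneg _)

theorem uniformAvg_const [Nonempty α] (c : ℝ) : uniformAvg (fun _ : α => c) = c := by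
  unfold uniformAvg
  rw [Finset.sum_const, Finset.card_univ, nsmul_eq_mul]
  field_simp

theorem uniformAvg_add (g h : α → ℝ) :
    uniformAvg (fun a => g a + h a) = uniformAvg g + uniformAvg h := by
  simp [uniformAvg, Finset.sum_add_distrib, add_div]

theorem uniformAvg_mul_left (c : ℝ) (g : α → ℝ) :
    uniformAvg (fun a => c * g a) = c * uniformAvg g := by
  simp [uniformAvg, ← Finset.mul_sum, mul_div_assoc]

theorem uniformAvg_sum {ι : Type} (s : Finset ι) (g : ι → α → ℝ) :
    uniformAvg (fun a => ∑ i ∈ s, g i a) = ∑ i ∈ s, uniformAvg (g i) := by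
  simp only [uniformAvg]
  rw [Finset.sum_comm, Finset.sum_div]

theorem uniformAvg_comm (g : α → β → ℝ) :
    uniformAvg (fun a => uniformAvg (g a)) = uniformAvg fun b => uniformAvg fun a => g a b := by
  simp only [uniformAvg, ← Finset.sum_div]
  rw [Finset.sum_comm, div_right_comm]

theorem uniformAvg_prod (g : α × β → ℝ) :
    uniformAvg g = uniformAvg fun a => uniformAvg fun b => g (a, b) := by
  simp only [uniformAvg, ← Finset.sum_div, Fintype.card_prod, Nat.cast_mul]
  rw [Fintype.sum_prod_type, div_div, mul_comm]

theorem uniformAvg_equiv (e : α ≃ β) (g : β → ℝ) : uniformAvg (fun a => g (e a)) = uniformAvg g := by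
  simp only [uniformAvg]
  rw [Equiv.sum_comp e g, Fintype.card_congr e]

theorem exists_uniformAvg_le [Nonempty α] (g : α → ℝ) : ∃ a, uniformAvg g ≤ g a := by
  by_contra! H
  have h1 : ∑ a, g a < ∑ _a : α, uniformAvg g :=
    Finset.sum_lt_sum_of_nonempty Finset.univ_nonempty fun a _ => H a
  rw [Finset.sum_const, Finset.card_univ, nsmul_eq_mul] at h1
  have h2 : (0 : ℝ) < Fintype.card α := by exact_mod_cast Fintype.card_pos
  unfold uniformAvg at h1
  rw [mul_div_cancel₀ _ h2.ne'] at h1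
  exact lt_irrefl _ h1

end Averages

theorem PolyBounded.mono {s t : ℕ → ℕ} (ht : PolyBounded t) (h : ∀ n, s n ≤ t n) :
    PolyBounded s := by
  obtain ⟨p, hp⟩ := ht
  exact ⟨p, fun n => (h n).trans (hp n)⟩

theorem polyBounded_const (c : ℕ) : PolyBounded fun _ => c := ⟨Polynomial.C c, fun n => by simp⟩

theorem polyBounded_id : PolyBounded fun n => n := ⟨Polynomial.X, fun n => by simp⟩

theorem PolyBounded.add {s t : ℕ → ℕ} (hs : PolyBounded s) (ht : PolyBounded t) :
    PolyBounded fun n => s n + t n := by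
  obtain ⟨p, hp⟩ := hs
  obtain ⟨q, hq⟩ := ht
  exact ⟨p + q, fun n => by rw [Polynomial.eval_add]; exact add_le_add (hp n) (hq n)⟩

theorem PolyBounded.mul {s t : ℕ → ℕ} (hs : PolyBounded s) (ht : PolyBounded t) :
    PolyBounded fun n => s n * t n := by
  obtain ⟨p, hp⟩ := hs
  obtain ⟨q, hq⟩ := ht
  exact ⟨p * q, fun n => by rw [Polynomial.eval_mul]; exact Nat.mul_le_mul (hp n) (hq n)⟩

/-- A polynomially bounded function is eventually below a monomial. -/
theorem PolyBounded.eventually_le_pow {s : ℕ → ℕ} (hs : PolyBounded s) :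
    ∃ a : ℕ, ∀ᶠ n : ℕ in Filter.atTop, s n ≤ n ^ a := by
  obtain ⟨p, hp⟩ := hs
  refine ⟨p.natDegree + 1, ?_⟩
  filter_upwards [Filter.eventually_ge_atTop (p.eval 1), Filter.eventually_ge_atTop 1] with n h1 h2
  refine (hp n).trans ?_
  calc p.eval n ≤ p.eval 1 * n ^ p.natDegree := by
        rw [Polynomial.eval_eq_sum_range, Polynomial.eval_eq_sum_range, Finset.sum_mul]
        refine Finset.sum_le_sum fun i hi => ?_
        rw [one_pow, mul_one]
        exact Nat.mul_le_mul_left _ (Nat.pow_le_pow_right h2 (by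
          simpa [Nat.lt_succ_iff] using hi))
    _ ≤ n * n ^ p.natDegree := Nat.mul_le_mul_right _ h1
    _ = n ^ (p.natDegree + 1) := by rw [pow_succ, mul_comm]

/-! ### Straight-line programs -/

/-- `Comp V s U`: starting from the Boolean functions in `V`, all functions in `U` are obtained by at
most `s` NAND operations. This is the wire-free view of a Boolean circuit. -/
inductive Comp {X : Type} : Set (X → Bool) → ℕ → Set (X → Bool) → Prop
  | base {V U : Set (X → Bool)} {s : ℕ} (h : U ⊆ V) : Comp V s U
  | nand {V U : Set (X → Bool)} {s : ℕ} {f g : X → Bool} (hf : f ∈ V) (hg : g ∈ V)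
      (h : Comp (insert (fun x => !(f x && g x)) V) s U) : Comp V (s + 1) U

namespace Comp

variable {X Y : Type} {V V' U U' W : Set (X → Bool)} {s s' : ℕ}

theorem mono_left (h : Comp V s U) : ∀ {V' : Set (X → Bool)}, V ⊆ V' → Comp V' s U := by
  induction h with
  | base h => exact fun hV => .base (h.trans hV)
  | nand hf hg _ ih => exact fun hV => .nand (hV hf) (hV hg) (ih (Set.insert_subset_insert hV))

theorem mono_right (h : Comp V s U) : ∀ {U' : Set (X → Bool)}, U' ⊆ U → Comp V s U' := by
  induction h with
  | base h => exact fun hU => .base (hU.trans h)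
  | nand hf hg _ ih => exact fun hU => .nand hf hg (ih hU)

theorem mono_size (h : Comp V s U) : ∀ {s' : ℕ}, s ≤ s' → Comp V s' U := by
  induction h with
  | base h => exact fun _ => .base h
  | nand hf hg _ ih =>
    intro s' hs
    obtain ⟨t, rfl⟩ : ∃ t, s' = t + 1 := ⟨s' - 1, by omega⟩
    exact .nand hf hg (ih (by omega))

theorem trans (h : Comp V s U) : Comp (V ∪ U) s' W → Comp V (s + s') W := by
  induction h with
  | base h =>
    intro h'
    rw [Set.union_eq_self_of_subset_right h] at h'
    exact h'.mono_size (Nat.le_add_left _ _)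
  | @nand V U s f g hf hg _ ih =>
    intro h'
    rw [Nat.add_right_comm]
    exact .nand hf hg (ih (h'.mono_left (Set.union_subset_union_left _ (Set.subset_insert _ _))))

theorem frame (h : Comp V s U) : ∀ {T : Set (X → Bool)}, T ⊆ V → Comp V s (U ∪ T) := by
  induction h with
  | base h => exact fun hT => .base (Set.union_subset h hT)
  | nand hf hg _ ih => exact fun hT => .nand hf hg (ih (hT.trans (Set.subset_insert _ _)))

theorem union (h : Comp V s U) (h' : Comp V s' U') : Comp V (s + s') (U ∪ U') :=
  h.trans (((h'.mono_left Set.subset_union_left).frame Set.subset_union_right).mono_right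
    (Set.union_comm U U').subset)

theorem iUnion {m : ℕ} {U : Fin m → Set (X → Bool)} (h : ∀ i, Comp V s (U i)) :
    Comp V (m * s) (⋃ i, U i) := by
  induction m with
  | zero => exact .base (by simp)
  | succ m ih =>
    have h1 := (ih fun i => h i.castSucc).union (h (Fin.last m))
    rw [Nat.succ_mul]
    refine h1.mono_right (Set.iUnion_subset fun i => ?_)
    refine Fin.lastCases ?_ (fun j => ?_) i
    · exact Set.subset_union_right
    · exact (Set.subset_iUnion (fun j : Fin m => U j.castSucc) j).trans Set.subset_union_left

theorem single_nand {f g : X → Bool} (hf : f ∈ V) (hg : g ∈ V) :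
    Comp V 1 {fun x => !(f x && g x)} :=
  .nand hf hg (.base (by simp))

theorem single_nand' {f g : X → Bool} (hf : Comp V s {f}) (hg : Comp V s' {g}) :
    Comp V (s + s' + 1) {fun x => !(f x && g x)} :=
  (hf.union hg).trans (single_nand (by simp) (by simp))

theorem single_not {f : X → Bool} (hf : Comp V s {f}) : Comp V (s + 1) {fun x => !(f x)} := by
  have h : Comp (V ∪ {f}) 1 {fun x => !(f x && f x)} := single_nand (by simp) (by simp)
  simp only [Bool.and_self] at h
  exact hf.trans h

theorem single_and {f g : X → Bool} (hf : Comp V s {f}) (hg : Comp V s' {g}) :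
    Comp V (s + s' + 2) {fun x => f x && g x} := by
  have h := (hf.single_nand' hg).single_not
  simpa using h

theorem single_or {f g : X → Bool} (hf : Comp V s {f}) (hg : Comp V s' {g}) :
    Comp V (s + s' + 3) {fun x => f x || g x} := by
  have h := (hf.single_not.single_nand' hg.single_not)
  have e : (fun x => !(!(f x) && !(g x))) = fun x => f x || g x := by
    funext x; cases f x <;> cases g x <;> rfl
  rw [e] at h
  exact h.mono_size (by omega)

/-- The inputs are computed once, although they are used twice. -/
theorem single_xor {f g : X → Bool} (hf : Comp V s {f}) (hg : Comp V s' {g}) :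
    Comp V (s + s' + 20) {fun x => xor (f x) (g x)} := by
  refine (Comp.mono_size ((hf.union hg).trans (s' := 12) (W := {fun x => xor (f x) (g x)}) ?_)
    (by omega))
  have hf' : Comp (V ∪ ({f} ∪ {g})) 0 {f} := .base (by simp)
  have hg' : Comp (V ∪ ({f} ∪ {g})) 0 {g} := .base (by simp)
  have h := (hf'.single_and hg'.single_not).single_or (hf'.single_not.single_and hg')
  have e : (fun x => (f x && !(g x)) || (!(f x) && g x)) = fun x => xor (f x) (g x) := by
    funext x; cases f x <;> cases g x <;> rfl
  rw [e] at h
  exact h.mono_size (by omega)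

theorem single_const (hV : (fun _ => false) ∈ V) (c : Bool) : Comp V 1 {fun _ => c} := by
  cases c
  · exact .base (by simpa using hV)
  · have h : Comp V 0 {fun _ => false} := .base (by simpa using hV)
    exact h.single_not

/-- The parity of a list of functions. -/
theorem single_parity (hV : (fun _ => false) ∈ V) (l : List (X → Bool))
    (h : ∀ f ∈ l, Comp V s {f}) :
    Comp V (l.length * (s + 20)) {fun x => l.foldr (fun f b => xor (f x) b) false} := by
  induction l with
  | nil => exact .base (by simpa using hV)
  | cons f l ih =>
    refine ((h f (by simp)).single_xor (ih fun g hg => h g (by simp [hg]))).mono_size ?_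
    rw [List.length_cons, Nat.succ_mul]
    omega

/-- The conjunction of finitely many functions. -/
theorem single_forall (hV : (fun _ => false) ∈ V) {m : ℕ} (f : Fin m → X → Bool)
    (h : ∀ i, Comp V s {f i}) :
    Comp V (m * (s + 2) + 1) {fun x => decide (∀ i, f i x = true)} := by
  induction m with
  | zero =>
    have h := single_const hV true
    simpa using h
  | succ m ih =>
    have h1 := (ih (fun i => f i.castSucc) fun i => h _).single_and (h (Fin.last m))
    have e : (fun x => decide (∀ i : Fin m, f i.castSucc x = true) && f (Fin.last m) x) =
        fun x => decide (∀ i, f i x = true) := by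
      funext x
      rw [← Bool.decide_coe (f (Fin.last m) x), ← Bool.decide_and, decide_eq_decide,
        Fin.forall_fin_succ']
    rw [e] at h1
    exact h1.mono_size (by rw [Nat.succ_mul]; omega)

theorem single_ite {c f g : X → Bool} (hc : c ∈ V) (hf : f ∈ V) (hg : g ∈ V) :
    Comp V 8 {fun x => if c x then f x else g x} := by
  have hc' : Comp V 0 {c} := .base (by simpa using hc)
  have hf' : Comp V 0 {f} := .base (by simpa using hf)
  have hg' : Comp V 0 {g} := .base (by simpa using hg)
  have h := (hc'.single_and hf').single_or (hc'.single_not.single_and hg')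
  have e : (fun x => (c x && f x) || (!(c x) && g x)) = fun x => if c x then f x else g x := by
    funext x; cases c x <;> simp
  rw [e] at h
  exact h.mono_size (by omega)

end Comp

/-- The Boolean coordinate functions of `θ`. -/
def coords {X : Type} {a : ℕ} (θ : X → Bits a) : Set (X → Bool) := Set.range fun i x => θ x i

theorem mem_coords {X : Type} {a : ℕ} (θ : X → Bits a) (i : Fin a) :
    (fun x => θ x i) ∈ coords θ := ⟨i, rfl⟩

/-- `φ` is computed by a circuit with at most `s` gates. -/
def HasCircuit {a b : ℕ} (s : ℕ) (φ : Bits a → Bits b) : Prop :=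
  ∃ C : Circuit a b, C.gates.length ≤ s ∧ ∀ x, C.eval x = φ x

/-- One gate, acting on the list of wire values. -/
def gateStep (w : List Bool) (g : ℕ × ℕ) : List Bool :=
  w ++ [!(w.getD g.1 false && w.getD g.2 false)]

theorem length_foldl_gateStep (g : List (ℕ × ℕ)) (w : List Bool) :
    (g.foldl gateStep w).length = w.length + g.length := by
  induction g generalizing w with
  | nil => rfl
  | cons p g ih => rw [List.foldl_cons, ih]; simp [gateStep]; omega

theorem Comp.exists_gates {X : Type} {V U : Set (X → Bool)} {s : ℕ} (h : Comp V s U) :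
    ∀ (w₀ : X → List Bool) (m : ℕ) (_ : ∀ x, (w₀ x).length = m)
      (_ : ∀ f ∈ V, ∃ i, ∀ x, (w₀ x).getD i false = f x),
      ∃ g : List (ℕ × ℕ), g.length ≤ s ∧
        ∀ f ∈ U, ∃ i, ∀ x, (g.foldl gateStep (w₀ x)).getD i false = f x := by
  induction h with
  | base h => exact fun w₀ m _ hV => ⟨[], by simp, fun f hf => hV f (h hf)⟩
  | @nand V U s f g hf hg _ ih =>
    intro w₀ m hm hV
    obtain ⟨i, hi⟩ := hV f hf
    obtain ⟨j, hj⟩ := hV g hg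
    obtain ⟨l, hl, H⟩ := ih (fun x => gateStep (w₀ x) (i, j)) (m + 1)
      (fun x => by simp [gateStep, hm]) (by
        rintro f' (rfl | hf')
        · refine ⟨m, fun x => ?_⟩
          simp only [gateStep, ← hm x, ← hi, ← hj]
          rw [List.getD_append_right _ _ _ _ (le_refl _)]
          simp
        · obtain ⟨k, hk⟩ := hV f' hf'
          by_cases hkm : k < m
          · refine ⟨k, fun x => ?_⟩
            rw [← hk x, gateStep, List.getD_append _ _ _ _ (by rw [hm]; exact hkm)]
          · -- a wire that does not exist has to stay one when wires are added
            refine ⟨m + 1, fun x => ?_⟩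
            rw [← hk x, List.getD_eq_default _ _ (by simp [gateStep, hm]),
              List.getD_eq_default _ _ (by rw [hm]; omega)])
    exact ⟨(i, j) :: l, by simpa using hl, fun f' hf' => by simpa using H f' hf'⟩

theorem Comp.hasCircuit {a b s : ℕ} {φ : Bits a → Bits b}
    (h : Comp (insert (fun _ => false) (coords id)) s (coords φ)) : HasCircuit s φ := by
  obtain ⟨g, hg, H⟩ := h.exists_gates (fun x => List.ofFn x) a (by simp) (by
    rintro f (rfl | ⟨i, rfl⟩)
    · exact ⟨a, fun x => List.getD_eq_default _ _ (by simp)⟩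
    · refine ⟨i, fun x => ?_⟩
      rw [List.getD_eq_getElem _ _ (by simp)]
      simp)
  choose o ho using fun j => H _ (mem_coords φ j)
  exact ⟨⟨g, o⟩, hg, fun x => funext fun j => ho j x⟩

theorem comp_foldl_gateStep {X : Type} (g : List (ℕ × ℕ)) :
    ∀ (V : Set (X → Bool)) (F : List (X → Bool)) (_ : (fun _ => false) ∈ V) (_ : ∀ f ∈ F, f ∈ V),
      Comp V g.length {f | ∃ i, f = fun x => (g.foldl gateStep (F.map fun f => f x)).getD i false} := by
  have key : ∀ (V : Set (X → Bool)) (F : List (X → Bool)) (_ : (fun _ => false) ∈ V)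
      (_ : ∀ f ∈ F, f ∈ V) (i : ℕ), (fun x => (F.map fun f => f x).getD i false) ∈ V := by
    intro V F h0 hF i
    by_cases hi : i < F.length
    · have : (fun x => (F.map fun f => f x).getD i false) = F[i] := by
        funext x
        rw [List.getD_eq_getElem _ _ (by simpa using hi), List.getElem_map]
      rw [this]
      exact hF _ (List.getElem_mem hi)
    · have : (fun x => (F.map fun f => f x).getD i false) = fun _ => false := by
        funext x
        rw [List.getD_eq_default _ _ (by simpa using hi)]
      rw [this]
      exact h0
  induction g with
  | nil =>
    intro V F h0 hF
    refine .base ?_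
    rintro f ⟨i, rfl⟩
    exact key V F h0 hF i
  | cons p g ih =>
    intro V F h0 hF
    refine .nand (key V F h0 hF p.1) (key V F h0 hF p.2) ?_
    have h := ih (insert (fun x => !((F.map fun f => f x).getD p.1 false &&
      (F.map fun f => f x).getD p.2 false)) V) (F ++ [fun x => !((F.map fun f => f x).getD p.1 false &&
      (F.map fun f => f x).getD p.2 false)]) (Set.mem_insert_of_mem _ h0) (by
        intro f hf
        rcases List.mem_append.1 hf with hf | hf
        · exact Set.mem_insert_of_mem _ (hF f hf)
        · rw [List.mem_singleton.1 hf]; exact Set.mem_insert _ _)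
    simpa [gateStep] using h

/-- A circuit for `φ`, applied to functions that are already available. -/
theorem HasCircuit.comp {X : Type} {V : Set (X → Bool)} {a b s : ℕ} {φ : Bits a → Bits b}
    (h : HasCircuit s φ) (hV : (fun _ => false) ∈ V) {θ : X → Bits a} (hθ : coords θ ⊆ V) :
    Comp V s (coords fun x => φ (θ x)) := by
  obtain ⟨C, hC, hφ⟩ := h
  refine ((comp_foldl_gateStep C.gates V (List.ofFn fun i x => θ x i) hV ?_).mono_right ?_).mono_size
    hC
  · intro f hf
    obtain ⟨i, rfl⟩ := (List.mem_ofFn' _ _).1 hf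
    exact hθ (mem_coords θ i)
  · rintro f ⟨j, rfl⟩
    refine ⟨C.out j, funext fun x => ?_⟩
    simp only [← hφ, Circuit.eval, Circuit.wires, List.map_ofFn]
    rfl

theorem Comp.circuit {X : Type} {V : Set (X → Bool)} {a b s t : ℕ} {φ : Bits a → Bits b}
    {θ : X → Bits a} (hθ : Comp V t (coords θ)) (h : HasCircuit s φ)
    (hV : (fun _ => false) ∈ V) : Comp V (t + s) (coords fun x => φ (θ x)) :=
  hθ.trans (h.comp (Set.mem_union_left _ hV) Set.subset_union_right)

theorem Comp.coords_of_forall {X : Type} {V : Set (X → Bool)} {b s : ℕ} {θ : X → Bits b}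
    (h : ∀ j, Comp V s {fun x => θ x j}) : Comp V (b * s) (coords θ) := by
  refine (Comp.iUnion h).mono_right ?_
  rintro f ⟨j, rfl⟩
  exact Set.mem_iUnion.2 ⟨j, rfl⟩

theorem Comp.append {X : Type} {V : Set (X → Bool)} {a b s t : ℕ} {θ : X → Bits a} {η : X → Bits b}
    (h : Comp V s (coords θ)) (h' : Comp V t (coords η)) :
    Comp V (s + t) (coords fun x => (Fin.append (θ x) (η x) : Bits (a + b))) := by
  refine (h.union h').mono_right ?_
  rintro f ⟨j, rfl⟩
  refine Fin.addCases (fun i => ?_) (fun i => ?_) j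
  · left; exact ⟨i, by simp⟩
  · right; exact ⟨i, by simp⟩

theorem comp_coords_const {X : Type} {V : Set (X → Bool)} (hV : (fun _ => false) ∈ V) {b : ℕ}
    (v : Bits b) : Comp V b (coords fun _ : X => v) := by
  have := Comp.coords_of_forall (θ := fun _ : X => v) fun j => Comp.single_const hV (v j)
  simpa using this

/-- Testing equality with a fixed string. -/
theorem comp_eq_const {X : Type} {V : Set (X → Bool)} (hV : (fun _ => false) ∈ V) {a : ℕ}
    {θ : X → Bits a} (hθ : coords θ ⊆ V) (v : Bits a) :
    Comp V (a * 23 + 1) {fun x => decide (θ x = v)} := by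
  have h := Comp.single_forall (V := V) (s := 21) hV (fun i x => !(xor (θ x i) (v i))) (fun i => by
    have h1 : Comp V 0 {fun x => θ x i} := .base (by simpa using hθ (mem_coords θ i))
    cases hv : v i
    · have := (h1.single_not).mono_size (show 0 + 1 ≤ 21 by omega)
      simpa using this
    · have := h1.mono_size (show 0 ≤ 21 by omega)
      simpa using this)
  have e : (fun x => decide (∀ i, (!(xor (θ x i) (v i))) = true)) = fun x => decide (θ x = v) := by
    funext x
    rw [decide_eq_decide, funext_iff]
    refine forall_congr' fun i => ?_
    cases θ x i <;> cases v i <;> simp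
  rw [e] at h
  exact h

/-! ### Hash functions with bounded independence -/

/-- On every set of at most `t` points, the hash function with a uniform key is distributed like a
uniformly random function. -/
def BoundedIndependent {K : Type} [Fintype K] {a b : ℕ} (t : ℕ) (h : K → Bits a → Bits b) : Prop :=
  ∀ S : Finset (Bits a), S.card ≤ t → ∀ Y : Bits a → Bits b,
    uniformAvg (fun k => if ∀ x ∈ S, h k x = Y x then (1 : ℝ) else 0) =
      uniformAvg (fun H : Bits a → Bits b => if ∀ x ∈ S, H x = Y x then (1 : ℝ) else 0)

theorem uniformAvg_fiber {G M : Type} [AddGroup G] [Fintype G] [AddGroup M] [Fintype M]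
    [DecidableEq M] (φ : G →+ M) (hφ : Function.Surjective φ) (y : M) :
    uniformAvg (fun g => if φ g = y then (1 : ℝ) else 0) = 1 / Fintype.card M := by
  have h1 : ∀ z : M, (Finset.univ.filter fun g => φ g = z).card =
      (Finset.univ.filter fun g => φ g = y).card := fun z =>
    AddMonoidHom.card_fiber_eq_of_mem_range φ (hφ z) (hφ y)
  have h2 : Fintype.card G = Fintype.card M * (Finset.univ.filter fun g => φ g = y).card := by
    rw [← Finset.card_univ, Finset.card_eq_sum_card_fiberwise (f := φ) (t := Finset.univ)
      (fun _ _ => Finset.mem_coe.2 (Finset.mem_univ _)), Finset.sum_congr rfl fun z _ => h1 z]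
    simp
  have h3 : (0 : ℝ) < Fintype.card G := by exact_mod_cast Fintype.card_pos
  unfold uniformAvg
  rw [Finset.sum_ite, Finset.sum_const_zero, add_zero, Finset.sum_const, nsmul_eq_mul, mul_one]
  rw [h2] at h3 ⊢
  push_cast at h3 ⊢
  have h4 : (Fintype.card M : ℝ) ≠ 0 := fun h => by simp [h] at h3
  have h5 : ((Finset.univ.filter fun g => φ g = y).card : ℝ) ≠ 0 := fun h => by simp [h] at h3
  field_simp

/-- The field element `1` of `ZMod 2` as the bit `true`. -/
def zmodBit (z : ZMod 2) : Bool := decide (z = 1)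

theorem zmodBit_add (y z : ZMod 2) : zmodBit (y + z) = xor (zmodBit y) (zmodBit z) := by
  revert y z; decide

theorem zmodBit_mul (y z : ZMod 2) : zmodBit (y * z) = (zmodBit y && zmodBit z) := by
  revert y z; decide

theorem zmodBit_ite (c : Bool) : zmodBit (if c then 1 else 0) = c := by revert c; decide

theorem zmodBit_eq_iff (z : ZMod 2) (c : Bool) : zmodBit z = c ↔ z = if c then 1 else 0 := by
  revert z c; decide

theorem zmodBit_list_sum (l : List (ZMod 2)) :
    zmodBit l.sum = l.foldr (fun z b => xor (zmodBit z) b) false := by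
  induction l with
  | nil => decide
  | cons z l ih => rw [List.sum_cons, zmodBit_add, ih, List.foldr_cons]

theorem uniformAvg_bits_fiber {G : Type} [AddGroup G] [Fintype G] {a b : ℕ} (S : Finset (Bits a))
    (φ : G →+ (S → Fin b → ZMod 2)) (hφ : Function.Surjective φ) (Y : Bits a → Bits b) :
    uniformAvg (fun g => if ∀ x : S, (fun j => zmodBit (φ g x j)) = Y x then (1 : ℝ) else 0) =
      1 / Fintype.card (S → Fin b → ZMod 2) := by
  rw [← uniformAvg_fiber φ hφ fun x j => if Y x j then 1 else 0]
  congr 1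
  funext g
  congr 1
  simp only [funext_iff, zmodBit_eq_iff]

theorem uniformAvg_random_function {a b : ℕ} (S : Finset (Bits a)) (Y : Bits a → Bits b) :
    uniformAvg (fun H : Bits a → Bits b => if ∀ x ∈ S, H x = Y x then (1 : ℝ) else 0) =
      1 / Fintype.card (S → Fin b → ZMod 2) := by
  let φ : (Bits a → Fin b → ZMod 2) →+ (S → Fin b → ZMod 2) :=
    { toFun := fun H x => H x, map_zero' := rfl, map_add' := fun _ _ => rfl }
  have hφ : Function.Surjective φ := by
    intro Z
    refine ⟨fun x => if h : x ∈ S then Z ⟨x, h⟩ else 0, ?_⟩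
    funext x
    simp [φ]
  rw [← uniformAvg_bits_fiber S φ hφ Y]
  let e₀ : ZMod 2 ≃ Bool :=
    { toFun := zmodBit
      invFun := fun c => if c then 1 else 0
      left_inv := fun z => ((zmodBit_eq_iff z _).1 rfl).symm
      right_inv := zmodBit_ite }
  let e : (Bits a → Fin b → ZMod 2) ≃ (Bits a → Bits b) :=
    Equiv.piCongrRight fun _ => Equiv.piCongrRight fun _ => e₀
  rw [← uniformAvg_equiv e]
  congr 1
  funext H
  simp only [Subtype.forall]
  rfl

section Field

variable {K : Type} [Field K] [Algebra (ZMod 2) K] {m : ℕ}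
  (B : Module.Basis (Fin m) (ZMod 2) K)

/-- The bits of a field element, with respect to a basis over `ZMod 2`. -/
def fieldBits (u : K) : Bits m := fun j => zmodBit (B.repr u j)

/-- The field element encoded by a string of at most `m` bits. -/
def fieldPoint {a : ℕ} (x : Bits a) : K :=
  B.equivFun.symm fun i => if h : (i : ℕ) < a then (if x ⟨i, h⟩ then 1 else 0) else 0

/-- The polynomial with coefficients `key`, evaluated at the field element `x`, cut to `b` bits. -/
def polyHash {a b t : ℕ} (hb : b ≤ m) (key : Fin t → K) (x : Bits a) : Bits b := fun j =>
  fieldBits B (∑ i, key i * fieldPoint B x ^ (i : ℕ)) (Fin.castLE hb j)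

theorem repr_fieldPoint {a : ℕ} (x : Bits a) (i : Fin m) : B.repr (fieldPoint B x) i =
    if h : (i : ℕ) < a then (if x ⟨i, h⟩ then 1 else 0) else 0 := by
  have := congrFun (B.equivFun.apply_symm_apply fun i : Fin m =>
    if h : (i : ℕ) < a then (if x ⟨i, h⟩ then (1 : ZMod 2) else 0) else 0) i
  rwa [Module.Basis.equivFun_apply] at this

theorem fieldPoint_injective {a : ℕ} (ha : a ≤ m) :
    Function.Injective (fieldPoint B : Bits a → K) := by
  intro x y h
  funext i
  have h1 := repr_fieldPoint B x (Fin.castLE ha i)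
  rw [h, repr_fieldPoint] at h1
  have hi : ((Fin.castLE ha i : Fin m) : ℕ) < a := i.2
  rw [dif_pos hi, dif_pos hi] at h1
  have h2 := congrArg zmodBit h1
  rw [zmodBit_ite, zmodBit_ite] at h2
  exact h2.symm

theorem polyHash_boundedIndependent [Fintype K] {a b : ℕ} (t : ℕ) (ha : a ≤ m) (hb : b ≤ m) :
    BoundedIndependent t (polyHash B hb : (Fin t → K) → Bits a → Bits b) := by
  intro S hS Y
  rw [uniformAvg_random_function]
  let φ : (Fin t → K) →+ (S → Fin b → ZMod 2) :=
    { toFun := fun key x j =>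
        B.repr (∑ i, key i * fieldPoint B (x : Bits a) ^ (i : ℕ)) (Fin.castLE hb j)
      map_zero' := by funext x j; simp
      map_add' := fun k k' => by
        funext x j
        simp [add_mul, Finset.sum_add_distrib] }
  have hφ : Function.Surjective φ := by
    classical
    intro Z
    -- the values to be interpolated have the prescribed first `b` bits
    let v : Bits a → K := fun x => B.equivFun.symm fun i =>
      if h : x ∈ S ∧ (i : ℕ) < b then Z ⟨x, h.1⟩ ⟨i, h.2⟩ else 0
    have hinj : Set.InjOn (fieldPoint B : Bits a → K) S := (fieldPoint_injective B ha).injOn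
    let P := Lagrange.interpolate S (fieldPoint B) v
    have hP : ∀ x ∈ S, P.eval (fieldPoint B x) = v x := fun x hx =>
      Lagrange.eval_interpolate_at_node v hinj hx
    have hdeg : P.degree < t := (Lagrange.degree_interpolate_lt v hinj).trans_le (by exact_mod_cast hS)
    refine ⟨fun i => P.coeff i, ?_⟩
    funext x j
    have h1 : ∑ i : Fin t, P.coeff i * fieldPoint B (x : Bits a) ^ (i : ℕ) = v x := by
      rw [← hP x x.2, Fin.sum_univ_eq_sum_range (fun i => P.coeff i * fieldPoint B (x : Bits a) ^ i) t]
      by_cases hP0 : P = 0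
      · simp [hP0]
      · rw [Polynomial.eval_eq_sum_range' ((Polynomial.natDegree_lt_iff_degree_lt hP0).2 hdeg)]
    change B.repr (∑ i : Fin t, P.coeff i * fieldPoint B (x : Bits a) ^ (i : ℕ)) _ = _
    rw [h1]
    have h2 := congrFun (B.equivFun.apply_symm_apply fun i : Fin m =>
      if h : (x : Bits a) ∈ S ∧ (i : ℕ) < b then Z ⟨x, h.1⟩ ⟨i, h.2⟩ else 0) (Fin.castLE hb j)
    rw [Module.Basis.equivFun_apply] at h2
    refine h2.trans ?_
    have h3 : (x : Bits a) ∈ S ∧ ((Fin.castLE hb j : Fin m) : ℕ) < b := ⟨x.2, j.2⟩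
    rw [dif_pos h3]
    rfl
  rw [← uniformAvg_bits_fiber S φ hφ Y]
  congr 1
  funext g
  simp only [Subtype.forall]
  rfl

theorem repr_mul (u v : K) (k : Fin m) : B.repr (u * v) k =
    ((Finset.univ : Finset (Fin m × Fin m)).toList.map fun p =>
      B.repr u p.1 * B.repr v p.2 * B.repr (B p.1 * B p.2) k).sum := by
  rw [Finset.sum_map_toList, Fintype.sum_prod_type]
  conv_lhs => rw [← B.sum_repr u, ← B.sum_repr v, Finset.sum_mul_sum]
  simp only [map_sum, Finsupp.coe_finsetSum, Finset.sum_apply, smul_mul_smul_comm, map_smul,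
    Finsupp.smul_apply, smul_eq_mul]

theorem comp_mul_add {X : Type} {V : Set (X → Bool)} (hV : (fun _ => false) ∈ V) {u v : X → K}
    (hu : coords (fun x => fieldBits B (u x)) ⊆ V) (hv : coords (fun x => fieldBits B (v x)) ⊆ V)
    (c : K) : Comp V (m * ((m * m + 1) * 22)) (coords fun x => fieldBits B (u x * v x + c)) := by
  refine Comp.coords_of_forall fun k => ?_
  let F : Fin m × Fin m → X → Bool := fun p x =>
    zmodBit (B.repr (u x) p.1 * B.repr (v x) p.2 * B.repr (B p.1 * B p.2) k)
  have hF : ∀ p, Comp V 2 {F p} := by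
    intro p
    have h1 : Comp V 0 {fun x => zmodBit (B.repr (u x) p.1)} := .base (Set.singleton_subset_iff.2 (hu ⟨p.1, rfl⟩))
    have h2 : Comp V 0 {fun x => zmodBit (B.repr (v x) p.2)} := .base (Set.singleton_subset_iff.2 (hv ⟨p.2, rfl⟩))
    have h3 := h1.single_and h2
    rcases hb : zmodBit (B.repr (B p.1 * B p.2) k) with _ | _
    · have : F p = fun _ => false := by funext x; simp [F, zmodBit_mul, hb]
      rw [this]
      exact .base (by simpa using hV)
    · have : F p = fun x => zmodBit (B.repr (u x) p.1) && zmodBit (B.repr (v x) p.2) := by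
        funext x; simp [F, zmodBit_mul, hb]
      rw [this]
      exact h3.mono_size (by omega)
  have h := Comp.single_parity hV ((fun _ => zmodBit (B.repr c k)) ::
    (Finset.univ : Finset (Fin m × Fin m)).toList.map F) (s := 2) (by
      intro f hf
      rcases List.mem_cons.1 hf with rfl | hf
      · exact (Comp.single_const hV _).mono_size (by omega)
      · obtain ⟨p, _, rfl⟩ := List.mem_map.1 hf
        exact hF p)
  have hlen : ((fun _ : X => zmodBit (B.repr c k)) ::
      (Finset.univ : Finset (Fin m × Fin m)).toList.map F).length = m * m + 1 := by
    simp
  rw [hlen] at h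
  convert h using 2
  funext x
  rw [fieldBits, map_add, Finsupp.add_apply, zmodBit_add, repr_mul, List.foldr_cons,
    Bool.xor_comm, zmodBit_list_sum, List.foldr_map, List.foldr_map]

theorem comp_horner {X : Type} {V : Set (X → Bool)} (hV : (fun _ => false) ∈ V) {z : X → K}
    (hz : coords (fun x => fieldBits B (z x)) ⊆ V) (t : ℕ) (key : Fin t → K) :
    Comp V (t * (m * ((m * m + 1) * 22)))
      (coords fun x => fieldBits B (∑ i, key i * z x ^ (i : ℕ))) := by
  induction t with
  | zero =>
    refine .base ?_
    rintro f ⟨j, rfl⟩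
    simpa [fieldBits, zmodBit] using hV
  | succ t ih =>
    have h := (ih fun i => key i.succ).trans (comp_mul_add B (Set.mem_union_left _ hV)
      Set.subset_union_right (hz.trans Set.subset_union_left) (key 0))
    rw [Nat.succ_mul]
    convert h using 3
    rename_i x
    rw [Fin.sum_univ_succ, Finset.sum_mul, add_comm]
    simp [pow_succ, mul_assoc]

theorem polyHash_hasCircuit {a b t : ℕ} (hb : b ≤ m) (key : Fin t → K) :
    HasCircuit (t * (m * ((m * m + 1) * 22))) (polyHash B hb key : Bits a → Bits b) := by
  have hV : (fun _ => false) ∈ insert (fun _ => false) (coords (id : Bits a → Bits a)) :=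
    Set.mem_insert _ _
  refine Comp.hasCircuit ((comp_horner B hV (z := fieldPoint B) ?_ t key).mono_right ?_)
  · rintro f ⟨j, rfl⟩
    simp only [fieldBits, repr_fieldPoint]
    by_cases hj : (j : ℕ) < a
    · right
      exact ⟨⟨j, hj⟩, by simp [hj, zmodBit_ite]⟩
    · left
      simp [hj, zmodBit]
  · rintro f ⟨j, rfl⟩
    exact ⟨Fin.castLE hb j, rfl⟩

end Field

/-- The size of the hash circuits. -/
def hashSize (a b t : ℕ) : ℕ := t * ((a + b + 1) * (((a + b + 1) * (a + b + 1) + 1) * 22))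

/-- For all `a`, `b`, `t` there is a `t`-wise independent family of functions from `a` to `b` bits all
of whose members have small circuits: polynomials of degree less than `t` over a field with
`2 ^ (a + b + 1)` elements. -/
theorem exists_boundedIndependent (a b t : ℕ) :
    ∃ (K : Type) (_ : Fintype K) (_ : Nonempty K) (h : K → Bits a → Bits b),
      BoundedIndependent t h ∧ ∀ k, HasCircuit (hashSize a b t) (h k) := by
  have : Fact (Nat.Prime 2) := ⟨Nat.prime_two⟩
  let F := GaloisField 2 (a + b + 1)
  let _ : Fintype F := Fintype.ofFinite F
  let B : Module.Basis (Fin (a + b + 1)) (ZMod 2) F :=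
    Module.finBasisOfFinrankEq _ _ (GaloisField.finrank 2 (Nat.succ_ne_zero _))
  exact ⟨Fin t → F, inferInstance, inferInstance, polyHash B (by omega),
    polyHash_boundedIndependent B t (by omega) (by omega), fun k => polyHash_hasCircuit B _ k⟩

/-! ### Toffoli gates from the universal gate set -/

/-- Running a list of gates. -/
def applyGates {k : ℕ} (gs : List (Gate k)) (ψ : QState k) : QState k :=
  gs.foldl (fun φ g => g.apply φ) ψ

theorem applyGates_append {k : ℕ} (gs hs : List (Gate k)) (ψ : QState k) :
    applyGates (gs ++ hs) ψ = applyGates hs (applyGates gs ψ) := List.foldl_append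

theorem applyGates_cons {k : ℕ} (g : Gate k) (gs : List (Gate k)) (ψ : QState k) :
    applyGates (g :: gs) ψ = applyGates gs (g.apply ψ) := rfl

/-- The gates `gs` permute the basis states; the permutation is given by its inverse `π`. -/
def Implements {k : ℕ} (gs : List (Gate k)) (π : Bits k → Bits k) : Prop :=
  ∀ ψ, applyGates gs ψ = fun x => ψ (π x)

theorem Implements.append {k : ℕ} {gs hs : List (Gate k)} {π ρ : Bits k → Bits k}
    (hg : Implements gs π) (hh : Implements hs ρ) : Implements (gs ++ hs) fun x => π (ρ x) := by
  intro ψ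
  rw [applyGates_append, hg, hh]

/-- The gates `gs` multiply the amplitudes by the phases `d`. -/
def Diagonal {k : ℕ} (gs : List (Gate k)) (d : Bits k → ℂ) : Prop :=
  ∀ ψ, applyGates gs ψ = fun x => d x * ψ x

theorem Diagonal.append {k : ℕ} {gs hs : List (Gate k)} {d d' : Bits k → ℂ}
    (hg : Diagonal gs d) (hh : Diagonal hs d') : Diagonal (gs ++ hs) fun x => d' x * d x := by
  intro ψ
  rw [applyGates_append, hg, hh]
  funext x
  ring

/-- The phase of the `π/8` gate. -/
def omega8 : ℂ := Complex.exp (Complex.I * Real.pi / 4)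

theorem omega8_pow_four : omega8 ^ 4 = -1 := by
  rw [omega8, ← Complex.exp_nat_mul, ← Complex.exp_pi_mul_I]
  congr 1
  push_cast
  ring

theorem diagonal_piEighth {k : ℕ} (i : Fin k) (j : ℕ) :
    Diagonal (List.replicate j (Gate.piEighth i)) fun x => (if x i then omega8 else 1) ^ j := by
  induction j with
  | zero => intro ψ; funext x; simp [applyGates]
  | succ j ih =>
    intro ψ
    rw [List.replicate_succ, applyGates_cons, ih]
    funext x
    simp only [Gate.apply, omega8]
    ring

theorem Diagonal.conj_cnot {k : ℕ} {gs : List (Gate k)} {d : Bits k → ℂ} (hg : Diagonal gs d)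
    {c t : Fin k} (h : c ≠ t) : Diagonal (Gate.cnot c t h :: (gs ++ [Gate.cnot c t h]))
      fun x => d (Function.update x t (xor (x t) (x c))) := by
  intro ψ
  rw [applyGates_cons, applyGates_append, hg]
  funext x
  simp [applyGates, Gate.apply, Function.update_of_ne h]

/-- The gates of a doubly controlled phase flip, from `4abc = a + b + c - (a ⊕ b) - (b ⊕ c) -
(a ⊕ c) + (a ⊕ b ⊕ c)`. -/
theorem exists_diagonal_ccz {k : ℕ} {a b t : Fin k} (hab : a ≠ b) (hat : a ≠ t) (hbt : b ≠ t) :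
    ∃ gs : List (Gate k), gs.length ≤ 40 ∧
      Diagonal gs fun x => if (x a && x b) && x t then -1 else 1 := by
  have h1 := diagonal_piEighth a 1
  have h2 := diagonal_piEighth b 1
  have h3 := diagonal_piEighth t 1
  have h4 := (diagonal_piEighth b 7).conj_cnot hab
  have h5 := (diagonal_piEighth t 7).conj_cnot hbt
  have h6 := (diagonal_piEighth t 7).conj_cnot hat
  have h7 := ((diagonal_piEighth t 1).conj_cnot hbt).conj_cnot hat
  refine ⟨_, ?_, fun ψ => ((((((h1.append h2).append h3).append h4).append h5).append h6).append h7
    ψ).trans (funext fun x => congrArg (· * ψ x) ?_)⟩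
  · simp
  · have e4 := omega8_pow_four
    have e16 : omega8 ^ 16 = 1 := by
      rw [show (16 : ℕ) = 4 * 4 from rfl, pow_mul, e4]; norm_num
    simp only [Function.update_self,
      Function.update_of_ne hbt]
    rcases x a <;> rcases x b <;> rcases x t <;> simp <;>
      first | done | linear_combination e16 | linear_combination e4

/-- Conjugating a phase flip controlled by `A` and `t` by Hadamard gates gives a bit flip controlled
by `A`. -/
theorem Diagonal.conj_hadamard {k : ℕ} {gs : List (Gate k)} {t : Fin k} {A : Bits k → Bool}
    (hA : ∀ x v, A (Function.update x t v) = A x)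
    (hg : Diagonal gs fun x => if A x && x t then -1 else 1) :
    Implements (Gate.hadamard t :: (gs ++ [Gate.hadamard t]))
      fun x => Function.update x t (xor (x t) (A x)) := by
  intro ψ
  rw [applyGates_cons, applyGates_append, hg]
  funext x
  have h2 : (Real.sqrt 2 : ℂ) * Real.sqrt 2 = 2 := by
    rw [← Complex.ofReal_mul, Real.mul_self_sqrt (by norm_num)]; norm_num
  have h0 : (Real.sqrt 2 : ℂ) ≠ 0 := by
    intro h; rw [h] at h2; norm_num at h2
  have hr : ψ (Function.update x t (xor (x t) (A x))) =
      if xor (x t) (A x) then ψ (Function.update x t true) else ψ (Function.update x t false) := by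
    cases xor (x t) (A x) <;> rfl
  rw [hr]
  simp only [applyGates, List.foldl_cons, List.foldl_nil, Gate.apply, hA, Function.update_self,
    Function.update_idem]
  generalize ψ (Function.update x t false) = p
  generalize ψ (Function.update x t true) = q
  cases A x <;> cases x t <;> simp <;> field_simp <;> rw [pow_two, h2] <;> ring

theorem implements_cnot {k : ℕ} {c t : Fin k} (h : c ≠ t) :
    Implements [Gate.cnot c t h] fun x => Function.update x t (xor (x t) (x c)) := fun _ => rfl

theorem exists_implements_not {k : ℕ} (t : Fin k) : ∃ gs : List (Gate k), gs.length ≤ 4 ∧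
    Implements gs fun x => Function.update x t (!(x t)) := by
  have h : Diagonal [Gate.phase t, Gate.phase t] fun x => if true && x t then -1 else 1 := by
    intro ψ
    funext x
    simp only [applyGates, List.foldl_cons, List.foldl_nil, Gate.apply]
    cases x t <;> simp [← mul_assoc]
  refine ⟨_, ?_, by simpa using h.conj_hadamard (A := fun _ => true) fun _ _ => rfl⟩
  simp

theorem exists_implements_toffoli {k : ℕ} {a b t : Fin k} (hab : a ≠ b) (hat : a ≠ t)
    (hbt : b ≠ t) : ∃ gs : List (Gate k), gs.length ≤ 42 ∧
      Implements gs fun x => Function.update x t (xor (x t) (x a && x b)) := by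
  obtain ⟨gs, hlen, hgs⟩ := exists_diagonal_ccz hab hat hbt
  exact ⟨_, by simp; omega, hgs.conj_hadamard (A := fun x => x a && x b) fun x v => by
    simp [Function.update_of_ne hat, Function.update_of_ne hbt]⟩

/-! ### Reversible evaluation of Boolean circuits -/

/-- The value of a wire that may not exist. -/
def wireVal {k : ℕ} (x : Bits k) : Option (Fin k) → Bool
  | none => false
  | some i => x i

theorem wireVal_update_of_ne {k : ℕ} (x : Bits k) {t : Fin k} (v : Bool) {r : Option (Fin k)}
    (h : r ≠ some t) : wireVal (Function.update x t v) r = wireVal x r := by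
  cases r with
  | none => rfl
  | some i => exact Function.update_of_ne (fun hi => h (by rw [hi])) _ _

theorem exists_implements_nand {k : ℕ} (r₁ r₂ : Option (Fin k)) (t : Fin k) (h₁ : r₁ ≠ some t)
    (h₂ : r₂ ≠ some t) : ∃ gs : List (Gate k), gs.length ≤ 50 ∧
      Implements gs fun x =>
        Function.update x t (xor (x t) (!(wireVal x r₁ && wireVal x r₂))) := by
  obtain ⟨ns, hns, hn⟩ := exists_implements_not t
  -- it is enough to XOR the conjunction into the target, which is then negated
  suffices H : ∃ gs : List (Gate k), gs.length ≤ 42 ∧ Implements gs fun x =>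
      Function.update x t (xor (x t) (wireVal x r₁ && wireVal x r₂)) by
    obtain ⟨gs, hgs, hg⟩ := H
    refine ⟨ns ++ gs, by simp; omega, ?_⟩
    have := hn.append hg
    simpa only [Function.update_self, Function.update_idem, Bool.xor_not, Bool.not_xor] using this
  rcases r₁ with _ | i
  · exact ⟨[], by simp, fun ψ => by simp [applyGates, wireVal]⟩
  rcases r₂ with _ | j
  · exact ⟨[], by simp, fun ψ => by simp [applyGates, wireVal]⟩
  have hi : i ≠ t := fun h => h₁ (by rw [h])
  have hj : j ≠ t := fun h => h₂ (by rw [h])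
  by_cases hij : i = j
  · subst hij
    exact ⟨[Gate.cnot i t hi], by simp, by simpa [wireVal] using implements_cnot hi⟩
  · exact exists_implements_toffoli hij hi hj

section XorResponse

variable {a b k : ℕ} (e : Fin a ⊕ Fin b ↪ Fin k)

theorem xorResponse_inr (v : Bits b) (x : Bits k) (j : Fin b) :
    xorResponse e v x (e (Sum.inr j)) = xor (x (e (Sum.inr j))) (v j) := by
  have : (∃ j', e (Sum.inr j') = e (Sum.inr j) ∧ v j' = true) ↔ v j = true := by
    constructor
    · rintro ⟨j', h, hv⟩
      rw [← Sum.inr.inj (e.injective h)]; exact hv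
    · exact fun h => ⟨j, rfl, h⟩
  simp only [xorResponse, this, Bool.decide_coe]

theorem xorResponse_of_ne (v : Bits b) (x : Bits k) {w : Fin k} (h : ∀ j, e (Sum.inr j) ≠ w) :
    xorResponse e v x w = x w := by
  simp [xorResponse, h]

theorem xorResponse_inl (v : Bits b) (x : Bits k) (i : Fin a) :
    xorResponse e v x (e (Sum.inl i)) = x (e (Sum.inl i)) :=
  xorResponse_of_ne e v x fun j h => by simpa using e.injective h

theorem queryBits_xorResponse (v : Bits b) (x : Bits k) :
    queryBits e (xorResponse e v x) = queryBits e x :=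
  funext fun i => xorResponse_inl e v x i

theorem xorResponse_xorResponse (u v : Bits b) (x : Bits k) :
    xorResponse e u (xorResponse e v x) = xorResponse e (fun j => xor (v j) (u j)) x := by
  funext w
  by_cases h : ∃ j, e (Sum.inr j) = w
  · obtain ⟨j, rfl⟩ := h
    simp [xorResponse_inr]
  · push Not at h
    simp [xorResponse_of_ne e _ _ h]

theorem xorResponse_false (x : Bits k) : xorResponse e (fun _ => false) x = x := by
  funext w
  simp [xorResponse]

theorem xorResponse_self (v : Bits b) (x : Bits k) :
    xorResponse e v (xorResponse e v x) = x := by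
  rw [xorResponse_xorResponse]
  simpa using xorResponse_false e x

end XorResponse

/-- Copying wires into the response register. -/
theorem exists_implements_copy {a b k : ℕ} (e : Fin a ⊕ Fin b ↪ Fin k) (r : Fin b → Option (Fin k))
    (hr : ∀ i j, r i ≠ some (e (Sum.inr j))) : ∃ gs : List (Gate k), gs.length ≤ b ∧
      Implements gs fun x => xorResponse e (fun j => wireVal x (r j)) x := by
  have key : ∀ t ≤ b, ∃ gs : List (Gate k), gs.length ≤ t ∧ Implements gs fun x =>
      xorResponse e (fun j => if (j : ℕ) < t then wireVal x (r j) else false) x := by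
    intro t
    induction t with
    | zero =>
      exact fun _ => ⟨[], by simp, fun ψ => by simp [applyGates, xorResponse_false]⟩
    | succ t ih =>
      intro ht
      obtain ⟨gs, hlen, hgs⟩ := ih (by omega)
      let j₀ : Fin b := ⟨t, by omega⟩
      have hstep : ∃ hs : List (Gate k), hs.length ≤ 1 ∧ Implements hs fun x =>
          Function.update x (e (Sum.inr j₀)) (xor (x (e (Sum.inr j₀))) (wireVal x (r j₀))) := by
        cases h : r j₀ with
        | none => exact ⟨[], by simp, fun ψ => by simp [applyGates, wireVal]⟩
        | some i =>
          exact ⟨_, by simp, implements_cnot (fun hi => hr j₀ j₀ (by rw [h, hi]))⟩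
      obtain ⟨hs, hhs, hstep⟩ := hstep
      refine ⟨gs ++ hs, by simp; omega, ?_⟩
      have := hgs.append hstep
      convert this using 2 with x
      simp only [wireVal_update_of_ne x _ (hr _ j₀)]
      funext w
      by_cases hw : ∃ j, e (Sum.inr j) = w
      · obtain ⟨j, rfl⟩ := hw
        rw [xorResponse_inr, xorResponse_inr]
        by_cases hj : j = j₀
        · subst hj
          simp [j₀]
        · have hne : e (Sum.inr j) ≠ e (Sum.inr j₀) := fun h =>
            hj (Sum.inr.inj (e.injective h))
          have hjt : (j : ℕ) ≠ t := fun h => hj (Fin.ext h)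
          rw [Function.update_of_ne hne]
          congr 2
          exact propext (by omega)
      · push Not at hw
        rw [xorResponse_of_ne e _ _ hw, xorResponse_of_ne e _ _ hw,
          Function.update_of_ne (hw j₀).symm]
  obtain ⟨gs, hlen, hgs⟩ := key b le_rfl
  exact ⟨gs, hlen, by simpa using hgs⟩

section Clean

variable {a b k : ℕ} (C : Circuit a b) (e : Fin a ⊕ Fin b ↪ Fin k)
  (w : Fin C.gates.length ↪ Fin k)

/-- The qubit that holds wire `i` of a circuit when the first `t` gates have been evaluated. -/
def wireRef (t i : ℕ) : Option (Fin k) :=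
  if h : i < a then some (e (Sum.inl ⟨i, h⟩))
  else if h : i < a + t ∧ i - a < C.gates.length then some (w ⟨i - a, h.2⟩) else none

variable {C e w}

theorem wireRef_ne_inr (hew : ∀ i j, e i ≠ w j) (t i : ℕ) (j : Fin b) :
    wireRef C e w t i ≠ some (e (Sum.inr j)) := by
  unfold wireRef
  split_ifs
  · intro h; simpa using e.injective (Option.some.inj h)
  · intro h; exact hew _ _ (Option.some.inj h).symm
  · simp

theorem wireRef_ne_work (hew : ∀ i j, e i ≠ w j) (t i : ℕ) (j : Fin C.gates.length)
    (h : t ≤ j) : wireRef C e w t i ≠ some (w j) := by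
  unfold wireRef
  split_ifs with h1 h2
  · intro h'; exact hew _ _ (Option.some.inj h')
  · intro h'
    have := congrArg Fin.val (w.injective (Option.some.inj h'))
    simp at this
    omega
  · simp

theorem exists_compute (hew : ∀ i j, e i ≠ w j) : ∀ t ≤ C.gates.length,
    ∃ (gB gF : List (Gate k)) (B F : Bits k → Bits k), gB.length ≤ 50 * t ∧ gF.length ≤ 50 * t ∧
      Implements gB B ∧ Implements gF F ∧ (∀ x, B (F x) = x) ∧ (∀ x, F (B x) = x) ∧
      (∀ u x, F (xorResponse e u x) = xorResponse e u (F x)) ∧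
      (∀ x i, F x (e i) = x (e i)) ∧
      (∀ x (j : Fin C.gates.length), t ≤ j → F x (w j) = x (w j)) ∧
      ∀ x, (∀ j, x (w j) = false) → ∀ i, wireVal (F x) (wireRef C e w t i) =
        ((C.gates.take t).foldl gateStep (List.ofFn (queryBits e x))).getD i false := by
  intro t
  induction t with
  | zero =>
    intro _
    refine ⟨[], [], id, id, by simp, by simp, fun ψ => rfl, fun ψ => rfl, fun _ => rfl,
      fun _ => rfl, fun _ _ => rfl, fun _ _ => rfl, fun _ _ _ => rfl, fun x _ i => ?_⟩
    simp only [List.take_zero, List.foldl_nil, id]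
    unfold wireRef
    split_ifs with h1 h2
    · rw [List.getD_eq_getElem _ _ (by simpa using h1)]
      simp [wireVal, queryBits]
    · omega
    · rw [List.getD_eq_default _ _ (by simpa using h1)]
      rfl
  | succ t ih =>
    intro ht
    obtain ⟨gB, gF, B, F, hB, hF, iB, iF, hBF, hFB, hxor, hin, hrest, hval⟩ := ih (by omega)
    let j₀ : Fin C.gates.length := ⟨t, by omega⟩
    let p := C.gates[t]
    obtain ⟨gs, hgs, hop⟩ := exists_implements_nand (wireRef C e w t p.1) (wireRef C e w t p.2)
      (w j₀) (wireRef_ne_work hew t _ j₀ le_rfl) (wireRef_ne_work hew t _ j₀ le_rfl)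
    set op : Bits k → Bits k := fun x => Function.update x (w j₀) (xor (x (w j₀))
      (!(wireVal x (wireRef C e w t p.1) && wireVal x (wireRef C e w t p.2)))) with hop_def
    have hval_update : ∀ x v i, wireVal (Function.update x (w j₀) v) (wireRef C e w t i) =
        wireVal x (wireRef C e w t i) := fun x v i =>
      wireVal_update_of_ne x v (wireRef_ne_work hew t _ j₀ le_rfl)
    have hop_op : ∀ x, op (op x) = x := by
      intro x
      simp [hop_def, hval_update]
    have hval_xor : ∀ u x i, wireVal (xorResponse e u x) (wireRef C e w t i) =
        wireVal x (wireRef C e w t i) := by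
      intro u x i
      cases h : wireRef C e w t i with
      | none => rfl
      | some q =>
        refine xorResponse_of_ne e u x fun j hj => ?_
        exact wireRef_ne_inr hew t i j (by rw [h, hj])
    refine ⟨gB ++ gs, gs ++ gF, fun x => B (op x), fun x => op (F x), ?_, ?_, iB.append hop,
      hop.append iF, fun x => by simp only [hop_op, hBF],
      fun x => by simp only [hFB, hop_op], ?_, ?_, ?_, ?_⟩
    · rw [List.length_append]; omega
    · rw [List.length_append]; omega
    · intro u x
      simp only [hop_def, hxor, hval_xor]
      rw [xorResponse_of_ne e u _ fun j => hew _ _]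
      funext q
      by_cases hq : q = w j₀
      · subst hq
        rw [Function.update_self, xorResponse_of_ne e u _ fun j => hew _ _, Function.update_self]
      · rw [Function.update_of_ne hq]
        simp only [xorResponse, Function.update_of_ne hq]
    · intro x i
      simp only [hop_def]
      rw [Function.update_of_ne (hew _ _), hin]
    · intro x j hj
      have hne : w j ≠ w j₀ := fun h => by
        have := congrArg Fin.val (w.injective h)
        simp [j₀] at this
        omega
      simp only [hop_def]
      rw [Function.update_of_ne hne, hrest x j (by omega)]
    · intro x hx i
      have hlen : ((C.gates.take t).foldl gateStep (List.ofFn (queryBits e x))).length = a + t := by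
        rw [length_foldl_gateStep]
        simp; omega
      rw [List.take_add_one, List.getElem?_eq_getElem (show t < C.gates.length by omega)]
      rw [Option.toList_some, List.foldl_append]
      simp only [List.foldl_cons, List.foldl_nil, gateStep]
      rw [← hval x hx, ← hval x hx]
      rcases lt_trichotomy i (a + t) with h | h | h
      · rw [List.getD_append _ _ _ _ (by rw [hlen]; exact h), ← hval x hx]
        have : wireRef C e w (t + 1) i = wireRef C e w t i := by
          unfold wireRef
          simp [h, show i < a + (t + 1) by omega]
        rw [this, hop_def]
        exact hval_update _ _ _
      · rw [List.getD_append_right _ _ _ _ (by rw [hlen]; omega), hlen]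
        have : wireRef C e w (t + 1) i = some (w j₀) := by
          unfold wireRef
          simp [h, j₀]
          omega
        rw [this]
        simp only [wireVal, hop_def, Function.update_self]
        rw [hrest x j₀ le_rfl, hx]
        simp [h, p]
      · rw [List.getD_eq_default _ _ (by simp [hlen]; omega)]
        have : wireRef C e w (t + 1) i = none := by
          unfold wireRef
          rw [dif_neg (by omega), dif_neg (by omega)]
        rw [this]
        rfl

/-- A Boolean circuit can be evaluated by `O(size)` gates with clean workspace: compute all wires,
copy the outputs into the response register, uncompute. -/
theorem exists_clean_circuit (hew : ∀ i j, e i ≠ w j) :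
    ∃ gs : List (Gate k), gs.length ≤ 100 * C.gates.length + b ∧
      ∀ ψ : QState k, (∀ x, ψ x ≠ 0 → ∀ j, x (w j) = false) →
        applyGates gs ψ = applyOracle C.eval e ψ := by
  obtain ⟨gB, gF, B, F, hB, hF, iB, iF, hBF, hFB, hxor, hin, -, hval⟩ :=
    exists_compute hew C.gates.length le_rfl
  let r : Fin b → Option (Fin k) := fun j => wireRef C e w C.gates.length (C.out j)
  obtain ⟨gc, hgc, ic⟩ := exists_implements_copy e r fun i j => wireRef_ne_inr hew _ _ j
  set copy : Bits k → Bits k := fun x => xorResponse e (fun j => wireVal x (r j)) x with hcopy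
  have hcc : ∀ x, copy (copy x) = x := by
    intro x
    have h : ∀ u j, wireVal (xorResponse e u x) (r j) = wireVal x (r j) := by
      intro u j
      cases h : r j with
      | none => rfl
      | some q =>
        exact xorResponse_of_ne e u x fun j' hj' => wireRef_ne_inr hew _ _ j' (h.trans (by rw [hj']))
    simp only [hcopy, h]
    exact xorResponse_self e _ x
  have hclean : ∀ x, (∀ j, x (w j) = false) →
      B (copy (F x)) = xorResponse e (C.eval (queryBits e x)) x := by
    intro x hx
    have h : (fun j => wireVal (F x) (r j)) = C.eval (queryBits e x) := by
      funext j
      rw [hval x hx, List.take_length]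
      rfl
    simp only [hcopy]
    rw [h, ← hxor, hBF]
  refine ⟨gB ++ gc ++ gF, by simp only [List.length_append]; omega, fun ψ hψ => ?_⟩
  rw [((iB.append ic).append iF) ψ]
  funext x
  simp only [applyOracle]
  by_cases hx : ∀ j, x (w j) = false
  · rw [hclean x hx]
  · -- outside the clean subspace both sides vanish
    have h1 : ψ (xorResponse e (C.eval (queryBits e x)) x) = 0 := by
      by_contra h
      refine hx fun j => ?_
      rw [← hψ _ h j, xorResponse_of_ne e _ _ fun i => hew _ _]
    rw [h1]
    by_contra h
    have h2 := hψ _ h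
    have h3 := hclean _ h2
    rw [hFB, hcc, hBF] at h3
    refine hx fun j => ?_
    rw [h3, xorResponse_of_ne e _ _ fun i => hew _ _]
    exact h2 j

end Clean

/-! ### The winning probability as a quadratic form in the state -/

/-- The squared norm of a state. -/
def normSq {k : ℕ} (ψ : QState k) : ℝ := ∑ x, ‖ψ x‖ ^ 2

theorem normSq_comp {k : ℕ} (ψ : QState k) {π : Bits k → Bits k} (h : Function.Involutive π) :
    normSq (fun x => ψ (π x)) = normSq ψ :=
  Equiv.sum_comp h.toPerm fun x => ‖ψ x‖ ^ 2

theorem normSq_applyOracle {a b k : ℕ} (F : Bits a → Bits b) (e : Fin a ⊕ Fin b ↪ Fin k)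
    (ψ : QState k) : normSq (applyOracle F e ψ) = normSq ψ :=
  normSq_comp ψ fun x => by
    rw [queryBits_xorResponse, xorResponse_self]

theorem normSq_applyResponse {a b k : ℕ} (v : Bits b) (e : Fin a ⊕ Fin b ↪ Fin k)
    (ψ : QState k) : normSq (applyResponse v e ψ) = normSq ψ :=
  normSq_applyOracle (fun _ => v) e ψ

theorem sum_normSq_projectQuery {a b k : ℕ} (e : Fin a ⊕ Fin b ↪ Fin k) (ψ : QState k) :
    ∑ q, normSq (projectQuery q e ψ) = normSq ψ := by
  unfold normSq
  rw [Finset.sum_comm]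
  refine Finset.sum_congr rfl fun x _ => ?_
  rw [Finset.sum_eq_single (queryBits e x)]
  · simp [projectQuery]
  · intro q _ hq
    simp [projectQuery, hq.symm]
  · simp

theorem sum_normSq_projectQubit {k : ℕ} (i : Fin k) (ψ : QState k) :
    ∑ v, normSq (projectQubit i v ψ) = normSq ψ := by
  unfold normSq
  rw [Finset.sum_comm]
  refine Finset.sum_congr rfl fun x _ => ?_
  cases h : x i <;> simp [projectQubit, h]

theorem normSq_gate {k : ℕ} (g : Gate k) (ψ : QState k) : normSq (g.apply ψ) = normSq ψ := by
  cases g with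
  | hadamard i =>
    let flip : Bits k → Bits k := fun x => Function.update x i (!(x i))
    have hflip : Function.Involutive flip := fun x => by simp [flip]
    have h1 : ∀ φ : QState k, normSq φ = (∑ x, (‖φ x‖ ^ 2 + ‖φ (flip x)‖ ^ 2)) / 2 := by
      intro φ
      rw [Finset.sum_add_distrib]
      have : ∑ x, ‖φ (flip x)‖ ^ 2 = normSq φ := normSq_comp φ hflip
      rw [this]
      simp [normSq]
    rw [h1, h1]
    congr 1
    refine Finset.sum_congr rfl fun x _ => ?_
    have h2 : ‖ψ x‖ ^ 2 + ‖ψ (flip x)‖ ^ 2 =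
        ‖ψ (Function.update x i false)‖ ^ 2 + ‖ψ (Function.update x i true)‖ ^ 2 := by
      have hx : x = Function.update x i (x i) := by simp
      simp only [flip]
      nth_rewrite 1 [hx]
      cases x i <;> simp [add_comm]
    rw [h2]
    have h3 : ‖(Real.sqrt 2 : ℂ)‖ ^ 2 = 2 := by
      rw [Complex.norm_real, Real.norm_eq_abs, sq_abs, Real.sq_sqrt (by norm_num)]
    have h4 := parallelogram_law_with_norm ℝ (ψ (Function.update x i false))
      (ψ (Function.update x i true))
    simp only [Gate.apply, flip, Function.update_idem, Function.update_self, norm_div, div_pow, h3]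
    cases x i <;> simp [← sub_eq_add_neg] <;> linear_combination h4 / 2
  | phase i =>
    refine Finset.sum_congr rfl fun x _ => ?_
    cases h : x i <;> simp [Gate.apply, h]
  | piEighth i =>
    refine Finset.sum_congr rfl fun x _ => ?_
    have h1 : ‖Complex.exp (Complex.I * Real.pi / 4)‖ = 1 := by
      rw [show Complex.I * Real.pi / 4 = ((Real.pi / 4 : ℝ) : ℂ) * Complex.I by push_cast; ring]
      exact Complex.norm_exp_ofReal_mul_I _
    cases h : x i <;> simp [Gate.apply, h, h1]
  | cnot c t h =>
    exact normSq_comp ψ fun x => by simp [Function.update_of_ne h]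

theorem Gate.apply_add {k : ℕ} (g : Gate k) (ψ φ : QState k) :
    g.apply (ψ + φ) = g.apply ψ + g.apply φ := by
  cases g <;> funext x <;> simp only [Gate.apply, Pi.add_apply] <;> ring

theorem projectQubit_add {k : ℕ} (i : Fin k) (v : Bool) (ψ φ : QState k) :
    projectQubit i v (ψ + φ) = projectQubit i v ψ + projectQubit i v φ := by
  funext x
  by_cases h : x i = v <;> simp [projectQubit, h]

theorem projectQuery_add {a b k : ℕ} (q : Bits a) (e : Fin a ⊕ Fin b ↪ Fin k) (ψ φ : QState k) :
    projectQuery q e (ψ + φ) = projectQuery q e ψ + projectQuery q e φ := by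
  funext x
  by_cases h : queryBits e x = q <;> simp [projectQuery, h]

theorem normSq_add_le {k : ℕ} (ψ φ : QState k) {t : ℝ} (ht : 0 < t) (x : Bits k) :
    ‖(ψ + φ) x‖ ^ 2 ≤ (1 + t) * ‖ψ x‖ ^ 2 + (1 + 1 / t) * ‖φ x‖ ^ 2 := by
  have h1 : ‖(ψ + φ) x‖ ≤ ‖ψ x‖ + ‖φ x‖ := norm_add_le _ _
  have h2 : 2 * ‖ψ x‖ * ‖φ x‖ ≤ t * ‖ψ x‖ ^ 2 + 1 / t * ‖φ x‖ ^ 2 := by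
    have h : 0 ≤ (t * ‖ψ x‖ - ‖φ x‖) ^ 2 / t := by positivity
    have e : (t * ‖ψ x‖ - ‖φ x‖) ^ 2 / t =
        t * ‖ψ x‖ ^ 2 + 1 / t * ‖φ x‖ ^ 2 - 2 * ‖ψ x‖ * ‖φ x‖ := by field_simp; ring
    linarith
  have h3 : ‖(ψ + φ) x‖ ^ 2 ≤ (‖ψ x‖ + ‖φ x‖) ^ 2 := by gcongr
  nlinarith

section Run

variable {I : Interface} {inp out k : ℕ} (G : Game I inp out) (r : G.Coins)
  (output : Fin out ↪ Fin k)

open Classical in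
theorem Game.run_nil (s : G.State) (ψ : QState k) : G.run r output [] s ψ =
    ∑ x : Bits k, if G.wins r s (fun j => x (output j)) then ‖ψ x‖ ^ 2 else 0 := by
  rw [Game.run]

theorem Game.run_gate (g : Gate k) (code : List (Instr I k)) (s : G.State) (ψ : QState k) :
    G.run r output (.gate g :: code) s ψ = G.run r output code s (g.apply ψ) := by
  rw [Game.run]

theorem Game.run_measure (i : Fin k) (code : List (Instr I k)) (s : G.State) (ψ : QState k) :
    G.run r output (.measure i :: code) s ψ =
      ∑ v : Bool, G.run r output code s (projectQubit i v ψ) := by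
  rw [Game.run]

theorem Game.run_oracle (i : I.QIdx) (e) (code : List (Instr I k)) (s : G.State) (ψ : QState k) :
    G.run r output (.oracle i e :: code) s ψ =
      G.run r output code s (applyOracle (G.oracle r i) e ψ) := by
  rw [Game.run]

theorem Game.run_query (i : I.CIdx) (e) (code : List (Instr I k)) (s : G.State) (ψ : QState k) :
    G.run r output (.query i e :: code) s ψ =
      ∑ q : Bits (I.cIn i), uniformAvg fun w : Bits (G.answerCoins i) =>
        G.run r output code (G.answer r s i q w).2
          (applyResponse (G.answer r s i q w).1 e (projectQuery q e ψ)) := by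
  rw [Game.run]

theorem Game.run_nonneg (code : List (Instr I k)) : ∀ (s : G.State) (ψ : QState k),
    0 ≤ G.run r output code s ψ := by
  induction code with
  | nil =>
    intro s ψ
    rw [Game.run_nil]
    exact Finset.sum_nonneg fun x _ => by split_ifs <;> positivity
  | cons c code ih =>
    intro s ψ
    cases c with
    | gate g => rw [Game.run_gate]; exact ih _ _
    | measure i => rw [Game.run_measure]; exact Finset.sum_nonneg fun _ _ => ih _ _
    | oracle i e => rw [Game.run_oracle]; exact ih _ _
    | query i e =>
      rw [Game.run_query]
      exact Finset.sum_nonneg fun _ _ => uniformAvg_nonneg fun _ => ih _ _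

theorem Game.run_le_normSq (code : List (Instr I k)) : ∀ (s : G.State) (ψ : QState k),
    G.run r output code s ψ ≤ normSq ψ := by
  induction code with
  | nil =>
    intro s ψ
    rw [Game.run_nil]
    exact Finset.sum_le_sum fun x _ => by split_ifs <;> simp
  | cons c code ih =>
    intro s ψ
    cases c with
    | gate g => rw [Game.run_gate, ← normSq_gate g]; exact ih _ _
    | measure i =>
      rw [Game.run_measure, ← sum_normSq_projectQubit i]
      exact Finset.sum_le_sum fun _ _ => ih _ _
    | oracle i e => rw [Game.run_oracle, ← normSq_applyOracle (G.oracle r i) e]; exact ih _ _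
    | query i e =>
      rw [Game.run_query, ← sum_normSq_projectQuery e]
      refine Finset.sum_le_sum fun q _ => ?_
      refine (uniformAvg_mono fun w => ih _ _).trans ?_
      simp only [normSq_applyResponse]
      rw [uniformAvg_const]

theorem Game.run_zero (code : List (Instr I k)) (s : G.State) : G.run r output code s 0 = 0 :=
  le_antisymm ((G.run_le_normSq r output code s 0).trans (by simp [normSq]))
    (G.run_nonneg r output code s 0)

theorem Game.run_gates (gs : List (Gate k)) (code : List (Instr I k)) : ∀ (s : G.State)
    (ψ : QState k), G.run r output (gs.map Instr.gate ++ code) s ψ =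
      G.run r output code s (applyGates gs ψ) := by
  induction gs with
  | nil => exact fun _ _ => rfl
  | cons g gs ih =>
    intro s ψ
    rw [List.map_cons, List.cons_append, Game.run_gate, ih]
    rfl

/-- Measuring the wires `f`, one after the other. -/
theorem Game.run_measure_wires (code : List (Instr I k)) (s : G.State) : ∀ {a : ℕ}
    (f : Fin a → Fin k) (ψ : QState k),
    G.run r output ((List.ofFn fun j => Instr.measure (f j)) ++ code) s ψ =
      ∑ q : Bits a, G.run r output code s fun x => if (fun j => x (f j)) = q then ψ x else 0 := by
  intro a
  induction a with
  | zero =>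
    intro f ψ
    simp only [Fintype.sum_unique, List.ofFn_zero, List.nil_append]
    exact congrArg _ (funext fun x => (if_pos (Subsingleton.elim _ _)).symm)
  | succ a ih =>
    intro f ψ
    rw [List.ofFn_succ, List.cons_append, Game.run_measure,
      ← Equiv.sum_comp (Fin.consEquiv fun _ : Fin (a + 1) => Bool), Fintype.sum_prod_type]
    refine Finset.sum_congr rfl fun v _ => ?_
    rw [ih (fun j => f j.succ)]
    refine Finset.sum_congr rfl fun q _ => congrArg _ (funext fun x => ?_)
    have h : ((fun j => x (f j)) = (Fin.consEquiv fun _ : Fin (a + 1) => Bool) (v, q)) ↔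
        ((fun j : Fin a => x (f j.succ)) = q ∧ x (f 0) = v) := by
      simp only [Fin.consEquiv, Equiv.coe_fn_mk, funext_iff, Fin.forall_fin_succ, Fin.cons_zero,
        Fin.cons_succ]
      exact and_comm
    simp only [h, projectQubit, ite_and]

end Run

/-! ### The asymmetric game with fixed oracle and key -/

/-- One step of an adversary in the asymmetric game, with oracle inputs of `d` and outputs of `o`
bits, ciphertexts of `ct` and messages of `ml` bits. -/
inductive Step (d o ct ml k : ℕ) : Type where
  | gate (g : Gate k)
  | measure (i : Fin k)
  | oracle (e : Fin d ⊕ Fin o ↪ Fin k)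
  | dec (e : Fin ct ⊕ Fin (ml + 1) ↪ Fin k)
  | challenge (e : Fin (ml + ml) ⊕ Fin ct ↪ Fin k)

/-- The asymmetric chosen ciphertext game with everything fixed that the challenger samples at the
start: the random oracle `O`, the decryption function `dec` on the ciphertexts `space`, and the
function `chal` that answers a challenge, with `N` fresh random bits. A winning output satisfies
`win`, and only legal runs are won. -/
structure FixedGame (d o ct ml N out : ℕ) where
  size : Bits ml → ℕ
  O : Bits d → Bits o
  dec : Bits ct → Bits (ml + 1)
  chal : Bits N → Bits (ml + ml) → Bits ct
  space : Set (Bits ct)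
  win : Bits out → Prop

namespace FixedGame

variable {d o ct ml N out k : ℕ}

/-- The state of the challenger after a decryption query. -/
def decState (D : FixedGame d o ct ml N out) (s : CCAState ct) (c : Bits ct) : CCAState ct :=
  ⟨s.challenge, s.legal ∧ s.challenge ≠ some c ∧ c ∈ D.space⟩

/-- The state of the challenger after a challenge `m` that was answered by `c`. -/
def chalState (D : FixedGame d o ct ml N out) (s : CCAState ct) (m : Bits (ml + ml))
    (c : Bits ct) : CCAState ct :=
  ⟨some c, s.legal ∧ s.challenge = none ∧ D.size (leftBits m) = D.size (rightBits m)⟩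

/-- The probability of winning from the state `s` of the challenger and the state `ψ` of the
adversary, as in `Game.run`. -/
def run (D : FixedGame d o ct ml N out) (output : Fin out ↪ Fin k) :
    List (Step d o ct ml k) → CCAState ct → QState k → ℝ
  | [], s, ψ => by
      classical exact ∑ x : Bits k, if s.legal ∧ D.win (fun j => x (output j)) then ‖ψ x‖ ^ 2 else 0
  | .gate g :: code, s, ψ => D.run output code s (g.apply ψ)
  | .measure i :: code, s, ψ => ∑ v : Bool, D.run output code s (projectQubit i v ψ)
  | .oracle e :: code, s, ψ => D.run output code s (applyOracle D.O e ψ)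
  | .dec e :: code, s, ψ => ∑ q : Bits ct,
      D.run output code (D.decState s q) (applyResponse (D.dec q) e (projectQuery q e ψ))
  | .challenge e :: code, s, ψ => ∑ m : Bits (ml + ml), uniformAvg fun w : Bits N =>
      D.run output code (D.chalState s m (D.chal w m))
        (applyResponse (D.chal w m) e (projectQuery m e ψ))

/-- The same game with other answers to challenges. -/
def withChal {N' : ℕ} (D : FixedGame d o ct ml N out) (chal : Bits N' → Bits (ml + ml) → Bits ct) :
    FixedGame d o ct ml N' out := ⟨D.size, D.O, D.dec, chal, D.space, D.win⟩

/-- The same game with another winning condition. -/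
def withWin {out' : ℕ} (D : FixedGame d o ct ml N out) (win : Bits out' → Prop) :
    FixedGame d o ct ml N out' := ⟨D.size, D.O, D.dec, D.chal, D.space, win⟩

variable (D : FixedGame d o ct ml N out) (output : Fin out ↪ Fin k)

open Classical in
theorem run_nil (s : CCAState ct) (ψ : QState k) : D.run output [] s ψ =
    ∑ x : Bits k, if s.legal ∧ D.win (fun j => x (output j)) then ‖ψ x‖ ^ 2 else 0 := by
  rw [run]

theorem run_nonneg (code : List (Step d o ct ml k)) : ∀ (s : CCAState ct) (ψ : QState k),
    0 ≤ D.run output code s ψ := by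
  induction code with
  | nil =>
    intro s ψ
    rw [run_nil]
    exact Finset.sum_nonneg fun x _ => by split_ifs <;> positivity
  | cons c code ih =>
    intro s ψ
    cases c with
    | gate g => rw [run]; exact ih _ _
    | measure i => rw [run]; exact Finset.sum_nonneg fun _ _ => ih _ _
    | oracle e => rw [run]; exact ih _ _
    | dec e => rw [run]; exact Finset.sum_nonneg fun _ _ => ih _ _
    | challenge e =>
      rw [run]
      exact Finset.sum_nonneg fun _ _ => uniformAvg_nonneg fun _ => ih _ _

theorem run_le_normSq (code : List (Step d o ct ml k)) : ∀ (s : CCAState ct) (ψ : QState k),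
    D.run output code s ψ ≤ normSq ψ := by
  induction code with
  | nil =>
    intro s ψ
    rw [run_nil]
    exact Finset.sum_le_sum fun x _ => by split_ifs <;> simp
  | cons c code ih =>
    intro s ψ
    cases c with
    | gate g => rw [run, ← normSq_gate g]; exact ih _ _
    | measure i =>
      rw [run, ← sum_normSq_projectQubit i]
      exact Finset.sum_le_sum fun _ _ => ih _ _
    | oracle e => rw [run, ← normSq_applyOracle D.O e]; exact ih _ _
    | dec e =>
      rw [run, ← sum_normSq_projectQuery e]
      refine Finset.sum_le_sum fun q _ => (ih _ _).trans ?_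
      rw [normSq_applyResponse]
    | challenge e =>
      rw [run, ← sum_normSq_projectQuery e]
      refine Finset.sum_le_sum fun q _ => ?_
      refine (uniformAvg_mono fun w => ih _ _).trans ?_
      simp only [normSq_applyResponse]
      rw [uniformAvg_const]

/-- The square root of the winning probability is a seminorm; this is its triangle inequality in a
form that is linear in the probabilities. -/
theorem run_add_le {t : ℝ} (ht : 0 < t) (code : List (Step d o ct ml k)) :
    ∀ (s : CCAState ct) (ψ φ : QState k), D.run output code s (ψ + φ) ≤
      (1 + t) * D.run output code s ψ + (1 + 1 / t) * D.run output code s φ := by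
  induction code with
  | nil =>
    intro s ψ φ
    simp only [run_nil, Finset.mul_sum, ← Finset.sum_add_distrib]
    refine Finset.sum_le_sum fun x _ => ?_
    split_ifs
    · exact normSq_add_le ψ φ ht x
    · simp
  | cons c code ih =>
    intro s ψ φ
    cases c with
    | gate g => simp only [run, Gate.apply_add]; exact ih _ _ _
    | measure i =>
      simp only [run, projectQubit_add, Finset.mul_sum, ← Finset.sum_add_distrib]
      exact Finset.sum_le_sum fun _ _ => ih _ _ _
    | oracle e => simp only [run]; exact ih _ _ _
    | dec e =>
      simp only [run, projectQuery_add, Finset.mul_sum, ← Finset.sum_add_distrib]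
      exact Finset.sum_le_sum fun _ _ => ih _ _ _
    | challenge e =>
      simp only [run, projectQuery_add, Finset.mul_sum, ← Finset.sum_add_distrib,
        ← uniformAvg_mul_left, ← uniformAvg_add]
      exact Finset.sum_le_sum fun _ _ => uniformAvg_mono fun _ => ih _ _ _

variable {D output}

theorem run_illegal (code : List (Step d o ct ml k)) : ∀ (s : CCAState ct) (ψ : QState k),
    ¬ s.legal → D.run output code s ψ = 0 := by
  induction code with
  | nil =>
    intro s ψ hs
    rw [run_nil]
    simp [hs]
  | cons c code ih =>
    intro s ψ hs
    cases c with
    | gate g => rw [run]; exact ih _ _ hs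
    | measure i => rw [run]; exact Finset.sum_eq_zero fun v _ => ih _ _ hs
    | oracle e => rw [run]; exact ih _ _ hs
    | dec e =>
      rw [run]
      exact Finset.sum_eq_zero fun q _ => ih _ _ fun h => hs h.1
    | challenge e =>
      rw [run]
      refine Finset.sum_eq_zero fun m _ => ?_
      have h : ∀ w : Bits N, D.run output code (D.chalState s m (D.chal w m))
          (applyResponse (D.chal w m) e (projectQuery m e ψ)) = 0 := fun w =>
        ih _ _ fun h => hs h.1
      simp only [h]
      exact uniformAvg_const 0

/-- The answers to decryption queries outside the ciphertext space are irrelevant. -/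
theorem run_congr_dec {dec' : Bits ct → Bits (ml + 1)} (hdec : ∀ c ∈ D.space, D.dec c = dec' c)
    (code : List (Step d o ct ml k)) : ∀ (s : CCAState ct) (ψ : QState k),
      D.run output code s ψ = { D with dec := dec' }.run output code s ψ := by
  induction code with
  | nil => intro s ψ; rw [run_nil, run_nil]
  | cons c code ih =>
    intro s ψ
    cases c with
    | gate g => rw [run, run]; exact ih _ _
    | measure i => rw [run, run]; exact Finset.sum_congr rfl fun v _ => ih _ _
    | oracle e => rw [run, run]; exact ih _ _
    | dec e =>
      rw [run, run]
      refine Finset.sum_congr rfl fun q _ => ?_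
      by_cases hq : q ∈ D.space
      · rw [hdec q hq]; exact ih _ _
      · exact (run_illegal code _ _ (by exact fun h => hq h.2.2)).trans
          (run_illegal code _ _ (by exact fun h => hq h.2.2)).symm
    | challenge e =>
      rw [run, run]
      exact Finset.sum_congr rfl fun m _ => congrArg _ (funext fun w => ih _ _)

/-! ### Sampling the randomness of the challenge in advance -/

/-- After the challenge, the function that answers challenges is irrelevant: a second challenge is
illegal. -/
theorem run_of_challenged {N' : ℕ} {chal' : Bits N' → Bits (ml + ml) → Bits ct}
    (code : List (Step d o ct ml k)) : ∀ (s : CCAState ct) (ψ : QState k),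
      s.challenge ≠ none → D.run output code s ψ = (D.withChal chal').run output code s ψ := by
  induction code with
  | nil => intro s ψ hs; rw [run_nil, run_nil]; rfl
  | cons c code ih =>
    intro s ψ hs
    cases c with
    | gate g => rw [run, run]; exact ih _ _ hs
    | measure i => rw [run, run]; exact Finset.sum_congr rfl fun v _ => ih _ _ hs
    | oracle e => rw [run, run]; exact ih _ _ hs
    | dec e => rw [run, run]; exact Finset.sum_congr rfl fun q _ => ih _ _ hs
    | challenge e =>
      rw [run, run]
      refine Finset.sum_congr rfl fun m _ => ?_
      have h : ∀ {N : ℕ} (D : FixedGame d o ct ml N out) (w : Bits N),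
          D.run output code (D.chalState s m (D.chal w m))
            (applyResponse (D.chal w m) e (projectQuery m e ψ)) = 0 := by
        intro N D w
        refine run_illegal _ _ _ ?_
        exact fun h => hs h.2.1
      simp only [h]
      rw [uniformAvg_const, uniformAvg_const]

/-- A part `i` of the randomness of the challenge may be sampled at the start. -/
theorem run_presample {N' : ℕ} {ι : Type} [Fintype ι] [Nonempty ι] (θ : ι → Bits N' → Bits N)
    (hθ : ∀ g : Bits N → ℝ, uniformAvg g = uniformAvg fun i => uniformAvg fun w => g (θ i w))
    (code : List (Step d o ct ml k)) : ∀ (s : CCAState ct) (ψ : QState k),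
      s.challenge = none → D.run output code s ψ =
        uniformAvg fun i => (D.withChal fun w => D.chal (θ i w)).run output code s ψ := by
  induction code with
  | nil =>
    intro s ψ hs
    simp only [run_nil]
    exact (uniformAvg_const _).symm
  | cons c code ih =>
    intro s ψ hs
    cases c with
    | gate g => simp only [run]; exact ih _ _ hs
    | measure i =>
      simp only [run, uniformAvg_sum]
      exact Finset.sum_congr rfl fun v _ => ih _ _ hs
    | oracle e => simp only [run]; exact ih _ _ hs
    | dec e =>
      simp only [run, uniformAvg_sum]
      exact Finset.sum_congr rfl fun q _ => ih _ _ hs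
    | challenge e =>
      simp only [run, uniformAvg_sum]
      refine Finset.sum_congr rfl fun m _ => ?_
      rw [hθ]
      congr 1
      funext i
      congr 1
      funext w
      exact run_of_challenged code _ _ (by simp [chalState])

/-! ### One-way to hiding -/

/-- The probability that the `j`-th step is a query to the random oracle at a point satisfying `bad`,
measured just before that step, in a run that is legal until then. -/
def queryWeight (D : FixedGame d o ct ml N out) (bad : Bits d → Prop)
    (code : List (Step d o ct ml k)) (j : ℕ) (s : CCAState ct) (ψ : QState k) : ℝ :=
  match code[j]? with
  | some (.oracle e) => (D.withWin bad).run (Function.Embedding.inl.trans e) (code.take j) s ψ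
  | _ => 0

theorem queryWeight_nonneg (D : FixedGame d o ct ml N out) (bad : Bits d → Prop)
    (code : List (Step d o ct ml k)) (j : ℕ) (s : CCAState ct) (ψ : QState k) :
    0 ≤ D.queryWeight bad code j s ψ := by
  unfold queryWeight
  split
  · exact run_nonneg _ _ _ _ _
  · exact le_rfl

theorem normSq_applyOracle_sub_le {a b : ℕ} (F F' : Bits a → Bits b) (bad : Bits a → Prop)
    (h : ∀ x, ¬ bad x → F x = F' x) (e : Fin a ⊕ Fin b ↪ Fin k) (ψ : QState k) [DecidablePred bad] :
    normSq (applyOracle F e ψ - applyOracle F' e ψ) ≤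
      4 * ∑ x, if bad (queryBits e x) then ‖ψ x‖ ^ 2 else 0 := by
  let φ : QState k := fun x => if bad (queryBits e x) then ψ x else 0
  have h1 : ∀ x, ‖(applyOracle F e ψ - applyOracle F' e ψ) x‖ ^ 2 ≤
      2 * ‖applyOracle F e φ x‖ ^ 2 + 2 * ‖applyOracle F' e φ x‖ ^ 2 := by
    intro x
    by_cases hx : bad (queryBits e x)
    · have e1 : applyOracle F e φ x = applyOracle F e ψ x := by
        simp [applyOracle, φ, queryBits_xorResponse, hx]
      have e2 : applyOracle F' e φ x = applyOracle F' e ψ x := by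
        simp [applyOracle, φ, queryBits_xorResponse, hx]
      rw [e1, e2, Pi.sub_apply]
      have h3 := norm_sub_le (applyOracle F e ψ x) (applyOracle F' e ψ x)
      have h4 : ‖applyOracle F e ψ x - applyOracle F' e ψ x‖ ^ 2 ≤
        (‖applyOracle F e ψ x‖ + ‖applyOracle F' e ψ x‖) ^ 2 := by gcongr
      nlinarith [sq_nonneg (‖applyOracle F e ψ x‖ - ‖applyOracle F' e ψ x‖)]
    · have e1 : (applyOracle F e ψ - applyOracle F' e ψ) x = 0 := by
        simp [applyOracle, h _ hx]
      rw [e1, norm_zero, zero_pow two_ne_zero]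
      positivity
  have h2 : ∑ x, (if bad (queryBits e x) then ‖ψ x‖ ^ 2 else 0) = normSq φ := by
    refine Finset.sum_congr rfl fun x _ => ?_
    by_cases hx : bad (queryBits e x) <;> simp [φ, hx]
  calc normSq (applyOracle F e ψ - applyOracle F' e ψ)
      ≤ ∑ x, (2 * ‖applyOracle F e φ x‖ ^ 2 + 2 * ‖applyOracle F' e φ x‖ ^ 2) :=
        Finset.sum_le_sum fun x _ => h1 x
    _ = 2 * normSq (applyOracle F e φ) + 2 * normSq (applyOracle F' e φ) := by
        rw [Finset.sum_add_distrib, ← Finset.mul_sum, ← Finset.mul_sum]; rfl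
    _ = _ := by rw [normSq_applyOracle, normSq_applyOracle, h2]; ring

/-- If the oracles `D.O` and `O'` agree outside `bad`, then the winning probability with `D.O`
exceeds the one with `O'` substantially only if the adversary puts weight on queries to `bad`. The
free parameter `t` replaces the square root of the usual bound and keeps the inequality linear in the
probabilities, so that it survives the summation over measurement outcomes. -/
theorem run_le_of_agree {bad : Bits d → Prop} {O' : Bits d → Bits o}
    (hO : ∀ x, ¬ bad x → D.O x = O' x) {t K : ℝ} (ht : 0 < t) (code : List (Step d o ct ml k)) :
    4 * (1 + 1 / t) * (1 + t) ^ code.length ≤ K → ∀ (s : CCAState ct) (ψ : QState k),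
      D.run output code s ψ ≤
        (1 + t) ^ code.length * { D with O := O' }.run output code s ψ +
          K * ∑ j ∈ Finset.range code.length, D.queryWeight bad code j s ψ := by
  classical
  set D' : FixedGame d o ct ml N out := { D with O := O' } with hD'
  induction code with
  | nil =>
    intro _ s ψ
    simp [run_nil, hD']
  | cons c code ih =>
    intro hK s ψ
    have ht1 : (1 : ℝ) ≤ 1 + t := by linarith
    have hpow : (1 + t) ^ code.length ≤ (1 + t) ^ (code.length + 1) :=
      pow_le_pow_right₀ ht1 (Nat.le_succ _)
    have hK' : 4 * (1 + 1 / t) * (1 + t) ^ code.length ≤ K :=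
      (mul_le_mul_of_nonneg_left hpow (by positivity)).trans hK
    have hK0 : 0 ≤ K := (show 0 ≤ 4 * (1 + 1 / t) * (1 + t) ^ code.length by positivity).trans hK'
    have ih := ih hK'
    -- it remains to compare the weights and to add one factor `1 + t`
    have step : ∀ (R : ℝ), 0 ≤ R → ∀ W W' : ℝ, W = W' →
        (1 + t) ^ code.length * R + K * W ≤ (1 + t) ^ (code.length + 1) * R + K * W' :=
      fun R hR W W' hW => add_le_add (mul_le_mul_of_nonneg_right hpow hR)
        (mul_le_mul_of_nonneg_left hW.le hK0)
    have hnn : ∀ s ψ, 0 ≤ D'.run output code s ψ := fun s ψ => run_nonneg _ _ _ _ _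
    rw [List.length_cons, Finset.sum_range_succ']
    cases c with
    | gate g =>
      rw [run, run]
      refine (ih s _).trans (step _ (hnn _ _) _ _ ?_)
      have h0 : D.queryWeight bad (.gate g :: code) 0 s ψ = 0 := rfl
      rw [h0, add_zero]
      refine Finset.sum_congr rfl fun j _ => ?_
      simp only [queryWeight, List.getElem?_cons_succ, List.take_succ_cons, run]
    | measure i =>
      rw [run, run]
      refine (Finset.sum_le_sum fun v _ => ih s _).trans ?_
      rw [Finset.sum_add_distrib, ← Finset.mul_sum, ← Finset.mul_sum]
      refine step _ (Finset.sum_nonneg fun _ _ => hnn _ _) _ _ ?_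
      have h0 : D.queryWeight bad (.measure i :: code) 0 s ψ = 0 := rfl
      rw [h0, add_zero, Finset.sum_comm]
      refine Finset.sum_congr rfl fun j _ => ?_
      simp only [queryWeight, List.getElem?_cons_succ, List.take_succ_cons]
      cases code[j]? with
      | none => simp
      | some c => cases c <;> simp [run]
    | oracle e =>
      rw [run, run]
      by_cases hs : s.legal
      · have h1 : applyOracle D.O e ψ = applyOracle O' e ψ +
            (applyOracle D.O e ψ - applyOracle O' e ψ) := by abel
        have h2 := D'.run_add_le output ht code s
          (applyOracle O' e ψ) (applyOracle D.O e ψ - applyOracle O' e ψ)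
        rw [← h1] at h2
        have h3 := (D'.run_le_normSq output code s
          (applyOracle D.O e ψ - applyOracle O' e ψ)).trans
            (normSq_applyOracle_sub_le D.O O' bad hO e ψ)
        have h4 : D.queryWeight bad (.oracle e :: code) 0 s ψ =
            ∑ x, if bad (queryBits e x) then ‖ψ x‖ ^ 2 else 0 := by
          simp only [queryWeight, List.getElem?_cons_zero, List.take_zero]
          rw [run_nil]
          simp only [hs, true_and]
          rfl
        have h5 : ∀ j, D.queryWeight bad (.oracle e :: code) (j + 1) s ψ =
            D.queryWeight bad code j s (applyOracle D.O e ψ) := by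
          intro j
          simp only [queryWeight, List.getElem?_cons_succ, List.take_succ_cons, run]
          rfl
        have h6 := D.queryWeight_nonneg bad (.oracle e :: code) 0 s ψ
        rw [← h4] at h3
        simp only [h5]
        refine (ih s _).trans ?_
        have h7 := h2.trans (add_le_add le_rfl
          (mul_le_mul_of_nonneg_left h3 (show 0 ≤ 1 + 1 / t by positivity)))
        have h8 := mul_le_mul_of_nonneg_left h7 (show 0 ≤ (1 + t) ^ code.length by positivity)
        have h9 := mul_le_mul_of_nonneg_right hK' h6
        have h10 : D'.O = O' := rfl
        rw [pow_succ, h10]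
        linarith
      · rw [run_illegal _ _ _ hs]
        refine add_nonneg (mul_nonneg (by positivity) (hnn _ _)) (mul_nonneg hK0 ?_)
        exact add_nonneg (Finset.sum_nonneg fun j _ => queryWeight_nonneg _ _ _ _ _ _)
          (queryWeight_nonneg _ _ _ _ _ _)
    | dec e =>
      have h0 : D.queryWeight bad (.dec e :: code) 0 s ψ = 0 := rfl
      rw [h0, add_zero, run, run]
      refine (Finset.sum_le_sum fun v _ => ih _ _).trans ?_
      rw [Finset.sum_add_distrib, ← Finset.mul_sum, ← Finset.mul_sum]
      refine step _ (Finset.sum_nonneg fun _ _ => hnn _ _) _ _ ?_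
      rw [Finset.sum_comm]
      refine Finset.sum_congr rfl fun j _ => ?_
      simp only [queryWeight, List.getElem?_cons_succ, List.take_succ_cons]
      cases code[j]? with
      | none => simp
      | some c =>
        cases c with
        | oracle e' => simp only [run]; rfl
        | _ => simp
    | challenge e =>
      have h0 : D.queryWeight bad (.challenge e :: code) 0 s ψ = 0 := rfl
      rw [h0, add_zero, run, run]
      refine (Finset.sum_le_sum fun v _ => uniformAvg_mono fun w => ih _ _).trans ?_
      simp only [uniformAvg_add, uniformAvg_mul_left]
      rw [Finset.sum_add_distrib, ← Finset.mul_sum, ← Finset.mul_sum]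
      refine step _ (Finset.sum_nonneg fun _ _ => uniformAvg_nonneg fun _ => hnn _ _) _ _ ?_
      simp only [uniformAvg_sum]
      rw [Finset.sum_comm]
      refine Finset.sum_congr rfl fun j _ => ?_
      simp only [queryWeight, List.getElem?_cons_succ, List.take_succ_cons]
      cases code[j]? with
      | none => simp [uniformAvg_const]
      | some c =>
        cases c with
        | oracle e' => simp only [run]; rfl
        | _ => simp [uniformAvg_const]

end FixedGame

/-! ### From the chosen ciphertext game to fixed games -/

section Translation

variable {E : AsymScheme} {n k : ℕ}

/-- An instruction of an adversary against `E`. -/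
def Step.ofInstr : Instr (E.interface n) k → Step (E.roIn n) (E.roOut n) (E.ctLen n) (E.msgLen n) k
  | .gate g => .gate g
  | .measure i => .measure i
  | .oracle _ e => .oracle e
  | .query .dec e => .dec e
  | .query .challenge e => .challenge e

/-- The chosen ciphertext game with the coins of the challenger fixed. -/
def fixedCCA (E : AsymScheme) (n : ℕ) (r : (E.ccaGame n).Coins) :
    FixedGame (E.roIn n) (E.roOut n) (E.ctLen n) (E.msgLen n) (E.encCoins n) 1 where
  size := E.msgSize n
  O := r.2.2
  dec := fun c => encodeOption (E.dec n r.2.2 (E.keyGen n r.1).2 c)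
  chal := fun u m => E.enc n r.2.2 (E.keyGen n r.1).1 (if r.2.1 then rightBits m else leftBits m) u
  space := E.ctSpace n (E.keyGen n r.1).1
  win := fun z => z 0 = r.2.1

theorem ccaGame_run_eq (r : (E.ccaGame n).Coins) {output : Fin 1 ↪ Fin k}
    (code : List (Instr (E.interface n) k)) : ∀ (s : CCAState (E.ctLen n)) (ψ : QState k),
      (E.ccaGame n).run r output code s ψ =
        (fixedCCA E n r).run output (code.map Step.ofInstr) s ψ := by
  induction code with
  | nil =>
    intro s ψ
    refine (Game.run_nil _ _ _ _ _).trans (Eq.trans ?_ (FixedGame.run_nil _ _ _ _).symm)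
    exact Finset.sum_congr rfl fun x _ => by congr
  | cons c code ih =>
    intro s ψ
    rw [List.map_cons]
    cases c with
    | gate g => exact (Game.run_gate _ _ _ _ _ _ _).trans (ih _ _)
    | measure i =>
      exact (Game.run_measure _ _ _ _ _ _ _).trans (Finset.sum_congr rfl fun v _ => ih _ _)
    | oracle i e => exact (Game.run_oracle _ _ _ _ _ _ _ _).trans (ih _ _)
    | query i e =>
      cases i with
      | dec =>
        refine (Game.run_query _ _ _ _ _ _ _ _).trans (Finset.sum_congr rfl fun q _ => ?_)
        exact (congrArg uniformAvg (funext fun w => ih _ _)).trans (uniformAvg_const (α := Bits 0) _)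
      | challenge =>
        refine (Game.run_query _ _ _ _ _ _ _ _).trans (Finset.sum_congr rfl fun m _ => ?_)
        exact congrArg uniformAvg (funext fun w => ih _ _)

end Translation

/-! ### The polynomial method -/

section LowDegree

variable {a b : ℕ}

/-- The indicator function of the functions with the values prescribed by `l`. -/
def valueIndicator (l : List (Bits a × Bits b)) (H : Bits a → Bits b) : ℂ :=
  if ∀ p ∈ l, H p.1 = p.2 then 1 else 0

/-- Functionals of `H : Bits a → Bits b` that are polynomials of degree at most `t` in the indicators
of the events `H x = v`. -/
def LowDegree (a b t : ℕ) : Submodule ℂ ((Bits a → Bits b) → ℂ) :=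
  Submodule.span ℂ {g | ∃ l : List (Bits a × Bits b), l.length ≤ t ∧ g = valueIndicator l}

theorem lowDegree_mono {s t : ℕ} (h : s ≤ t) : LowDegree a b s ≤ LowDegree a b t :=
  Submodule.span_mono fun _ ⟨l, hl, hg⟩ => ⟨l, hl.trans h, hg⟩

theorem const_mem_lowDegree (c : ℂ) (t : ℕ) : (fun _ => c) ∈ LowDegree a b t := by
  have h : valueIndicator ([] : List (Bits a × Bits b)) ∈ LowDegree a b t :=
    Submodule.subset_span ⟨[], by simp, rfl⟩
  convert Submodule.smul_mem _ c h using 1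
  funext H
  simp [valueIndicator]

theorem mul_mem_lowDegree {s t : ℕ} {f g : (Bits a → Bits b) → ℂ} (hf : f ∈ LowDegree a b s)
    (hg : g ∈ LowDegree a b t) : f * g ∈ LowDegree a b (s + t) := by
  refine Submodule.span_induction ?_ ?_ ?_ ?_ hf
  · rintro _ ⟨l, hl, rfl⟩
    refine Submodule.span_induction ?_ ?_ ?_ ?_ hg
    · rintro _ ⟨l', hl', rfl⟩
      refine Submodule.subset_span ⟨l ++ l', by simp; omega, ?_⟩
      funext H
      simp only [valueIndicator, Pi.mul_apply, List.forall_mem_append]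
      rw [ite_and, ite_mul, one_mul, zero_mul]
    · rw [mul_zero]; exact Submodule.zero_mem _
    · intro x y _ _ hx hy; rw [mul_add]; exact Submodule.add_mem _ hx hy
    · intro c x _ hx; rw [mul_smul_comm]; exact Submodule.smul_mem _ c hx
  · rw [zero_mul]; exact Submodule.zero_mem _
  · intro x y _ _ hx hy; rw [add_mul]; exact Submodule.add_mem _ hx hy
  · intro c x _ hx; rw [smul_mul_assoc]; exact Submodule.smul_mem _ c hx

theorem conj_mem_lowDegree {t : ℕ} {f : (Bits a → Bits b) → ℂ} (hf : f ∈ LowDegree a b t) :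
    (fun H => (starRingEnd ℂ) (f H)) ∈ LowDegree a b t := by
  refine Submodule.span_induction (p := fun f _ => (fun H => (starRingEnd ℂ) (f H)) ∈
    LowDegree a b t) ?_ ?_ ?_ ?_ hf
  · rintro _ ⟨l, hl, rfl⟩
    refine Submodule.subset_span ⟨l, hl, funext fun H => ?_⟩
    unfold valueIndicator
    split_ifs <;> simp
  · simp only [Pi.zero_apply, map_zero]; exact Submodule.zero_mem _
  · intro x y _ _ hx hy
    simp only [Pi.add_apply, map_add]; exact Submodule.add_mem _ hx hy
  · intro c x _ hx
    simp only [Pi.smul_apply, smul_eq_mul, map_mul]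
    exact Submodule.smul_mem _ ((starRingEnd ℂ) c) hx

/-- A classical or quantum query to `H` raises the degree by one. -/
theorem query_mem_lowDegree {t : ℕ} (x : Bits a) {g : Bits b → (Bits a → Bits b) → ℂ}
    (hg : ∀ v, g v ∈ LowDegree a b t) : (fun H => g (H x) H) ∈ LowDegree a b (t + 1) := by
  have h : (fun H => g (H x) H) = ∑ v, valueIndicator [(x, v)] * g v := by
    funext H
    rw [Finset.sum_apply, Finset.sum_eq_single (H x)]
    · simp [valueIndicator]
    · intro v _ hv
      simp [valueIndicator, hv.symm]
    · simp
  rw [h, add_comm]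
  exact Submodule.sum_mem _ fun v _ => mul_mem_lowDegree
    (Submodule.subset_span ⟨[(x, v)], by simp, rfl⟩) (hg v)

theorem sum_mem_lowDegree {ι : Type} {t : ℕ} (s : Finset ι) {g : ι → (Bits a → Bits b) → ℂ}
    (hg : ∀ i, g i ∈ LowDegree a b t) : (fun H => ∑ i ∈ s, g i H) ∈ LowDegree a b t := by
  have h : (fun H => ∑ i ∈ s, g i H) = ∑ i ∈ s, g i := by funext H; simp
  rw [h]
  exact Submodule.sum_mem _ fun i _ => hg i

theorem const_mul_mem_lowDegree {t : ℕ} (c : ℂ) {g : (Bits a → Bits b) → ℂ}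
    (hg : g ∈ LowDegree a b t) : (fun H => c * g H) ∈ LowDegree a b t :=
  Submodule.smul_mem _ c hg

/-- Averages of functionals of degree at most `t` do not distinguish a `t`-wise independent hash
function from a random function. -/
theorem avg_eq_of_mem_lowDegree {K : Type} [Fintype K] {h : K → Bits a → Bits b} {t : ℕ}
    (hh : BoundedIndependent t h) {g : (Bits a → Bits b) → ℂ} (hg : g ∈ LowDegree a b t) :
    (∑ k, g (h k)) / Fintype.card K = (∑ H, g H) / Fintype.card (Bits a → Bits b) := by
  refine Submodule.span_induction (p := fun g _ => (∑ k, g (h k)) / (Fintype.card K : ℂ) =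
    (∑ H, g H) / (Fintype.card (Bits a → Bits b) : ℂ)) ?_ ?_ ?_ ?_ hg
  · rintro _ ⟨l, hl, rfl⟩
    by_cases hY : ∃ Y : Bits a → Bits b, ∀ p ∈ l, Y p.1 = p.2
    · obtain ⟨Y, hY⟩ := hY
      have h1 := hh (l.map Prod.fst).toFinset
        ((List.toFinset_card_le _).trans (by simpa using hl)) Y
      have h2 : ∀ H : Bits a → Bits b, valueIndicator l H =
          ((if ∀ x ∈ (l.map Prod.fst).toFinset, H x = Y x then (1 : ℝ) else 0 : ℝ) : ℂ) := by
        intro H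
        have : (∀ p ∈ l, H p.1 = p.2) ↔ ∀ x ∈ (l.map Prod.fst).toFinset, H x = Y x := by
          simp only [List.mem_toFinset, List.forall_mem_map]
          exact forall₂_congr fun p hp => by rw [hY p hp]
        simp only [valueIndicator, this]
        split_ifs <;> simp
      simp only [h2]
      have h3 := congrArg (fun r : ℝ => (r : ℂ)) h1
      simpa only [uniformAvg, Complex.ofReal_div, Complex.ofReal_sum, Complex.ofReal_natCast] using h3
    · have h2 : ∀ H : Bits a → Bits b, valueIndicator l H = 0 := fun H =>
        if_neg fun hH => hY ⟨H, hH⟩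
      simp [h2]
  · simp
  · intro x y _ _ hx hy
    simp only [Pi.add_apply, Finset.sum_add_distrib, add_div, hx, hy]
  · intro c x _ hx
    simp only [Pi.smul_apply, smul_eq_mul, ← Finset.mul_sum, mul_div_assoc, hx]

end LowDegree

section HashedGame

variable {d R o ct ml N out k : ℕ}

/-- A fixed game all of whose answers are computed from values of `H`: oracle queries are answered by
`H (p x)`, a decryption query `c` depends on `H (z c)` and the challenge on `H y`. -/
structure HashedGame (d R o ct ml N out : ℕ) where
  size : Bits ml → ℕ
  p : Bits d → Bits R
  z : Bits ct → Bits R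
  y : Bits R
  dec : Bits ct → Bits o → Bits (ml + 1)
  chal : Bits N → Bits (ml + ml) → Bits o → Bits ct
  space : Set (Bits ct)
  win : Bits out → Prop

/-- The game for a given function `H`. -/
def HashedGame.fix (D : HashedGame d R o ct ml N out) (H : Bits R → Bits o) :
    FixedGame d o ct ml N out where
  size := D.size
  O := fun x => H (D.p x)
  dec := fun c => D.dec c (H (D.z c))
  chal := fun w m => D.chal w m (H D.y)
  space := D.space
  win := D.win

theorem gate_mem_lowDegree {t : ℕ} (g : Gate k) {ψ : (Bits R → Bits o) → QState k}
    (hψ : ∀ x, (fun H => ψ H x) ∈ LowDegree R o t) (x : Bits k) :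
    (fun H => g.apply (ψ H) x) ∈ LowDegree R o t := by
  cases g with
  | hadamard i =>
    simp only [Gate.apply, div_eq_inv_mul]
    exact const_mul_mem_lowDegree _ (Submodule.add_mem _ (hψ _) (const_mul_mem_lowDegree _ (hψ _)))
  | phase i => exact const_mul_mem_lowDegree _ (hψ x)
  | piEighth i => exact const_mul_mem_lowDegree _ (hψ x)
  | cnot c t h => exact hψ _

theorem HashedGame.run_mem_lowDegree (D : HashedGame d R o ct ml N out) (output : Fin out ↪ Fin k)
    (code : List (Step d o ct ml k)) : ∀ (t : ℕ) (s : CCAState ct)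
      (ψ : (Bits R → Bits o) → QState k) (_ : ∀ x, (fun H => ψ H x) ∈ LowDegree R o t),
      (fun H => (((D.fix H).run output code s (ψ H) : ℝ) : ℂ)) ∈
        LowDegree R o (2 * t + 2 * code.length) := by
  induction code with
  | nil =>
    intro t s ψ hψ
    simp only [FixedGame.run_nil, Complex.ofReal_sum]
    refine sum_mem_lowDegree _ fun x => ?_
    by_cases hw : s.legal ∧ D.win fun j => x (output j)
    · have h : ∀ H, ((‖ψ H x‖ ^ 2 : ℝ) : ℂ) = ψ H x * (starRingEnd ℂ) (ψ H x) := by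
        intro H
        rw [Complex.mul_conj, Complex.normSq_eq_norm_sq]
      have h' : ∀ H, (s.legal ∧ (D.fix H).win fun j => x (output j)) := fun _ => hw
      refine (congrArg (· ∈ LowDegree R o _) (funext fun H => ?_)).mpr (lowDegree_mono (by simp; omega)
        (mul_mem_lowDegree (hψ x) (conj_mem_lowDegree (hψ x))))
      rw [if_pos (h' H), h]
      rfl
    · have h' : ∀ H, ¬ (s.legal ∧ (D.fix H).win fun j => x (output j)) := fun _ => hw
      refine (congrArg (· ∈ LowDegree R o _) (funext fun H => ?_)).mpr (const_mem_lowDegree 0 _)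
      rw [if_neg (h' H), Complex.ofReal_zero]
  | cons c code ih =>
    intro t s ψ hψ
    cases c with
    | gate g =>
      simp only [FixedGame.run]
      exact lowDegree_mono (by simp) (ih t s _ (gate_mem_lowDegree g hψ))
    | measure i =>
      simp only [FixedGame.run, Complex.ofReal_sum]
      refine sum_mem_lowDegree _ fun v => lowDegree_mono (by simp) (ih t s _ fun x => ?_)
      by_cases h : x i = v
      · simp only [projectQubit, h, if_true]; exact hψ x
      · simp only [projectQubit, h, if_false]; exact const_mem_lowDegree _ _
    | oracle e =>
      simp only [FixedGame.run]
      refine lowDegree_mono (by simp; omega) (ih (t + 1) s _ fun x => ?_)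
      exact query_mem_lowDegree (D.p (queryBits e x)) fun v => hψ (xorResponse e v x)
    | dec e =>
      simp only [FixedGame.run, Complex.ofReal_sum]
      refine sum_mem_lowDegree _ fun q => ?_
      have h1 : ∀ v : Bits o, (fun H => (((D.fix H).run output code ⟨s.challenge, s.legal ∧
          s.challenge ≠ some q ∧ q ∈ D.space⟩
          (applyResponse (D.dec q v) e (projectQuery q e (ψ H))) : ℝ) : ℂ)) ∈
          LowDegree R o (2 * t + 2 * code.length) := by
        refine fun v => ih t _ _ fun x => ?_
        by_cases h : queryBits e (xorResponse e (D.dec q v) x) = q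
        · simp only [applyResponse, projectQuery, h, if_true]; exact hψ _
        · simp only [applyResponse, projectQuery, h, if_false]; exact const_mem_lowDegree _ _
      exact lowDegree_mono (by simp) (query_mem_lowDegree (D.z q) h1)
    | challenge e =>
      simp only [FixedGame.run, Complex.ofReal_sum, uniformAvg, div_eq_inv_mul,
        Complex.ofReal_mul]
      refine sum_mem_lowDegree _ fun m => const_mul_mem_lowDegree _ (sum_mem_lowDegree _ fun w => ?_)
      have h1 : ∀ v : Bits o, (fun H => (((D.fix H).run output code ⟨some (D.chal w m v), s.legal ∧
          s.challenge = none ∧ D.size (leftBits m) = D.size (rightBits m)⟩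
          (applyResponse (D.chal w m v) e (projectQuery m e (ψ H))) : ℝ) : ℂ)) ∈
          LowDegree R o (2 * t + 2 * code.length) := by
        refine fun v => ih t _ _ fun x => ?_
        by_cases h : queryBits e (xorResponse e (D.chal w m v) x) = m
        · simp only [applyResponse, projectQuery, h, if_true]; exact hψ _
        · simp only [applyResponse, projectQuery, h, if_false]; exact const_mem_lowDegree _ _
      exact lowDegree_mono (by simp) (query_mem_lowDegree D.y h1)

/-- A random function may be replaced by a hash function that is `2q`-wise independent, where `q`
bounds the number of queries. -/
theorem HashedGame.avg_run_eq (D : HashedGame d R o ct ml N out) (output : Fin out ↪ Fin k)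
    {K : Type} [Fintype K] {h : K → Bits R → Bits o} (code : List (Step d o ct ml k)) {t : ℕ}
    (ht : 2 * code.length ≤ t) (hh : BoundedIndependent t h) (s : CCAState ct) (ψ : QState k) :
    uniformAvg (fun H => (D.fix H).run output code s ψ) =
      uniformAvg fun κ => (D.fix (h κ)).run output code s ψ := by
  have h1 := avg_eq_of_mem_lowDegree hh (lowDegree_mono (by omega)
    (D.run_mem_lowDegree output code 0 s (fun _ => ψ) fun x => const_mem_lowDegree _ _))
  rw [← Complex.ofReal_inj]
  simp only [uniformAvg, Complex.ofReal_div, Complex.ofReal_sum, Complex.ofReal_natCast]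
  exact h1.symm

end HashedGame

/-! ### Simulation on a larger register -/

section Extend

variable {k p a b : ℕ}

/-- The state `ψ` together with additional qubits in the basis state `v`. -/
def extend (ψ : QState k) (v : Bits p) : QState (k + p) := fun x =>
  if rightBits x = v then ψ (leftBits x) else 0

theorem leftBits_update (x : Bits (k + p)) (i : Fin k) (c : Bool) :
    leftBits (Function.update x (Fin.castAdd p i) c) = Function.update (leftBits x) i c := by
  funext j
  by_cases h : j = i
  · subst h; simp [leftBits]
  · have : Fin.castAdd p j ≠ Fin.castAdd p i := fun h' => h (Fin.castAdd_injective k p h')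
    simp [leftBits, h, this]

theorem rightBits_update (x : Bits (k + p)) (i : Fin k) (c : Bool) :
    rightBits (Function.update x (Fin.castAdd p i) c) = rightBits x := by
  funext j
  have : Fin.natAdd k j ≠ Fin.castAdd p i := fun h => by
    have := congrArg Fin.val h
    simp at this
    omega
  simp [rightBits, this]

/-- A gate on the first qubits of a larger register. -/
def Gate.lift (p : ℕ) : Gate k → Gate (k + p)
  | .hadamard i => .hadamard (Fin.castAdd p i)
  | .phase i => .phase (Fin.castAdd p i)
  | .piEighth i => .piEighth (Fin.castAdd p i)
  | .cnot c t h => .cnot (Fin.castAdd p c) (Fin.castAdd p t)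
      fun h' => h (Fin.castAdd_injective k p h')

theorem Gate.lift_apply (g : Gate k) (ψ : QState k) (v : Bits p) :
    (g.lift p).apply (extend ψ v) = extend (g.apply ψ) v := by
  cases g <;> funext x <;>
    simp only [Gate.lift, Gate.apply, extend, rightBits_update, leftBits_update] <;>
    split_ifs <;> simp_all [leftBits]

/-- Projection to the subspace where the wires `f` carry `q`. -/
def projectWires (f : Fin a → Fin k) (q : Bits a) (ψ : QState k) : QState k := fun x =>
  if (fun j => x (f j)) = q then ψ x else 0

theorem ite_comm_zero {P Q : Prop} [Decidable P] [Decidable Q] (c : ℂ) :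
    (if P then if Q then c else 0 else 0) = if Q then if P then c else 0 else 0 := by
  split_ifs <;> rfl

theorem projectWires_extend (f : Fin a → Fin k) (q : Bits a) (ψ : QState k) (v : Bits p) :
    projectWires (fun j => Fin.castAdd p (f j)) q (extend ψ v) = extend (projectWires f q ψ) v := by
  funext x
  exact ite_comm_zero _

theorem projectQubit_extend (i : Fin k) (c : Bool) (ψ : QState k) (v : Bits p) :
    projectQubit (Fin.castAdd p i) c (extend ψ v) = extend (projectQubit i c ψ) v :=
  funext fun _ => ite_comm_zero _

/-- Projection of the additional qubits. -/
theorem projectWires_extend_right (f : Fin a → Fin p) (q : Bits a) (ψ : QState k) (v : Bits p) :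
    projectWires (fun j => Fin.natAdd k (f j)) q (extend ψ v) =
      if (fun j => v (f j)) = q then extend ψ v else 0 := by
  funext x
  by_cases hx : rightBits x = v
  · subst hx
    have h : (fun j => x (Fin.natAdd k (f j))) = fun j => rightBits x (f j) := rfl
    simp only [projectWires, h]
    split_ifs <;> rfl
  · have h : extend ψ v x = 0 := if_neg hx
    simp only [projectWires, h, ite_self]
    split_ifs
    · exact h.symm
    · rfl

theorem extend_zero (v : Bits p) : extend (0 : QState k) v = 0 := by
  funext x
  simp [extend]

theorem applyOracle_projectQuery (F : Bits a → Bits b) (q : Bits a) (e : Fin a ⊕ Fin b ↪ Fin k)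
    (ψ : QState k) :
    applyOracle F e (projectQuery q e ψ) = applyResponse (F q) e (projectQuery q e ψ) := by
  funext x
  simp only [applyOracle, applyResponse, projectQuery, queryBits_xorResponse]
  split_ifs with h
  · rw [h]
  · rfl

/-- Embeddings of registers whose responses lie among the first qubits. -/
theorem applyOracle_extend {a' : ℕ} {F : Bits a → Bits b} {F' : Bits a' → Bits b}
    {e : Fin a ⊕ Fin b ↪ Fin (k + p)} {e' : Fin a' ⊕ Fin b ↪ Fin k} {v : Bits p}
    (he : ∀ j, e (Sum.inr j) = Fin.castAdd p (e' (Sum.inr j)))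
    (hF : ∀ x, rightBits x = v → F (queryBits e x) = F' (queryBits e' (leftBits x)))
    (ψ : QState k) : applyOracle F e (extend ψ v) = extend (applyOracle F' e' ψ) v := by
  have hr : ∀ u x, rightBits (xorResponse e u x) = rightBits x := by
    intro u x
    funext j
    refine xorResponse_of_ne e u x fun i h => ?_
    rw [he] at h
    have := congrArg Fin.val h
    simp at this
    omega
  have hl : ∀ u x, leftBits (xorResponse e u x) = xorResponse e' u (leftBits x) := by
    intro u x
    funext j
    simp only [leftBits, xorResponse, he, (Fin.castAdd_injective k p).eq_iff]
  funext x
  simp only [applyOracle, extend, hr, hl]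
  split_ifs with h
  · rw [hF x h]
  · rfl

/-- XOR into a part of a string. -/
def xorAt (ρ : Fin b → Fin p) (u : Bits b) (v : Bits p) : Bits p :=
  fun w => xor (v w) (decide (∃ j, ρ j = w ∧ u j = true))

/-- Embeddings of registers whose responses lie among the additional qubits. -/
theorem applyOracle_extend_right {F : Bits a → Bits b} {e : Fin a ⊕ Fin b ↪ Fin (k + p)}
    {ρ : Fin b → Fin p} {v : Bits p} {u : Bits b} {ψ : QState k}
    (he : ∀ j, e (Sum.inr j) = Fin.natAdd k (ρ j))
    (hF : ∀ x, ψ (leftBits x) ≠ 0 → rightBits x = v → F (queryBits e x) = u) :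
    applyOracle F e (extend ψ v) = extend ψ (xorAt ρ u v) := by
  have hl : ∀ u x, leftBits (xorResponse e u x) = leftBits x := by
    intro u x
    funext j
    refine xorResponse_of_ne e u x fun i h => ?_
    rw [he] at h
    have := congrArg Fin.val h
    simp at this
    omega
  have hr : ∀ u x, rightBits (xorResponse e u x) = xorAt ρ u (rightBits x) := by
    intro u x
    funext j
    simp only [rightBits, xorResponse, xorAt, he, (Fin.natAdd_injective p k).eq_iff]
  funext x
  simp only [applyOracle, extend, hl]
  by_cases h0 : ψ (leftBits x) = 0
  · simp [h0]
  have key : rightBits (xorResponse e (F (queryBits e x)) x) = v ↔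
      rightBits x = xorAt ρ u v := by
    constructor
    · intro h
      have h1 := hF (xorResponse e (F (queryBits e x)) x) (by rwa [hl]) h
      rw [queryBits_xorResponse] at h1
      rw [h1] at h
      have h2 := hr u (xorResponse e u x)
      rw [xorResponse_self, h] at h2
      exact h2
    · intro h
      have h2 : rightBits (xorResponse e u x) = v := by
        have h3 := hr u (xorResponse e u (Fin.append (leftBits x) v))
        rw [xorResponse_self, rightBits_append, hr, rightBits_append] at h3
        rw [hr, h]
        exact h3.symm
      have h1 := hF (xorResponse e u x) (by rwa [hl]) h2
      rw [queryBits_xorResponse] at h1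
      rw [h1]
      exact h2
  simp only [key]

theorem applyResponse_extend_right {u : Bits b} {e : Fin a ⊕ Fin b ↪ Fin (k + p)}
    {ρ : Fin b → Fin p} {v : Bits p} (he : ∀ j, e (Sum.inr j) = Fin.natAdd k (ρ j)) (ψ : QState k) :
    applyResponse u e (extend ψ v) = extend ψ (xorAt ρ u v) :=
  applyOracle_extend_right (F := fun _ => u) he fun _ _ _ => rfl

theorem xorAt_of_ne {ρ : Fin b → Fin p} {u : Bits b} {v : Bits p} {w : Fin p} (h : ∀ j, ρ j ≠ w) :
    xorAt ρ u v w = v w := by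
  simp [xorAt, h]

theorem xorAt_apply {ρ : Fin b → Fin p} (hρ : Function.Injective ρ) (u : Bits b) (v : Bits p)
    (j : Fin b) : xorAt ρ u v (ρ j) = xor (v (ρ j)) (u j) := by
  have : (∃ j', ρ j' = ρ j ∧ u j' = true) ↔ u j = true :=
    ⟨fun ⟨j', h, hu⟩ => hρ h ▸ hu, fun h => ⟨j, rfl, h⟩⟩
  simp only [xorAt, this, Bool.decide_coe]

theorem xorAt_self (ρ : Fin b → Fin p) (u : Bits b) (v : Bits p) : xorAt ρ u (xorAt ρ u v) = v := by
  funext w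
  simp [xorAt]

open Classical in
theorem sum_extend (ψ : QState k) (v : Bits p) (P : Bits k → Prop) :
    (∑ x : Bits (k + p), if P (leftBits x) then ‖extend ψ v x‖ ^ 2 else 0) =
      ∑ x, if P x then ‖ψ x‖ ^ 2 else 0 := by
  let e : Bits k × Bits p ≃ Bits (k + p) :=
    { toFun := fun z => Fin.append z.1 z.2
      invFun := fun x => (leftBits x, rightBits x)
      left_inv := fun z => by simp [leftBits_append, rightBits_append]
      right_inv := fun x => by
        funext i
        refine Fin.addCases (fun j => ?_) (fun j => ?_) i <;> simp [leftBits, rightBits] }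
  rw [← Equiv.sum_comp e, Fintype.sum_prod_type]
  refine Finset.sum_congr rfl fun x _ => ?_
  rw [Finset.sum_eq_single v]
  · simp [e, leftBits_append, rightBits_append, extend]
  · intro u _ hu
    simp [e, rightBits_append, extend, hu]
  · simp

/-- The embedding of a register in the first qubits into the extended register, where all the
additional qubits become part of the query. -/
def dataEmb (p : ℕ) (e : Fin a ⊕ Fin b ↪ Fin k) : Fin (p + a) ⊕ Fin b ↪ Fin (k + p) where
  toFun := Sum.elim (Fin.addCases (fun i => Fin.natAdd k i) fun i => Fin.castAdd p (e (Sum.inl i)))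
    fun j => Fin.castAdd p (e (Sum.inr j))
  inj' := by
    have h : ∀ (i : Fin p) (j : Fin k), Fin.natAdd k i ≠ Fin.castAdd p j := fun i j h => by
      have := congrArg Fin.val h
      simp at this
      omega
    have inj : ∀ i j, Fin.castAdd p (e i) = Fin.castAdd p (e j) → i = j := fun i j h =>
      e.injective (Fin.castAdd_injective k p h)
    rintro (i | i) (j | j)
    · refine Fin.addCases (fun i => ?_) (fun i => ?_) i <;>
        refine Fin.addCases (fun j => ?_) (fun j => ?_) j <;> intro hij <;>
        simp only [Sum.elim_inl, Fin.addCases_left, Fin.addCases_right] at hij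
      · rw [Fin.natAdd_injective p k hij]
      · exact absurd hij (h _ _)
      · exact absurd hij.symm (h _ _)
      · rw [Sum.inl.inj (inj _ _ hij)]
    · refine Fin.addCases (fun i => ?_) (fun i => ?_) i <;> intro hij <;>
        simp only [Sum.elim_inl, Sum.elim_inr, Fin.addCases_left, Fin.addCases_right] at hij
      · exact absurd hij (h _ _)
      · cases inj _ _ hij
    · refine Fin.addCases (fun j => ?_) (fun j => ?_) j <;> intro hij <;>
        simp only [Sum.elim_inl, Sum.elim_inr, Fin.addCases_left, Fin.addCases_right] at hij
      · exact absurd hij.symm (h _ _)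
      · cases inj _ _ hij
    · intro hij
      rw [Sum.inr.inj (inj _ _ hij)]

theorem dataEmb_inl_castAdd (e : Fin a ⊕ Fin b ↪ Fin k) (i : Fin p) :
    dataEmb p e (Sum.inl (Fin.castAdd a i)) = Fin.natAdd k i := by
  change Fin.addCases (motive := fun _ => Fin (k + p)) (fun i => Fin.natAdd k i)
    (fun i => Fin.castAdd p (e (Sum.inl i))) (Fin.castAdd a i) = _
  rw [Fin.addCases_left]

theorem dataEmb_inl_natAdd (e : Fin a ⊕ Fin b ↪ Fin k) (i : Fin a) :
    dataEmb p e (Sum.inl (Fin.natAdd p i)) = Fin.castAdd p (e (Sum.inl i)) := by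
  change Fin.addCases (motive := fun _ => Fin (k + p)) (fun i => Fin.natAdd k i)
    (fun i => Fin.castAdd p (e (Sum.inl i))) (Fin.natAdd p i) = _
  rw [Fin.addCases_right]

theorem applyOracle_dataEmb (F : Bits (p + a) → Bits b) (e : Fin a ⊕ Fin b ↪ Fin k) (ψ : QState k)
    (v : Bits p) : applyOracle F (dataEmb p e) (extend ψ v) =
      extend (applyOracle (fun x => F (Fin.append v x)) e ψ) v := by
  refine applyOracle_extend (e := dataEmb p e) (e' := e) (fun j => rfl) (fun x hx => congrArg F ?_) ψ
  subst hx
  funext i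
  refine Fin.addCases (fun i => ?_) (fun i => ?_) i <;>
    simp [queryBits, dataEmb_inl_castAdd, dataEmb_inl_natAdd, rightBits, leftBits]

/-- Circuits are evaluated with a workspace of zeros. -/
theorem exists_gates_extend {s : ℕ} {φ : Bits a → Bits b} (h : HasCircuit s φ)
    (e : Fin a ⊕ Fin b ↪ Fin k) : ∃ gs : List (Gate (k + s)), gs.length ≤ 100 * s + b ∧
      ∀ ψ : QState k, applyGates gs (extend ψ fun _ : Fin s => false) =
        extend (applyOracle φ e ψ) fun _ => false := by
  obtain ⟨C, hC, hφ⟩ := h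
  let e' : Fin a ⊕ Fin b ↪ Fin (k + s) := e.trans (Fin.castAddEmb s)
  let w : Fin C.gates.length ↪ Fin (k + s) :=
    (Fin.castLEEmb hC).trans (Fin.natAddEmb k)
  obtain ⟨gs, hgs, H⟩ := exists_clean_circuit (C := C) (e := e') (w := w) (by
    intro i j h
    have := congrArg Fin.val h
    simp [e', w] at this
    omega)
  refine ⟨gs, by omega, fun ψ => ?_⟩
  rw [H]
  · have : C.eval = φ := funext hφ
    rw [this]
    exact applyOracle_extend (e := e') (e' := e) (fun j => rfl) (fun x _ => rfl) ψ
  · intro x hx j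
    simp only [extend, ne_eq, ite_eq_right_iff, Classical.not_imp] at hx
    exact congrFun hx.1 (Fin.castLE hC j)

/-- The basis state `v`. -/
def basisState (v : Bits k) : QState k := fun x => if x = v then 1 else 0

theorem extend_basisState (u : Bits k) (v : Bits p) :
    extend (basisState u) v = basisState (Fin.append u v) := by
  funext x
  have h : x = Fin.append u v ↔ rightBits x = v ∧ leftBits x = u := by
    constructor
    · rintro rfl
      exact ⟨rightBits_append _ _, leftBits_append _ _⟩
    · rintro ⟨rfl, rfl⟩
      funext i
      refine Fin.addCases (fun j => ?_) (fun j => ?_) i <;> simp [leftBits, rightBits]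
  simp only [extend, basisState, h, ite_and]

/-- Writing the input `v` into qubits in the state `0`. -/
theorem applyResponse_basisState (ι : Fin b ↪ Fin k) (v : Bits b) :
    applyResponse v ((Equiv.emptySum (Fin 0) (Fin b)).toEmbedding.trans ι)
      (basisState fun _ => false) = startState ι v := by
  funext x
  set e : Fin 0 ⊕ Fin b ↪ Fin k := (Equiv.emptySum (Fin 0) (Fin b)).toEmbedding.trans ι
  have h1 : (fun w => decide (∃ j, ι j = w ∧ v j = true)) = xorResponse e v fun _ => false := by
    funext w
    simp [xorResponse, e]
  have h2 : xorResponse e v x = (fun _ => false) ↔ x = xorResponse e v fun _ => false :=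
    ⟨fun h => by rw [← h, xorResponse_self], fun h => by rw [h, xorResponse_self]⟩
  simp only [applyResponse, basisState, startState, h1, h2]

end Extend

section Simulation

variable {I : Interface} {inp out k m s a b : ℕ} (G : Game I inp out) (r : G.Coins)

/-- The state of a simulation: the register of the simulated adversary, some data, and a clean
workspace. -/
def simState (s : ℕ) (ψ : QState k) (v : Bits m) : QState (k + m + s) :=
  extend (extend ψ v) fun _ => false

/-- The first qubits of the register of a simulation. -/
def simEmb (k m s : ℕ) : Fin k ↪ Fin (k + m + s) := (Fin.castAddEmb m).trans (Fin.castAddEmb s)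

open Classical in
theorem Game.run_simState_nil (output : Fin out ↪ Fin k) (σ : G.State) (ψ : QState k)
    (v : Bits m) : G.run r (output.trans (simEmb k m s)) [] σ (simState s ψ v) =
      ∑ x : Bits k, if G.wins r σ (fun j => x (output j)) then ‖ψ x‖ ^ 2 else 0 := by
  rw [Game.run_nil, ← sum_extend ψ v, ← sum_extend (extend ψ v) fun _ : Fin s => false]
  rfl

variable (output : Fin out ↪ Fin (k + m + s)) (code : List (Instr I (k + m + s))) (σ : G.State)
  (ψ : QState k) (v : Bits m)

theorem Game.run_simState_gate (g : Gate k) :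
    G.run r output (.gate ((g.lift m).lift s) :: code) σ (simState s ψ v) =
      G.run r output code σ (simState s (g.apply ψ) v) := by
  rw [Game.run_gate, simState, Gate.lift_apply, Gate.lift_apply, simState]

theorem Game.run_simState_measure (i : Fin k) :
    G.run r output (.measure (simEmb k m s i) :: code) σ (simState s ψ v) =
      ∑ c : Bool, G.run r output code σ (simState s (projectQubit i c ψ) v) := by
  rw [Game.run_measure]
  refine Finset.sum_congr rfl fun c _ => congrArg _ ?_
  exact (projectQubit_extend _ _ _ _).trans (congrArg (extend · _) (projectQubit_extend _ _ _ _))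

/-- Measuring a query register. -/
def measureQuery (I : Interface) (m s : ℕ) (e : Fin a ⊕ Fin b ↪ Fin k) :
    List (Instr I (k + m + s)) :=
  List.ofFn fun j : Fin a => .measure (simEmb k m s (e (Sum.inl j)))

theorem Game.run_simState_measureQuery (e : Fin a ⊕ Fin b ↪ Fin k) :
    G.run r output (measureQuery I m s e ++ code) σ (simState s ψ v) =
      ∑ q : Bits a, G.run r output code σ (simState s (projectQuery q e ψ) v) := by
  rw [measureQuery, Game.run_measure_wires]
  refine Finset.sum_congr rfl fun q _ => congrArg _ ?_
  exact (projectWires_extend _ q _ _).trans (congrArg (extend · _) (projectWires_extend _ q _ _))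

theorem exists_simState_gates {φ : Bits (m + a) → Bits b} (h : HasCircuit s φ)
    (e : Fin a ⊕ Fin b ↪ Fin k) : ∃ gs : List (Gate (k + m + s)), gs.length ≤ 100 * s + b ∧
      ∀ (ψ : QState k) (v : Bits m), applyGates gs (simState s ψ v) =
        simState s (applyOracle (fun x => φ (Fin.append v x)) e ψ) v := by
  obtain ⟨gs, hgs, H⟩ := exists_gates_extend h (dataEmb m e)
  refine ⟨gs, hgs, fun ψ v => ?_⟩
  rw [simState, H, applyOracle_dataEmb, simState]

end Simulation

/-! ### Circuits for parts of strings -/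

section Parts

variable {X : Type} {a b : ℕ} {V : Set (X → Bool)}

theorem coords_leftBits (θ : X → Bits (a + b)) : coords (fun x => leftBits (θ x)) ⊆ coords θ := by
  rintro f ⟨i, rfl⟩
  exact ⟨Fin.castAdd b i, rfl⟩

theorem coords_rightBits (θ : X → Bits (a + b)) : coords (fun x => rightBits (θ x)) ⊆ coords θ := by
  rintro f ⟨i, rfl⟩
  exact ⟨Fin.natAdd a i, rfl⟩

theorem Comp.left {θ : X → Bits (a + b)} {s : ℕ} (h : Comp V s (coords θ)) :
    Comp V s (coords fun x => leftBits (θ x)) := h.mono_right (coords_leftBits θ)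

theorem Comp.right {θ : X → Bits (a + b)} {s : ℕ} (h : Comp V s (coords θ)) :
    Comp V s (coords fun x => rightBits (θ x)) := h.mono_right (coords_rightBits θ)

/-- A circuit for a function of two arguments. -/
theorem Comp.circuit₂ {c s t u : ℕ} {θ : X → Bits a} {η : X → Bits b}
    {φ : Bits a → Bits b → Bits c} (hφ : HasCircuit s fun z => φ (leftBits z) (rightBits z))
    (hV : (fun _ => false) ∈ V) (hθ : Comp V t (coords θ)) (hη : Comp V u (coords η)) :
    Comp V (t + u + s) (coords fun x => φ (θ x) (η x)) := by
  have h := (hθ.append hη).circuit hφ hV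
  simpa only [leftBits_append, rightBits_append] using h

/-- A circuit for a function of three arguments. -/
theorem Comp.circuit₃ {c d s t u w : ℕ} {θ : X → Bits a} {η : X → Bits b} {ζ : X → Bits c}
    {φ : Bits a → Bits b → Bits c → Bits d}
    (hφ : HasCircuit s fun z => φ (leftBits (leftBits z)) (rightBits (leftBits z)) (rightBits z))
    (hV : (fun _ => false) ∈ V) (hθ : Comp V t (coords θ)) (hη : Comp V u (coords η))
    (hζ : Comp V w (coords ζ)) : Comp V (t + u + w + s) (coords fun x => φ (θ x) (η x) (ζ x)) := by
  have h := ((hθ.append hη).append hζ).circuit hφ hV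
  simpa only [leftBits_append, rightBits_append] using h

/-- The functions available to a circuit at the start. -/
def inputs (a : ℕ) : Set (Bits a → Bool) := insert (fun _ => false) (coords id)

theorem false_mem_inputs (a : ℕ) : (fun _ => false) ∈ inputs a := Set.mem_insert _ _

theorem comp_inputs (a : ℕ) : Comp (inputs a) 0 (coords fun z : Bits a => z) :=
  .base (Set.subset_insert _ _)

end Parts

/-! ### Inverting the trapdoor function -/

section Inverter

variable {d o ct ml N out inp k : ℕ}

theorem HasCircuit.mono {a b s t : ℕ} {φ : Bits a → Bits b} (h : HasCircuit s φ) (hst : s ≤ t) :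
    HasCircuit t φ :=
  let ⟨C, hC, hφ⟩ := h
  ⟨C, hC.trans hst, hφ⟩

/-- A fixed game whose answers are computed by circuits from the query and some data `v` can be
played without a challenger. -/
theorem FixedGame.exists_simulation (I : Interface) {m s : ℕ} {φO : Bits (m + d) → Bits o}
    {φD : Bits (m + ct) → Bits (ml + 1)} {φC : Bits (m + (ml + ml)) → Bits ct}
    (hO : HasCircuit s φO) (hD : HasCircuit s φD) (hC : HasCircuit s φC) (output : Fin out ↪ Fin k)
    (code : List (Step d o ct ml k)) :
    ∃ code' : List (Instr I (k + m + s)),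
      code'.length ≤ (100 * s + o + ct + 2 * ml + 1) * code.length ∧
      ∀ (G : Game I inp out) (r : G.Coins) (σ : G.State) (v : Bits m)
        (D : FixedGame d o ct ml N out), (D.O = fun x => φO (Fin.append v x)) →
        (D.dec = fun c => φD (Fin.append v c)) → (D.chal = fun _ c => φC (Fin.append v c)) →
        (∀ x, D.win x → G.wins r σ x) → ∀ (τ : CCAState ct) (ψ : QState k),
          D.run output code τ ψ ≤
            G.run r (output.trans (simEmb k m s)) code' σ (simState s ψ v) := by
  induction code with
  | nil =>
    refine ⟨[], by simp, fun G r σ v D _ _ _ hw τ ψ => ?_⟩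
    rw [FixedGame.run_nil, Game.run_simState_nil]
    refine Finset.sum_le_sum fun x _ => ?_
    by_cases h : τ.legal ∧ D.win fun j => x (output j)
    · rw [if_pos h, if_pos (hw _ h.2)]
    · rw [if_neg h]
      split_ifs <;> positivity
  | cons c code ih =>
    obtain ⟨code', hlen, H⟩ := ih
    cases c with
    | gate g =>
      refine ⟨.gate ((g.lift m).lift s) :: code', ?_, fun G r σ v D h1 h2 h3 hw τ ψ => ?_⟩
      · rw [List.length_cons, List.length_cons, Nat.mul_succ]; omega
      · rw [FixedGame.run, Game.run_simState_gate]
        exact H G r σ v D h1 h2 h3 hw τ _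
    | measure i =>
      refine ⟨.measure (simEmb k m s i) :: code', ?_, fun G r σ v D h1 h2 h3 hw τ ψ => ?_⟩
      · rw [List.length_cons, List.length_cons, Nat.mul_succ]; omega
      · rw [FixedGame.run, Game.run_simState_measure]
        exact Finset.sum_le_sum fun c _ => H G r σ v D h1 h2 h3 hw τ _
    | oracle e =>
      obtain ⟨gs, hgs, hg⟩ := exists_simState_gates hO e
      refine ⟨gs.map .gate ++ code', ?_, fun G r σ v D h1 h2 h3 hw τ ψ => ?_⟩
      · rw [List.length_append, List.length_map, List.length_cons, Nat.mul_succ]; omega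
      · rw [FixedGame.run, Game.run_gates, hg, h1]
        exact H G r σ v D h1 h2 h3 hw τ _
    | dec e =>
      obtain ⟨gs, hgs, hg⟩ := exists_simState_gates hD e
      refine ⟨measureQuery I m s e ++ (gs.map .gate ++ code'), ?_,
        fun G r σ v D h1 h2 h3 hw τ ψ => ?_⟩
      · rw [List.length_append, List.length_append, List.length_map, List.length_cons,
          Nat.mul_succ, measureQuery, List.length_ofFn]
        omega
      · rw [FixedGame.run, Game.run_simState_measureQuery]
        refine Finset.sum_le_sum fun q _ => ?_
        rw [Game.run_gates, hg, applyOracle_projectQuery, h2]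
        exact H G r σ v D h1 h2 h3 hw _ _
    | challenge e =>
      obtain ⟨gs, hgs, hg⟩ := exists_simState_gates hC e
      refine ⟨measureQuery I m s e ++ (gs.map .gate ++ code'), ?_,
        fun G r σ v D h1 h2 h3 hw τ ψ => ?_⟩
      · rw [List.length_append, List.length_append, List.length_map, List.length_cons,
          Nat.mul_succ, measureQuery, List.length_ofFn]
        omega
      · rw [FixedGame.run, Game.run_simState_measureQuery]
        refine Finset.sum_le_sum fun q _ => ?_
        rw [Game.run_gates, hg, applyOracle_projectQuery, h3]
        refine (uniformAvg_mono fun w => H G r σ v D h1 h2 h3 hw _ _).trans ?_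
        rw [uniformAvg_const]

theorem startState_data {m s : ℕ} (v : Bits m) :
    startState ((Fin.natAddEmb k).trans (Fin.castAddEmb s)) v =
      simState s (basisState fun _ : Fin k => false) v := by
  rw [simState, extend_basisState, extend_basisState]
  have h : (fun w => decide (∃ j, ((Fin.natAddEmb k).trans (Fin.castAddEmb s)) j = w ∧ v j = true)) =
      Fin.append (Fin.append (fun _ : Fin k => false) v) fun _ : Fin s => false := by
    funext w
    refine Fin.addCases (fun w => Fin.addCases (fun w => ?_) (fun w => ?_) w) (fun w => ?_) w
    · rw [Fin.append_right]
      refine decide_eq_false ?_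
      rintro ⟨j, hj, -⟩
      have := congrArg Fin.val hj
      simp at this
      omega
    · rw [Fin.append_left, Fin.append_left]
      refine decide_eq_false ?_
      rintro ⟨j, hj, -⟩
      have := congrArg Fin.val hj
      simp at this
      omega
    · rw [Fin.append_left, Fin.append_right]
      have : (∃ j, ((Fin.natAddEmb k).trans (Fin.castAddEmb s)) j =
          Fin.castAdd s (Fin.natAdd k w) ∧ v j = true) ↔ v w = true := by
        refine ⟨fun ⟨j, hj, hv⟩ => ?_, fun hv => ⟨w, rfl, hv⟩⟩
        have hjw : j = w := Fin.natAdd_injective m k (Fin.castAdd_injective (k + m) s hj)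
        exact hjw ▸ hv
      simp only [this, Bool.decide_coe]
  funext x
  rw [startState, h, basisState]

/-- The chosen ciphertext game against the hybrid scheme where the random oracle is `H ∘ f pk`, the
first part of the challenge ciphertext is `y`, and decryption and the challenge use `H` directly. The
coins of the symmetric encryption of the challenge are `θ w`. -/
def hybridGame (T : TrapdoorFunction) (S : SymScheme) (n : ℕ) (pk : Bits (T.pkLen n))
    (y : Bits (T.rangeLen n)) (b : Bool) (θ : Bits N → Bits (S.encCoins n)) (win : Bits out → Prop) :
    HashedGame (T.domLen n) (T.rangeLen n) n (T.rangeLen n + S.ctLen n) (S.msgLen n) N out where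
  size := S.msgSize n
  p := T.f n pk
  z := leftBits
  y := y
  dec := fun c κ => encodeOption (S.dec n κ (rightBits c))
  chal := fun w m κ => Fin.append y (S.enc n κ (if b then rightBits m else leftBits m) (θ w))
  space := {c | leftBits c ∈ Set.range (T.f n pk)}
  win := win

variable {T : TrapdoorFunction} {S : SymScheme} {n P : ℕ}

/-- Bounds on everything that enters the cost of the reductions. -/
structure CostBound (T : TrapdoorFunction) (S : SymScheme) (n P : ℕ) : Prop where
  length : n + T.pkLen n + T.domLen n + T.rangeLen n + S.msgLen n + S.ctLen n + S.encCoins n ≤ P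
  f : HasCircuit P fun z => T.f n (leftBits z) (rightBits z)
  enc : HasCircuit P fun z => S.enc n (leftBits (leftBits z)) (rightBits (leftBits z)) (rightBits z)
  dec : HasCircuit P fun z => encodeOption (S.dec n (leftBits z) (rightBits z))

theorem coords_message {X : Type} {V : Set (X → Bool)} {a s : ℕ} {θ : X → Bits (a + a)}
    (h : Comp V s (coords θ)) (b : Bool) :
    Comp V s (coords fun x => if b then rightBits (θ x) else leftBits (θ x)) := by
  cases b
  · exact h.left
  · exact h.right

/-- An adversary that queries the random oracle at a preimage of `y` inverts `f pk`. -/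
theorem exists_inverter (hP : CostBound T S n P) {h : Bits (T.rangeLen n) → Bits n}
    (hh : HasCircuit P h) (b : Bool) (u : Bits (S.encCoins n)) (input : Fin (T.pkLen n) ↪ Fin k)
    (output : Fin (T.domLen n) ↪ Fin k)
    (code : List (Step (T.domLen n) n (T.rangeLen n + S.ctLen n) (S.msgLen n) k))
    (hk : k + code.length ≤ P) :
    ∃ B : Adversary noInterface (T.pkLen n + T.rangeLen n) (T.domLen n),
      B.qubits + B.code.length ≤ 1000 * (P + 1) ^ 2 ∧
      (uniformAvg fun r : Bits (T.keyCoins n) × Bits (T.domLen n) =>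
        ((hybridGame T S n (T.keyGen n r.1).1 (T.f n (T.keyGen n r.1).1 r.2) b (fun _ : Bits 0 => u)
          fun z => T.f n (T.keyGen n r.1).1 z = T.f n (T.keyGen n r.1).1 r.2).fix h).run output code
            ⟨none, True⟩ (startState input (T.keyGen n r.1).1)) ≤ (T.invGame n).winProb B := by
  have hlen := hP.length
  set m := T.pkLen n + T.rangeLen n with hm
  set s := 4 * P with hs
  let φO : Bits (m + T.domLen n) → Bits n := fun z => h (T.f n (leftBits (leftBits z)) (rightBits z))
  let φD : Bits (m + (T.rangeLen n + S.ctLen n)) → Bits (S.msgLen n + 1) := fun z =>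
    encodeOption (S.dec n (h (leftBits (rightBits z))) (rightBits (rightBits z)))
  let φC : Bits (m + (S.msgLen n + S.msgLen n)) → Bits (T.rangeLen n + S.ctLen n) := fun z =>
    Fin.append (rightBits (leftBits z)) (S.enc n (h (rightBits (leftBits z)))
      (if b then rightBits (rightBits z) else leftBits (rightBits z)) u)
  let φI : Bits (m + 0) → Bits (T.pkLen n) := fun z => leftBits (leftBits z)
  have hO : HasCircuit s φO := by
    have hz := comp_inputs (m + T.domLen n)
    have hV := false_mem_inputs (m + T.domLen n)
    refine (Comp.hasCircuit (((Comp.circuit₂ hP.f hV hz.left.left hz.right).circuit hh hV))).mono ?_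
    omega
  have hD : HasCircuit s φD := by
    have hz := comp_inputs (m + (T.rangeLen n + S.ctLen n))
    have hV := false_mem_inputs (m + (T.rangeLen n + S.ctLen n))
    refine (Comp.hasCircuit (Comp.circuit₂ (φ := fun κ c => encodeOption (S.dec n κ c)) hP.dec hV
      (hz.right.left.circuit hh hV) hz.right.right)).mono ?_
    omega
  have hC : HasCircuit s φC := by
    have hz := comp_inputs (m + (S.msgLen n + S.msgLen n))
    have hV := false_mem_inputs (m + (S.msgLen n + S.msgLen n))
    refine (Comp.hasCircuit (hz.left.right.append (Comp.circuit₃ (φ := S.enc n) hP.enc hV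
      (hz.left.right.circuit hh hV) (coords_message hz.right b) (comp_coords_const hV u)))).mono ?_
    omega
  have hI : HasCircuit s φI :=
    (Comp.hasCircuit (comp_inputs (m + 0)).left.left).mono (Nat.zero_le _)
  obtain ⟨code', hcode', H⟩ := FixedGame.exists_simulation (N := 0)
    (inp := T.pkLen n + T.rangeLen n) noInterface hO hD hC output code
  obtain ⟨gs, hgs, hg⟩ := exists_simState_gates hI
    ((Equiv.emptySum (Fin 0) (Fin (T.pkLen n))).toEmbedding.trans input)
  refine ⟨⟨k + m + s, (Fin.natAddEmb k).trans (Fin.castAddEmb s), output.trans (simEmb k m s),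
    gs.map .gate ++ code'⟩, ?_, uniformAvg_mono fun r => ?_⟩
  · simp only [List.length_append, List.length_map]
    have h1 : code'.length ≤ (404 * P + 1) * P := hcode'.trans
      (Nat.mul_le_mul (by omega) (by omega))
    nlinarith
  · set pk := (T.keyGen n r.1).1 with hpk
    set v : Bits m := Fin.append pk (T.f n pk r.2) with hv
    have hstart : startState ((Fin.natAddEmb k).trans (Fin.castAddEmb s)) v =
        simState s (basisState fun _ => false) v := startState_data v
    -- the first gates copy the public key into the register of the simulated adversary
    have hinit : applyGates gs (simState s (basisState fun _ => false) v) =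
        simState s (startState input pk) v := by
      rw [hg, ← applyResponse_basisState]
      have h1 : ∀ x, φI (Fin.append v x) = pk := fun x => by
        simp only [φI, hv, leftBits_append]
      simp only [h1]
      rfl
    refine (H (T.invGame n) r () v _ ?_ ?_ ?_ ?_ _ _).trans (le_of_eq ?_)
    · funext x
      simp only [φO, hv, leftBits_append, rightBits_append]
      rfl
    · funext c
      simp only [φD, rightBits_append]
      rfl
    · funext w c
      simp only [φC, hv, leftBits_append, rightBits_append]
      rfl
    · exact fun x hx => hx
    · refine Eq.trans ?_ (Game.run_gates _ _ _ _ _ _ _).symm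
      refine congrArg _ (hinit.symm.trans (congrArg _ ?_))
      exact hstart.symm

end Inverter

/-! ### Breaking the symmetric scheme -/

section CircuitParts

variable {X : Type} {V : Set (X → Bool)} {b s t u : ℕ}

theorem Comp.coords_ite {c : X → Bool} {θ η : X → Bits b} (hc : Comp V s {c})
    (hθ : Comp V t (coords θ)) (hη : Comp V u (coords η)) :
    Comp V (s + t + u + b * 8) (coords fun x => if c x then θ x else η x) := by
  refine ((hc.union hθ).union hη).trans (Comp.coords_of_forall fun j => ?_)
  have h := Comp.single_ite (V := V ∪ ({c} ∪ coords θ ∪ coords η)) (c := c)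
    (f := fun x => θ x j) (g := fun x => η x j) (by simp)
    (Or.inr (Or.inl (Or.inr (mem_coords θ j)))) (Or.inr (Or.inr (mem_coords η j)))
  refine h.mono_right ?_
  rintro f rfl
  refine funext fun x => ?_
  split_ifs <;> rfl

theorem Comp.coords_not {θ : X → Bits b} (hθ : Comp V t (coords θ)) :
    Comp V (t + b) (coords fun x j => !(θ x j)) := by
  have h : Comp (V ∪ coords θ) (b * 1) (coords fun x j => !(θ x j)) :=
    Comp.coords_of_forall fun j => (Comp.base (s := 0)
      (Set.singleton_subset_iff.2 (Or.inr (mem_coords θ j)))).single_not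
  rw [mul_one] at h
  exact hθ.trans h

/-- A comparison with a constant. -/
theorem Comp.eq_const {θ : X → Bits b} (hθ : Comp V t (coords θ)) (hV : (fun _ => false) ∈ V)
    (v : Bits b) : Comp V (t + (b * 23 + 1)) {fun x => decide (θ x = v)} :=
  hθ.trans (comp_eq_const (Or.inl hV) Set.subset_union_right v)

end CircuitParts

section Data

variable {c a : ℕ}

/-- The data of the symmetric reduction: the second part of the challenge ciphertext (zero before the
challenge), a query, and the answer to it. -/
def simData (x q : Bits c) (z : Bits a) : Bits (c + c + a) := Fin.append (Fin.append x q) z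

/-- The wires of the challenge ciphertext. -/
def chalWire (a : ℕ) (i : Fin c) : Fin (c + c + a) := Fin.castAdd a (Fin.castAdd c i)

/-- The wires of the query. -/
def queryWire (a : ℕ) (i : Fin c) : Fin (c + c + a) := Fin.castAdd a (Fin.natAdd c i)

/-- The wires of the answer. -/
def answerWire (c : ℕ) (j : Fin a) : Fin (c + c + a) := Fin.natAdd (c + c) j

theorem chalWire_injective : Function.Injective (chalWire (c := c) a) := fun i j h => by
  have := congrArg Fin.val h
  simp [chalWire] at this
  exact Fin.ext this

theorem queryWire_injective : Function.Injective (queryWire (c := c) a) := fun i j h => by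
  have := congrArg Fin.val h
  simp [queryWire] at this
  exact Fin.ext this

theorem answerWire_injective : Function.Injective (answerWire (a := a) c) := fun i j h => by
  have := congrArg Fin.val h
  simp [answerWire] at this
  exact Fin.ext this

theorem chalWire_ne_queryWire (i j : Fin c) : chalWire a i ≠ queryWire a j := fun h => by
  have := congrArg Fin.val h
  simp [chalWire, queryWire] at this
  omega

theorem queryWire_ne_answerWire (i : Fin c) (j : Fin a) : queryWire a i ≠ answerWire c j :=
  fun h => by
    have := congrArg Fin.val h
    simp [queryWire, answerWire] at this
    omega

theorem chalWire_ne_answerWire (i : Fin c) (j : Fin a) : chalWire a i ≠ answerWire c j :=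
  fun h => by
    have := congrArg Fin.val h
    simp [chalWire, answerWire] at this
    omega

@[simp] theorem simData_chalWire (x q : Bits c) (z : Bits a) (i : Fin c) :
    simData x q z (chalWire a i) = x i := by
  simp [simData, chalWire]

@[simp] theorem simData_queryWire (x q : Bits c) (z : Bits a) (i : Fin c) :
    simData x q z (queryWire a i) = q i := by
  rw [simData, queryWire, Fin.append_left, Fin.append_right]

@[simp] theorem simData_answerWire (x q : Bits c) (z : Bits a) (j : Fin a) :
    simData x q z (answerWire c j) = z j := by
  simp [simData, answerWire]

theorem simData_ext {v w : Bits (c + c + a)} (h1 : ∀ i, v (chalWire a i) = w (chalWire a i))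
    (h2 : ∀ i, v (queryWire a i) = w (queryWire a i))
    (h3 : ∀ j, v (answerWire c j) = w (answerWire c j)) : v = w := by
  funext i
  exact Fin.addCases (fun i => Fin.addCases h1 h2 i) h3 i

theorem xorAt_chalWire (u q : Bits c) (z : Bits a) :
    xorAt (chalWire a) u (simData (fun _ => false) q z) = simData u q z := by
  refine simData_ext (fun i => ?_) (fun i => ?_) fun j => ?_
  · rw [xorAt_apply chalWire_injective]; simp
  · rw [xorAt_of_ne fun j => chalWire_ne_queryWire j i]; simp
  · rw [xorAt_of_ne fun i => chalWire_ne_answerWire i j]; simp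

theorem xorAt_queryWire (x u : Bits c) (z : Bits a) :
    xorAt (queryWire a) u (simData x (fun _ => false) z) = simData x u z := by
  refine simData_ext (fun i => ?_) (fun i => ?_) fun j => ?_
  · rw [xorAt_of_ne fun j => (chalWire_ne_queryWire i j).symm]; simp
  · rw [xorAt_apply queryWire_injective]; simp
  · rw [xorAt_of_ne fun i => queryWire_ne_answerWire i j]; simp

theorem xorAt_answerWire (x q : Bits c) (u : Bits a) :
    xorAt (answerWire c) u (simData x q fun _ => false) = simData x q u := by
  refine simData_ext (fun i => ?_) (fun i => ?_) fun j => ?_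
  · rw [xorAt_of_ne fun j => (chalWire_ne_answerWire i j).symm]; simp
  · rw [xorAt_of_ne fun j => (queryWire_ne_answerWire i j).symm]; simp
  · rw [xorAt_apply answerWire_injective]; simp

end Data

section SymReduction

variable {S : SymScheme} {n k m s : ℕ}

/-- Two disjoint registers. -/
def registers {a b : ℕ} (f : Fin a → Fin k) (g : Fin b → Fin k) (hf : Function.Injective f)
    (hg : Function.Injective g) (h : ∀ i j, f i ≠ g j) : Fin a ⊕ Fin b ↪ Fin k :=
  ⟨Sum.elim f g, hf.sumElim hg h⟩

/-- `Game.run` for the symmetric game. -/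
def SymScheme.play (S : SymScheme) (n : ℕ) (r : Bits n × Bool) (output : Fin 1 ↪ Fin k)
    (code : List (Instr (S.interface n) k)) (σ : CCAState (S.ctLen n)) (ψ : QState k) : ℝ :=
  (S.ccaGame n).run r output code σ ψ

/-- A decryption query in the symmetric game. -/
def SymScheme.decInstr (S : SymScheme) (n : ℕ)
    (e : Fin (S.ctLen n) ⊕ Fin (S.msgLen n + 1) ↪ Fin k) : Instr (S.interface n) k :=
  .query SymQuery.dec e

/-- A challenge in the symmetric game. -/
def SymScheme.chalInstr (S : SymScheme) (n : ℕ)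
    (e : Fin (S.msgLen n + S.msgLen n) ⊕ Fin (S.ctLen n) ↪ Fin k) : Instr (S.interface n) k :=
  .query SymQuery.challenge e

namespace SymScheme

variable (r : Bits n × Bool) (output : Fin 1 ↪ Fin k) (code : List (Instr (S.interface n) k))
  (σ : CCAState (S.ctLen n)) (ψ : QState k)

theorem play_nonneg : 0 ≤ S.play n r output code σ ψ := Game.run_nonneg _ _ _ _ _ _

theorem play_zero : S.play n r output code σ 0 = 0 := Game.run_zero _ _ _ _ _

theorem play_gates (gs : List (Gate k)) :
    S.play n r output (gs.map .gate ++ code) σ ψ = S.play n r output code σ (applyGates gs ψ) :=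
  Game.run_gates _ _ _ _ _ _ _

theorem play_dec (e : Fin (S.ctLen n) ⊕ Fin (S.msgLen n + 1) ↪ Fin k) :
    S.play n r output (S.decInstr n e :: code) σ ψ =
      ∑ q : Bits (S.ctLen n), S.play n r output code
        ⟨σ.challenge, σ.legal ∧ σ.challenge ≠ some q⟩
        (applyResponse (encodeOption (S.dec n r.1 q)) e (projectQuery q e ψ)) :=
  (Game.run_query _ _ _ _ _ _ _ _).trans
    (Finset.sum_congr rfl fun _ _ => uniformAvg_const (α := Bits 0) _)

theorem play_challenge (e : Fin (S.msgLen n + S.msgLen n) ⊕ Fin (S.ctLen n) ↪ Fin k) :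
    S.play n r output (S.chalInstr n e :: code) σ ψ =
      ∑ m : Bits (S.msgLen n + S.msgLen n), uniformAvg fun w : Bits (S.encCoins n) =>
        S.play n r output code
          ⟨some (S.enc n r.1 (if r.2 then rightBits m else leftBits m) w), σ.legal ∧
            σ.challenge = none ∧ S.msgSize n (leftBits m) = S.msgSize n (rightBits m)⟩
          (applyResponse (S.enc n r.1 (if r.2 then rightBits m else leftBits m) w) e
            (projectQuery m e ψ)) :=
  Game.run_query _ _ _ _ _ _ _ _

end SymScheme

theorem SymScheme.play_simState_gate (r : Bits n × Bool) (output : Fin 1 ↪ Fin (k + m + s))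
    (code : List (Instr (S.interface n) (k + m + s))) (σ : CCAState (S.ctLen n)) (ψ : QState k)
    (v : Bits m) (g : Gate k) :
    S.play n r output (.gate ((g.lift m).lift s) :: code) σ (simState s ψ v) =
      S.play n r output code σ (simState s (g.apply ψ) v) :=
  Game.run_simState_gate _ _ _ _ _ _ _ _

theorem SymScheme.play_simState_measure (r : Bits n × Bool) (output : Fin 1 ↪ Fin (k + m + s))
    (code : List (Instr (S.interface n) (k + m + s))) (σ : CCAState (S.ctLen n)) (ψ : QState k)
    (v : Bits m) (i : Fin k) :
    S.play n r output (.measure (simEmb k m s i) :: code) σ (simState s ψ v) =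
      ∑ c : Bool, S.play n r output code σ (simState s (projectQubit i c ψ) v) :=
  Game.run_simState_measure _ _ _ _ _ _ _ _

theorem SymScheme.play_measureQuery {a b : ℕ} (r : Bits n × Bool)
    (output : Fin 1 ↪ Fin (k + m + s)) (code : List (Instr (S.interface n) (k + m + s)))
    (σ : CCAState (S.ctLen n)) (ψ : QState k) (v : Bits m) (e : Fin a ⊕ Fin b ↪ Fin k) :
    S.play n r output (measureQuery (S.interface n) m s e ++ code) σ (simState s ψ v) =
      ∑ q : Bits a, S.play n r output code σ (simState s (projectQuery q e ψ) v) :=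
  Game.run_simState_measureQuery _ _ _ _ _ _ _ _

open Classical in
theorem SymScheme.play_simState_nil (r : Bits n × Bool) (output : Fin 1 ↪ Fin k)
    (σ : CCAState (S.ctLen n)) (ψ : QState k) (v : Bits m) :
    S.play n r (output.trans (simEmb k m s)) [] σ (simState s ψ v) =
      ∑ x : Bits k, if σ.legal ∧ x (output 0) = r.2 then ‖ψ x‖ ^ 2 else 0 :=
  (Game.run_simState_nil _ _ _ _ _ _).trans (Finset.sum_congr rfl fun x _ => by congr)

theorem applyResponse_castAdd {a b p : ℕ} (u : Bits b) (e : Fin a ⊕ Fin b ↪ Fin k) (ψ : QState k)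
    (v : Bits p) : applyResponse u (e.trans (Fin.castAddEmb p)) (extend ψ v) =
      extend (applyResponse u e ψ) v :=
  applyOracle_extend (F := fun _ : Bits a => u) (F' := fun _ : Bits a => u)
    (e := e.trans (Fin.castAddEmb p)) (e' := e) (fun _ => rfl) (fun _ _ => rfl) ψ

/-- The query and answer wires of the data. -/
def answerEmb (k s c a : ℕ) : Fin c ⊕ Fin a ↪ Fin (k + (c + c + a) + s) :=
  (registers (fun i => Fin.natAdd k (queryWire a i)) (fun j => Fin.natAdd k (answerWire c j))
    ((Fin.natAdd_injective _ k).comp queryWire_injective)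
    ((Fin.natAdd_injective _ k).comp answerWire_injective)
    fun i j h => queryWire_ne_answerWire i j (Fin.natAdd_injective _ k h)).trans (Fin.castAddEmb s)

/-- A decryption query on classical data. -/
theorem SymScheme.play_answerEmb (r : Bits n × Bool)
    (output : Fin 1 ↪ Fin (k + (S.ctLen n + S.ctLen n + (S.msgLen n + 1)) + s))
    (code : List (Instr (S.interface n) (k + (S.ctLen n + S.ctLen n + (S.msgLen n + 1)) + s)))
    (σ : CCAState (S.ctLen n)) (ψ : QState k) (x q : Bits (S.ctLen n)) (z : Bits (S.msgLen n + 1)) :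
    S.play n r output
        (S.decInstr n (answerEmb k s (S.ctLen n) (S.msgLen n + 1)) :: code) σ
        (simState s ψ (simData x q z)) =
      S.play n r output code ⟨σ.challenge, σ.legal ∧ σ.challenge ≠ some q⟩
        (simState s ψ (xorAt (answerWire _) (encodeOption (S.dec n r.1 q)) (simData x q z))) := by
  have hproj : ∀ q' : Bits (S.ctLen n),
      projectQuery q' (answerEmb k s (S.ctLen n) (S.msgLen n + 1)) (simState s ψ (simData x q z)) =
        if q = q' then simState s ψ (simData x q z) else 0 := by
    intro q'
    refine (projectWires_extend (fun i => Fin.natAdd k (queryWire (S.msgLen n + 1) i)) q' _ _).trans ?_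
    have h := projectWires_extend_right (queryWire (S.msgLen n + 1)) q' ψ (simData x q z)
    simp only [simData_queryWire] at h
    rw [h, simState]
    split_ifs
    · rfl
    · exact extend_zero _
  rw [SymScheme.play_dec, Finset.sum_eq_single q]
  · rw [hproj, if_pos rfl]
    refine congrArg _ ?_
    refine (applyResponse_castAdd _ _ _ _).trans (congrArg (extend · _) ?_)
    exact applyResponse_extend_right (fun _ => rfl) ψ
  · intro q' _ hq'
    rw [hproj, if_neg hq'.symm]
    exact SymScheme.play_zero _ _ _ _
  · simp

/-- Gates that compute the query wires of the data from a measured query and the challenge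
ciphertext. -/
theorem exists_query_gates {a c A B : ℕ} {φ : Bits (c + A) → Bits c} (h : HasCircuit s φ)
    (e : Fin A ⊕ Fin B ↪ Fin k) :
    ∃ gs : List (Gate (k + (c + c + a) + s)), gs.length ≤ 100 * s + c ∧
      ∀ (p : Bits A) (ψ : QState k) (x q : Bits c) (z : Bits a),
        applyGates gs (simState s (projectQuery p e ψ) (simData x q z)) =
          simState s (projectQuery p e ψ)
            (xorAt (queryWire a) (φ (Fin.append x p)) (simData x q z)) := by
  let f : Fin (c + A) → Fin (k + (c + c + a)) :=
    Fin.append (fun i => Fin.natAdd k (chalWire a i)) fun j => Fin.castAdd _ (e (Sum.inl j))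
  have hne : ∀ (i : Fin (c + c + a)) (j : Fin k), Fin.natAdd k i ≠ Fin.castAdd (c + c + a) j := by
    intro i j h
    have := congrArg Fin.val h
    simp at this
    omega
  have hf : Function.Injective f := Fin.append_injective_iff.2
    ⟨(Fin.natAdd_injective _ k).comp chalWire_injective, fun i j hij =>
      Sum.inl_injective (e.injective (Fin.castAdd_injective _ _ hij)), fun i j => hne _ _⟩
  have hfg : ∀ i j, f i ≠ Fin.natAdd k (queryWire a j) := by
    intro i j
    refine Fin.addCases (fun i => ?_) (fun i => ?_) i
    · simp only [f, Fin.append_left]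
      exact fun h => chalWire_ne_queryWire i j (Fin.natAdd_injective _ k h)
    · simp only [f, Fin.append_right]
      exact (hne _ _).symm
  obtain ⟨gs, hgs, H⟩ := exists_gates_extend h (registers f (fun j => Fin.natAdd k (queryWire a j)) hf
    ((Fin.natAdd_injective _ k).comp queryWire_injective) hfg)
  refine ⟨gs, hgs, fun p ψ x q z => ?_⟩
  rw [simState, H, simState]
  refine congrArg (extend · _) (applyOracle_extend_right (fun _ => rfl) fun w hw1 hw2 => congrArg φ ?_)
  have hp : queryBits e (leftBits w) = p := by
    by_contra hp
    exact hw1 (if_neg hp)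
  funext i
  refine Fin.addCases (fun i => ?_) (fun i => ?_) i
  · have h1 := congrFun hw2 (chalWire a i)
    rw [simData_chalWire] at h1
    rw [Fin.append_left, ← h1]
    simp [queryBits, registers, f, rightBits]
  · rw [Fin.append_right, ← hp]
    simp [queryBits, registers, f, leftBits]

/-- The message register of the adversary and the challenge ciphertext of the data. -/
def challengeEmb {a b c A : ℕ} (s : ℕ) (e : Fin A ⊕ Fin b ↪ Fin k) :
    Fin A ⊕ Fin c ↪ Fin (k + (c + c + a) + s) :=
  (registers (fun i => Fin.castAdd (c + c + a) (e (Sum.inl i)))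
    (fun j => Fin.natAdd k (chalWire a j))
    (fun _ _ hij => Sum.inl_injective (e.injective (Fin.castAdd_injective _ _ hij)))
    ((Fin.natAdd_injective _ k).comp chalWire_injective) fun i j h => by
      have := congrArg Fin.val h
      simp at this
      omega).trans (Fin.castAddEmb s)

/-- A challenge whose answer goes to the data. -/
theorem SymScheme.play_challengeEmb {b : ℕ} (r : Bits n × Bool)
    (output : Fin 1 ↪ Fin (k + (S.ctLen n + S.ctLen n + (S.msgLen n + 1)) + s))
    (e : Fin (S.msgLen n + S.msgLen n) ⊕ Fin b ↪ Fin k)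
    (code : List (Instr (S.interface n) (k + (S.ctLen n + S.ctLen n + (S.msgLen n + 1)) + s)))
    (σ : CCAState (S.ctLen n)) (ψ : QState k) (q : Bits (S.ctLen n)) (z : Bits (S.msgLen n + 1)) :
    S.play n r output (S.chalInstr n (challengeEmb s e) :: code) σ
        (simState s ψ (simData (fun _ => false) q z)) =
      ∑ m : Bits (S.msgLen n + S.msgLen n), uniformAvg fun w : Bits (S.encCoins n) =>
        S.play n r output code
          ⟨some (S.enc n r.1 (if r.2 then rightBits m else leftBits m) w), σ.legal ∧
            σ.challenge = none ∧ S.msgSize n (leftBits m) = S.msgSize n (rightBits m)⟩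
          (simState s (projectQuery m e ψ)
            (simData (S.enc n r.1 (if r.2 then rightBits m else leftBits m) w) q z)) := by
  rw [SymScheme.play_challenge]
  refine Finset.sum_congr rfl fun m _ => congrArg _ (funext fun w => congrArg _ ?_)
  have hproj : projectQuery m (challengeEmb (c := S.ctLen n) (a := S.msgLen n + 1) s e)
      (simState s ψ (simData (fun _ => false) q z)) =
      simState s (projectQuery m e ψ) (simData (fun _ => false) q z) :=
    (projectWires_extend _ m _ _).trans (congrArg (extend · _)
      (projectWires_extend (fun i => e (Sum.inl i)) m _ _))
  rw [hproj]
  refine (applyResponse_castAdd _ _ _ _).trans (congrArg (extend · _) ?_)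
  refine (applyResponse_extend_right (ρ := chalWire _) (fun _ => rfl) _).trans ?_
  rw [xorAt_chalWire]

/-- The chosen ciphertext game in which the key `key`, unrelated to `H`, is used for the challenge and
for all decryption queries with first part `y`. -/
def replacedGame (T : TrapdoorFunction) (S : SymScheme) (n : ℕ) (pk : Bits (T.pkLen n))
    (y : Bits (T.rangeLen n)) (key : Bits n) (b : Bool) :
    HashedGame (T.domLen n) (T.rangeLen n) n (T.rangeLen n + S.ctLen n) (S.msgLen n)
      (S.encCoins n) 1 where
  size := S.msgSize n
  p := T.f n pk
  z := leftBits
  y := y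
  dec := fun c κ => encodeOption (S.dec n (if leftBits c = y then key else κ) (rightBits c))
  chal := fun w m _ => Fin.append y (S.enc n key (if b then rightBits m else leftBits m) w)
  space := {c | leftBits c ∈ Set.range (T.f n pk)}
  win := fun z => z 0 = b

variable {T : TrapdoorFunction} {P : ℕ}

/-- Decryption queries are answered with the help of the decryption oracle of the symmetric game. A
query with first part other than `y` leads to a dummy query there, which must be legal: it is the
complement of the challenge ciphertext. -/
theorem exists_dec_code (hP : CostBound T S n P) {h : Bits (T.rangeLen n) → Bits n}
    (hh : HasCircuit P h) (y : Bits (T.rangeLen n)) (hs : 30 * P + 10 ≤ s)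
    (e : Fin (T.rangeLen n + S.ctLen n) ⊕ Fin (S.msgLen n + 1) ↪ Fin k) :
    ∃ block : List (Instr (S.interface n)
        (k + (S.ctLen n + S.ctLen n + (S.msgLen n + 1)) + s)),
      block.length ≤ 300 * s + 4 * P + 3 ∧
      ∀ (r : Bits n × Bool)
        (output : Fin 1 ↪ Fin (k + (S.ctLen n + S.ctLen n + (S.msgLen n + 1)) + s))
        (code : List (Instr (S.interface n)
          (k + (S.ctLen n + S.ctLen n + (S.msgLen n + 1)) + s)))
        (σ : CCAState (S.ctLen n)) (x : Bits (S.ctLen n)) (ψ : QState k),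
        ∃ σ' : Bits (T.rangeLen n + S.ctLen n) → CCAState (S.ctLen n),
          (S.play n r output (block ++ code) σ
              (simState s ψ (simData x (fun _ => false) fun _ => false)) =
            ∑ q, S.play n r output code (σ' q)
              (simState s (applyResponse (encodeOption
                (S.dec n (if leftBits q = y then r.1 else h (leftBits q)) (rightBits q))) e
                  (projectQuery q e ψ)) (simData x (fun _ => false) fun _ => false))) ∧
          ∀ q, (σ' q).challenge = σ.challenge ∧ (σ.legal → (∀ c, σ.challenge = some c →
            c = x ∧ (leftBits q = y → rightBits q ≠ x)) → (σ' q).legal) := by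
  have hlen := hP.length
  by_cases hct : S.ctLen n = 0
  · -- there is only one ciphertext, which all keys decrypt to the same message
    have hsub : ∀ c c' : Bits (S.ctLen n), c = c' := fun c c' =>
      funext fun i => absurd i.2 (by omega)
    have hdec : ∀ κ κ' (c : Bits (S.ctLen n)), S.dec n κ c = S.dec n κ' c := by
      have h1 : ∀ κ (c : Bits (S.ctLen n)), S.dec n κ c = some fun _ => false := fun κ c =>
        (congrArg _ (hsub c (S.enc n κ (fun _ => false) fun _ => false))).trans (S.dec_enc _ _ _ _)
      exact fun κ κ' c => (h1 κ c).trans (h1 κ' c).symm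
    have hD : HasCircuit s fun z : Bits (S.ctLen n + S.ctLen n + (S.msgLen n + 1) +
        (T.rangeLen n + S.ctLen n)) =>
        encodeOption (S.dec n (h (leftBits (rightBits z))) (rightBits (rightBits z))) := by
      have hz := comp_inputs (S.ctLen n + S.ctLen n + (S.msgLen n + 1) + (T.rangeLen n + S.ctLen n))
      have hV := false_mem_inputs (S.ctLen n + S.ctLen n + (S.msgLen n + 1) +
        (T.rangeLen n + S.ctLen n))
      refine (Comp.hasCircuit (Comp.circuit₂ (φ := fun κ c => encodeOption (S.dec n κ c)) hP.dec hV
        (hz.right.left.circuit hh hV) hz.right.right)).mono ?_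
      omega
    obtain ⟨gs, hgs, hg⟩ := exists_simState_gates hD e
    refine ⟨measureQuery _ _ s e ++ gs.map .gate, ?_, fun r output code σ x ψ => ⟨fun _ => σ, ?_,
      fun q => ⟨rfl, fun h _ => h⟩⟩⟩
    · rw [List.length_append, List.length_map, measureQuery, List.length_ofFn]
      omega
    · rw [List.append_assoc, SymScheme.play_measureQuery]
      refine Finset.sum_congr rfl fun q _ => ?_
      rw [SymScheme.play_gates, hg, applyOracle_projectQuery]
      simp only [rightBits_append]
      rw [hdec (if leftBits q = y then r.1 else h (leftBits q)) (h (leftBits q))]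
  · let φ₁ : Bits (S.ctLen n + (T.rangeLen n + S.ctLen n)) → Bits (S.ctLen n) := fun z =>
      if decide (leftBits (rightBits z) = y) then rightBits (rightBits z)
      else fun j => !(leftBits z j)
    let φ₂ : Bits (S.ctLen n + S.ctLen n + (S.msgLen n + 1) + (T.rangeLen n + S.ctLen n)) →
        Bits (S.msgLen n + 1) := fun z =>
      if decide (leftBits (rightBits z) = y) then rightBits (leftBits z)
      else encodeOption (S.dec n (h (leftBits (rightBits z))) (rightBits (rightBits z)))
    have h1 : HasCircuit s φ₁ := by
      have hz := comp_inputs (S.ctLen n + (T.rangeLen n + S.ctLen n))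
      have hV := false_mem_inputs (S.ctLen n + (T.rangeLen n + S.ctLen n))
      refine (Comp.hasCircuit (Comp.coords_ite (hz.right.left.eq_const hV y) hz.right.right
        hz.left.coords_not)).mono ?_
      omega
    have h2 : HasCircuit s φ₂ := by
      have hz := comp_inputs (S.ctLen n + S.ctLen n + (S.msgLen n + 1) + (T.rangeLen n + S.ctLen n))
      have hV := false_mem_inputs (S.ctLen n + S.ctLen n + (S.msgLen n + 1) +
        (T.rangeLen n + S.ctLen n))
      refine (Comp.hasCircuit (Comp.coords_ite (hz.right.left.eq_const hV y) hz.left.right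
        (Comp.circuit₂ (φ := fun κ c => encodeOption (S.dec n κ c)) hP.dec hV
          (hz.right.left.circuit hh hV) hz.right.right))).mono ?_
      omega
    obtain ⟨g₁, hlen₁, hg₁⟩ := exists_query_gates (a := S.msgLen n + 1) h1 e
    obtain ⟨g₂, hlen₂, hg₂⟩ := exists_simState_gates h2 e
    let ask : Instr (S.interface n) (k + (S.ctLen n + S.ctLen n + (S.msgLen n + 1)) + s) :=
      S.decInstr n (answerEmb k s (S.ctLen n) (S.msgLen n + 1))
    -- the second half of the block clears the query and the answer
    refine ⟨measureQuery _ _ s e ++ (g₁.map .gate ++ (ask :: (g₂.map .gate ++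
      (ask :: g₁.map .gate)))), ?_, fun r output code σ x ψ => ?_⟩
    · simp only [List.length_append, List.length_map, measureQuery, List.length_ofFn,
        List.length_cons]
      omega
    let q' : Bits (T.rangeLen n + S.ctLen n) → Bits (S.ctLen n) := fun q => φ₁ (Fin.append x q)
    refine ⟨fun q => ⟨σ.challenge, (σ.legal ∧ σ.challenge ≠ some (q' q)) ∧
      σ.challenge ≠ some (q' q)⟩, ?_, fun q => ⟨rfl, fun hl hc => ?_⟩⟩
    · simp only [List.append_assoc, List.cons_append]
      rw [SymScheme.play_measureQuery]
      refine Finset.sum_congr rfl fun q _ => ?_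
      have hresp : φ₂ (Fin.append (simData x (q' q) (encodeOption (S.dec n r.1 (q' q)))) q) =
          encodeOption (S.dec n (if leftBits q = y then r.1 else h (leftBits q))
            (rightBits q)) := by
        simp only [φ₂, leftBits_append, rightBits_append, decide_eq_true_eq]
        have h3 : rightBits (simData x (q' q) (encodeOption (S.dec n r.1 (q' q)))) =
            encodeOption (S.dec n r.1 (q' q)) := rightBits_append _ _
        rw [h3]
        split_ifs with hy
        · have h4 : q' q = rightBits q := by
            simp only [q', φ₁, rightBits_append, hy, decide_true, if_true]
          rw [h4]
        · rfl
      have hproj : ∀ u, applyResponse u e (projectQuery q e ψ) =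
          projectQuery q e (applyResponse u e (projectQuery q e ψ)) := by
        intro u
        funext w
        by_cases hw : queryBits e w = q <;>
          simp [applyResponse, projectQuery, queryBits_xorResponse, hw]
      have hq' : φ₁ (Fin.append x q) = q' q := rfl
      rw [SymScheme.play_gates, hg₁, xorAt_queryWire, hq']
      rw [SymScheme.play_answerEmb, xorAt_answerWire, SymScheme.play_gates, hg₂, applyOracle_projectQuery]
      simp only [hresp]
      rw [SymScheme.play_answerEmb, SymScheme.play_gates, ← xorAt_answerWire, xorAt_self, hproj, hg₁, ← xorAt_queryWire, xorAt_self]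
    · have h5 : σ.challenge ≠ some (q' q) := by
        intro h6
        obtain ⟨h7, h8⟩ := hc _ h6
        by_cases hy : leftBits q = y
        · refine h8 hy ?_
          rw [← h7]
          simp only [q', φ₁, rightBits_append, hy, decide_true, if_true]
        · have h9 : q' q = fun j => !(x j) := by
            simp only [q', φ₁, rightBits_append, leftBits_append, hy, decide_false,
              Bool.false_eq_true, if_false]
          have h10 := congrFun (h9.symm.trans h7) ⟨0, Nat.pos_of_ne_zero hct⟩
          simp at h10
      exact ⟨⟨hl, h5⟩, h5⟩

/-- The states of the two challengers correspond to each other, as long as the asymmetric run is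
legal; `x` is the content of the challenge wires. -/
def Corresponds (y : Bits (T.rangeLen n)) (τ : CCAState (T.rangeLen n + S.ctLen n))
    (σ : CCAState (S.ctLen n)) (x : Bits (S.ctLen n)) : Prop :=
  τ.legal → σ.legal ∧ (τ.challenge = none → σ.challenge = none ∧ x = fun _ => false) ∧
    ∀ c, τ.challenge = some c → σ.challenge = some x ∧ c = Fin.append y x

/-- The steps of an adversary in the game with replaced key are simulated in the symmetric game. The
challenge ciphertext stays on the wires of the data and is compared with decryption queries there. -/
theorem exists_sym_simulation (hP : CostBound T S n P) {h : Bits (T.rangeLen n) → Bits n}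
    (hh : HasCircuit P h) (pk : Bits (T.pkLen n)) (y : Bits (T.rangeLen n)) (hs : 30 * P + 10 ≤ s)
    (output : Fin 1 ↪ Fin k)
    (code : List (Step (T.domLen n) n (T.rangeLen n + S.ctLen n) (S.msgLen n) k)) :
    ∃ code' : List (Instr (S.interface n)
        (k + (S.ctLen n + S.ctLen n + (S.msgLen n + 1)) + s)),
      code'.length ≤ (300 * s + 4 * P + 3) * code.length ∧
      ∀ (r : Bits n × Bool) (τ : CCAState (T.rangeLen n + S.ctLen n)) (σ : CCAState (S.ctLen n))
        (x : Bits (S.ctLen n)) (ψ : QState k), Corresponds y τ σ x →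
        ((replacedGame T S n pk y r.1 r.2).fix h).run output code τ ψ ≤
          S.play n r (output.trans (simEmb k _ s)) code' σ
            (simState s ψ (simData x (fun _ => false) fun _ => false)) := by
  have hlen := hP.length
  induction code with
  | nil =>
    refine ⟨[], by simp, fun r τ σ x ψ hc => ?_⟩
    rw [FixedGame.run_nil, SymScheme.play_simState_nil]
    refine Finset.sum_le_sum fun w _ => ?_
    by_cases hw : τ.legal ∧
        ((replacedGame T S n pk y r.1 r.2).fix h).win fun j => w (output j)
    · rw [if_pos hw, if_pos ⟨(hc hw.1).1, hw.2⟩]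
    · rw [if_neg hw]
      split_ifs <;> positivity
  | cons c code ih =>
    obtain ⟨code', hlen', H⟩ := ih
    cases c with
    | gate g =>
      refine ⟨.gate ((g.lift _).lift s) :: code', ?_, fun r τ σ x ψ hc => ?_⟩
      · rw [List.length_cons, List.length_cons, Nat.mul_succ]; omega
      · rw [FixedGame.run, SymScheme.play_simState_gate]
        exact H r τ σ x _ hc
    | measure i =>
      refine ⟨.measure (simEmb k _ s i) :: code', ?_, fun r τ σ x ψ hc => ?_⟩
      · rw [List.length_cons, List.length_cons, Nat.mul_succ]; omega
      · rw [FixedGame.run, SymScheme.play_simState_measure]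
        exact Finset.sum_le_sum fun v _ => H r τ σ x _ hc
    | oracle e =>
      have hO : HasCircuit s fun z : Bits (S.ctLen n + S.ctLen n + (S.msgLen n + 1) + T.domLen n) =>
          h (T.f n pk (rightBits z)) := by
        have hz := comp_inputs (S.ctLen n + S.ctLen n + (S.msgLen n + 1) + T.domLen n)
        have hV := false_mem_inputs (S.ctLen n + S.ctLen n + (S.msgLen n + 1) + T.domLen n)
        refine (Comp.hasCircuit ((Comp.circuit₂ (φ := T.f n) hP.f hV (comp_coords_const hV pk)
          hz.right).circuit hh hV)).mono ?_
        omega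
      obtain ⟨gs, hgs, hg⟩ := exists_simState_gates hO e
      refine ⟨gs.map .gate ++ code', ?_, fun r τ σ x ψ hc => ?_⟩
      · rw [List.length_append, List.length_map, List.length_cons, Nat.mul_succ]; omega
      · rw [FixedGame.run, SymScheme.play_gates, hg]
        simp only [rightBits_append]
        exact H r τ σ x _ hc
    | dec e =>
      obtain ⟨block, hblock, hb⟩ := exists_dec_code hP hh y hs e
      refine ⟨block ++ code', ?_, fun r τ σ x ψ hc => ?_⟩
      · rw [List.length_append, List.length_cons, Nat.mul_succ]; omega
      · by_cases hτ : τ.legal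
        swap
        · rw [FixedGame.run_illegal _ _ _ hτ]
          exact SymScheme.play_nonneg _ _ _ _ _
        obtain ⟨σ', h1, h2⟩ := hb r (output.trans (simEmb k _ s)) code' σ x ψ
        rw [FixedGame.run, h1]
        refine Finset.sum_le_sum fun q _ => H r _ _ x _ ?_
        obtain ⟨h3, h4⟩ := h2 q
        rintro ⟨-, h5, -⟩
        obtain ⟨h6, h7, h8⟩ := hc hτ
        refine ⟨h4 h6 fun c hσ => ?_, by rw [h3]; exact h7, by rw [h3]; exact h8⟩
        cases hτc : τ.challenge with
        | none => rw [(h7 hτc).1] at hσ; cases hσ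
        | some c' =>
          obtain ⟨h9, h10⟩ := h8 c' hτc
          rw [h9] at hσ
          refine ⟨(Option.some.inj hσ).symm, fun hy hx => h5 ?_⟩
          rw [hτc, h10, ← hy, ← hx]
          refine congrArg some (funext fun i => ?_)
          refine Fin.addCases (fun i => ?_) (fun i => ?_) i <;> simp [leftBits, rightBits]
    | challenge e =>
      have hC : HasCircuit s fun z : Bits (S.ctLen n + S.ctLen n + (S.msgLen n + 1) +
          (S.msgLen n + S.msgLen n)) =>
          (Fin.append y (leftBits (leftBits (leftBits z))) : Bits (T.rangeLen n + S.ctLen n)) := by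
        have hz := comp_inputs (S.ctLen n + S.ctLen n + (S.msgLen n + 1) +
          (S.msgLen n + S.msgLen n))
        have hV := false_mem_inputs (S.ctLen n + S.ctLen n + (S.msgLen n + 1) +
          (S.msgLen n + S.msgLen n))
        refine (Comp.hasCircuit ((comp_coords_const hV y).append hz.left.left.left)).mono ?_
        omega
      obtain ⟨gs, hgs, hg⟩ := exists_simState_gates hC e
      refine ⟨S.chalInstr n (challengeEmb s e) :: (gs.map .gate ++ code'), ?_,
        fun r τ σ x ψ hc => ?_⟩
      · rw [List.length_cons, List.length_append, List.length_map, List.length_cons, Nat.mul_succ]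
        omega
      · by_cases hτ : τ.legal
        swap
        · rw [FixedGame.run_illegal _ _ _ hτ]
          exact SymScheme.play_nonneg _ _ _ _ _
        rw [FixedGame.run]
        cases hτc : τ.challenge with
        | some c' =>
          refine le_of_eq_of_le (Finset.sum_eq_zero fun m _ => ?_) (SymScheme.play_nonneg _ _ _ _ _)
          refine (congrArg uniformAvg (funext fun w => ?_)).trans (uniformAvg_const 0)
          refine FixedGame.run_illegal _ _ _ ?_
          rintro ⟨-, h1, -⟩
          rw [hτc] at h1
          cases h1
        | none =>
          obtain ⟨h6, h7, h8⟩ := hc hτ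
          obtain ⟨h9, rfl⟩ := h7 hτc
          rw [SymScheme.play_challengeEmb]
          refine Finset.sum_le_sum fun m _ => uniformAvg_mono fun w => ?_
          rw [SymScheme.play_gates, hg, applyOracle_projectQuery]
          have h10 : ∀ c : Bits (S.ctLen n), (Fin.append y (leftBits (leftBits (leftBits (Fin.append
              (simData c (fun _ => false) fun _ : Fin (S.msgLen n + 1) => false) m)))) :
              Bits (T.rangeLen n + S.ctLen n)) = Fin.append y c := by
            intro c
            rw [leftBits_append, simData, leftBits_append, leftBits_append]
          rw [h10]
          refine H r _ _ _ _ ?_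
          rintro ⟨-, -, h11⟩
          refine ⟨⟨h6, h9, h11⟩, fun h12 => (by cases h12), fun c h12 => ⟨rfl, ?_⟩⟩
          exact (Option.some.inj h12).symm

theorem append_false (a b : ℕ) : (Fin.append (fun _ : Fin a => false) fun _ : Fin b => false) =
    fun _ => false := by
  funext w
  refine Fin.addCases (fun w => ?_) (fun w => ?_) w
  · rw [Fin.append_left]
  · rw [Fin.append_right]

/-- After the replacement of the key, an adversary against the hybrid scheme breaks the symmetric
scheme. -/
theorem exists_symAdversary (hP : CostBound T S n P) {h : Bits (T.rangeLen n) → Bits n}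
    (hh : HasCircuit P h) (pk : Bits (T.pkLen n)) (y : Bits (T.rangeLen n))
    (input : Fin (T.pkLen n) ↪ Fin k) (output : Fin 1 ↪ Fin k)
    (code : List (Step (T.domLen n) n (T.rangeLen n + S.ctLen n) (S.msgLen n) k))
    (hk : k + code.length ≤ P) :
    ∃ B : Adversary (S.interface n) 0 1, B.qubits + B.code.length ≤ 20000 * (P + 1) ^ 2 ∧
      (uniformAvg fun r : Bits n × Bool => ((replacedGame T S n pk y r.1 r.2).fix h).run output code
        ⟨none, True⟩ (startState input pk)) ≤ (S.ccaGame n).winProb B := by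
  have hlen := hP.length
  set s := 30 * P + 10 with hs
  obtain ⟨code', hcode', H⟩ := exists_sym_simulation hP hh pk y hs.ge output code
  have hI : HasCircuit s fun _ : Bits (S.ctLen n + S.ctLen n + (S.msgLen n + 1) + 0) => pk := by
    refine (Comp.hasCircuit (comp_coords_const (false_mem_inputs _) pk)).mono ?_
    omega
  obtain ⟨gs, hgs, hg⟩ := exists_simState_gates hI
    ((Equiv.emptySum (Fin 0) (Fin (T.pkLen n))).toEmbedding.trans input)
  refine ⟨⟨k + (S.ctLen n + S.ctLen n + (S.msgLen n + 1)) + s, Function.Embedding.ofIsEmpty,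
    output.trans (simEmb k _ s), gs.map .gate ++ code'⟩, ?_, uniformAvg_mono fun r => ?_⟩
  · simp only [List.length_append, List.length_map]
    have h1 : code'.length ≤ (9004 * P + 3003) * P := hcode'.trans
      (Nat.mul_le_mul (by omega) (by omega))
    nlinarith
  · have hstart : startState Function.Embedding.ofIsEmpty ((S.ccaGame n).input r) =
        simState s (basisState fun _ : Fin k => false)
          (simData (fun _ : Fin (S.ctLen n) => false) (fun _ => false)
            fun _ : Fin (S.msgLen n + 1) => false) := by
      rw [simState, extend_basisState, extend_basisState]
      funext x
      refine if_congr (Eq.congr_right (funext fun w => ?_)) rfl rfl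
      have h1 : decide (∃ j : Fin 0, (Function.Embedding.ofIsEmpty : Fin 0 ↪ Fin _) j = w ∧
          (S.ccaGame n).input r j = true) = false := decide_eq_false fun ⟨j, _⟩ => j.elim0
      rw [h1]
      simp only [simData, append_false]
    refine (H r _ ⟨none, True⟩ (fun _ => false) _ ?_).trans (le_of_eq ?_)
    · exact fun _ => ⟨trivial, fun _ => ⟨rfl, rfl⟩, fun c hc => by cases hc⟩
    · refine Eq.trans ?_ (SymScheme.play_gates r _ code' _ _ gs).symm
      refine congrArg (S.play n r _ code' _) ?_
      refine Eq.trans ?_ (congrArg (applyGates gs) hstart).symm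
      rw [hg, ← applyResponse_basisState]
      rfl

end SymReduction

/-! ### Game hopping -/

section Averages

variable {α β γ : Type} [Fintype α] [Fintype β] [Fintype γ]

/-- The restriction of a random function along an injection is a random function. -/
theorem uniformAvg_comp_injective [DecidableEq α] [DecidableEq β] [Nonempty γ] {p : α → β} (hp : Function.Injective p)
    (g : (α → γ) → ℝ) :
    uniformAvg (fun H : β → γ => g fun x => H (p x)) = uniformAvg g := by
  classical
  let e := Equiv.piEquivPiSubtypeProd (· ∈ Set.range p) fun _ : β => γ
  let e' := (Equiv.ofInjective p hp).arrowCongr (Equiv.refl γ)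
  rw [← uniformAvg_equiv e.symm, uniformAvg_prod]
  have h : ∀ u v, (fun x => e.symm (u, v) (p x)) = e'.symm u := by
    intro u v
    funext x
    simp [e, e', Equiv.piEquivPiSubtypeProd, Equiv.arrowCongr, Equiv.ofInjective_apply]
  simp only [h, uniformAvg_const]
  exact uniformAvg_equiv e'.symm g

/-- Resampling one value of a random function. -/
theorem uniformAvg_update [DecidableEq β] [Nonempty γ] (y : β) (g : (β → γ) → ℝ) :
    uniformAvg (fun H : β → γ => uniformAvg fun κ : γ => g (Function.update H y κ)) =
      uniformAvg g := by
  let e : (β → γ) × γ ≃ (β → γ) × γ :=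
    { toFun := fun z => (Function.update z.1 y z.2, z.1 y)
      invFun := fun z => (Function.update z.1 y z.2, z.1 y)
      left_inv := fun z => by simp
      right_inv := fun z => by simp }
  have h := uniformAvg_equiv e fun z => g z.1
  rw [uniformAvg_prod, uniformAvg_prod] at h
  simp only [uniformAvg_const] at h
  exact h

/-- A random string of `a + b` bits consists of two random strings. -/
theorem uniformAvg_append {a b : ℕ} (g : Bits (a + b) → ℝ) :
    uniformAvg g = uniformAvg fun u : Bits a => uniformAvg fun v : Bits b => g (Fin.append u v) := by
  let e : Bits a × Bits b ≃ Bits (a + b) :=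
    { toFun := fun z => Fin.append z.1 z.2
      invFun := fun x => (leftBits x, rightBits x)
      left_inv := fun z => by simp [leftBits_append, rightBits_append]
      right_inv := fun x => by
        funext i
        refine Fin.addCases (fun j => ?_) (fun j => ?_) i <;> simp [leftBits, rightBits] }
  rw [← uniformAvg_equiv e g, uniformAvg_prod]
  rfl

theorem uniformAvg_rearrange {δ ε : Type} [Fintype δ] [Fintype ε] (g : α → β → γ → δ → ε → ℝ) :
    (uniformAvg fun a => uniformAvg fun b => uniformAvg fun c => uniformAvg fun d =>
      uniformAvg fun e => g a b c d e) =
    uniformAvg fun z : β × δ × ε => uniformAvg fun x : α × γ => g x.1 z.1 x.2 z.2.1 z.2.2 := by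
  rw [uniformAvg_comm, uniformAvg_prod]
  refine congrArg _ (funext fun b => ?_)
  refine Eq.trans ?_ ((uniformAvg_prod fun x : α × γ => uniformAvg fun z : δ × ε =>
    g x.1 b x.2 z.1 z.2).symm.trans (uniformAvg_comm _))
  exact congrArg uniformAvg (funext fun a => congrArg uniformAvg (funext fun c =>
    (uniformAvg_prod fun z : δ × ε => g a b c z.1 z.2).symm))

end Averages

section Hops

variable {T : TrapdoorFunction} {S : SymScheme} {n k P : ℕ}

theorem TrapdoorFunction.f_injective (T : TrapdoorFunction) (n : ℕ) (w : Bits (T.keyCoins n)) :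
    Function.Injective (T.f n (T.keyGen n w).1) := fun x x' h => by
  have h' := T.inv_f n w x
  rw [h, T.inv_f] at h'
  exact h'.symm

/-- The chosen ciphertext game against the hybrid scheme, with the random oracle written as
`H ∘ f pk`. -/
theorem run_fixedCCA_hybrid (w : Bits (T.keyCoins n)) (b : Bool) (r : Bits (T.domLen n))
    (H : Bits (T.rangeLen n) → Bits n) (output : Fin 1 ↪ Fin k)
    (code : List (Step (T.domLen n) n (T.rangeLen n + S.ctLen n) (S.msgLen n) k))
    (s : CCAState (T.rangeLen n + S.ctLen n)) (ψ : QState k) :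
    ((fixedCCA (hybrid T S) n (w, b, fun x => H (T.f n (T.keyGen n w).1 x))).withChal
        (N' := S.encCoins n) fun u => (fixedCCA (hybrid T S) n
          (w, b, fun x => H (T.f n (T.keyGen n w).1 x))).chal (Fin.append r u)).run output code s ψ =
      ((hybridGame T S n (T.keyGen n w).1 (T.f n (T.keyGen n w).1 r) b id fun z : Bits 1 =>
        z 0 = b).fix H).run output code s ψ := by
  have hdec : ∀ c ∈ {c : Bits (T.rangeLen n + S.ctLen n) |
      leftBits c ∈ Set.range (T.f n (T.keyGen n w).1)},
      encodeOption (S.dec n (H (T.f n (T.keyGen n w).1 (T.inv n (T.keyGen n w).2 (leftBits c))))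
        (rightBits c)) = encodeOption (S.dec n (H (leftBits c)) (rightBits c)) := by
    rintro c ⟨x, hx⟩
    rw [← hx, T.inv_f]
  refine (FixedGame.run_congr_dec (D := (fixedCCA (hybrid T S) n (w, b, fun x =>
    H (T.f n (T.keyGen n w).1 x))).withChal (N' := S.encCoins n) fun u => (fixedCCA (hybrid T S) n
      (w, b, fun x => H (T.f n (T.keyGen n w).1 x))).chal (Fin.append r u)) hdec code s ψ).trans ?_
  have h : ∀ (u : Bits (S.encCoins n)) (m : Bits (S.msgLen n + S.msgLen n)),
      (fixedCCA (hybrid T S) n (w, b, fun x => H (T.f n (T.keyGen n w).1 x))).chal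
        (Fin.append r u) m = ((hybridGame T S n (T.keyGen n w).1 (T.f n (T.keyGen n w).1 r) b id
          fun z : Bits 1 => z 0 = b).fix H).chal u m := by
    intro u m
    change Fin.append (T.f n (T.keyGen n w).1 (leftBits (Fin.append r u))) (S.enc n
      (H (T.f n (T.keyGen n w).1 (leftBits (Fin.append r u))))
        (if b then rightBits m else leftBits m) (rightBits (Fin.append r u))) = _
    rw [leftBits_append, rightBits_append]
    rfl
  have h' : (fun u : Bits (S.encCoins n) => (fixedCCA (hybrid T S) n
      (w, b, fun x => H (T.f n (T.keyGen n w).1 x))).chal (Fin.append r u)) =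
      ((hybridGame T S n (T.keyGen n w).1 (T.f n (T.keyGen n w).1 r) b id
        fun z : Bits 1 => z 0 = b).fix H).chal := funext fun u => funext fun m => h u m
  rw [h']
  rfl

/-- The winning probability in terms of the function `H` and the first component `r` of the coins of
the challenge. -/
theorem winProb_hybrid (A : Adversary ((hybrid T S).interface n) (T.pkLen n) 1) :
    ((hybrid T S).ccaGame n).winProb A = uniformAvg fun w : Bits (T.keyCoins n) =>
      uniformAvg fun b : Bool => uniformAvg fun r : Bits (T.domLen n) =>
        uniformAvg fun H : Bits (T.rangeLen n) → Bits n =>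
          ((hybridGame T S n (T.keyGen n w).1 (T.f n (T.keyGen n w).1 r) b id fun z : Bits 1 =>
            z 0 = b).fix H).run A.output (A.code.map Step.ofInstr) ⟨none, True⟩
              (startState A.input (T.keyGen n w).1) := by
  have h1 : ∀ (w : Bits (T.keyCoins n)) (b : Bool) (O : Bits (T.domLen n) → Bits n),
      ((hybrid T S).ccaGame n).run (w, b, O) A.output A.code ⟨none, True⟩
        (startState A.input (T.keyGen n w).1) = uniformAvg fun r : Bits (T.domLen n) =>
      ((fixedCCA (hybrid T S) n (w, b, O)).withChal (N' := S.encCoins n) fun u =>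
        (fixedCCA (hybrid T S) n (w, b, O)).chal (Fin.append r u)).run A.output
          (A.code.map Step.ofInstr) ⟨none, True⟩ (startState A.input (T.keyGen n w).1) := by
    intro w b O
    refine (ccaGame_run_eq _ _ _ _).trans (FixedGame.run_presample _ ?_ _ _ _ rfl)
    exact fun g => uniformAvg_append g
  refine (uniformAvg_prod (α := Bits (T.keyCoins n))
    (β := Bool × (Bits (T.domLen n) → Bits n)) _).trans (congrArg _ (funext fun w => ?_))
  refine (uniformAvg_prod (α := Bool)
    (β := Bits (T.domLen n) → Bits n) _).trans (congrArg _ (funext fun b => ?_))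
  refine (congrArg uniformAvg (funext fun O => h1 w b O)).trans ((uniformAvg_comm _).trans
    (congrArg _ (funext fun r => ?_)))
  refine (uniformAvg_comp_injective (TrapdoorFunction.f_injective T n w) _).symm.trans
    (congrArg _ (funext fun H => ?_))
  exact run_fixedCCA_hybrid w b r H A.output _ _ _

/-- After the replacement of the key, some choice of the key pair, the coins and the hash function is
at least as good as the average. -/
theorem exists_symAdversary_of_replaced (hP : CostBound T S n P) (input : Fin (T.pkLen n) ↪ Fin k)
    (output : Fin 1 ↪ Fin k)
    (code : List (Step (T.domLen n) n (T.rangeLen n + S.ctLen n) (S.msgLen n) k))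
    (hk : k + code.length ≤ P) (hh : hashSize (T.rangeLen n) n (2 * code.length) ≤ P) :
    ∃ B : Adversary (S.interface n) 0 1, B.qubits + B.code.length ≤ 20000 * (P + 1) ^ 2 ∧
      (uniformAvg fun w : Bits (T.keyCoins n) => uniformAvg fun b : Bool =>
        uniformAvg fun r : Bits (T.domLen n) => uniformAvg fun H : Bits (T.rangeLen n) → Bits n =>
          uniformAvg fun κ : Bits n =>
            ((replacedGame T S n (T.keyGen n w).1 (T.f n (T.keyGen n w).1 r) κ b).fix H).run output
              code ⟨none, True⟩ (startState input (T.keyGen n w).1)) ≤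
        (S.ccaGame n).winProb B := by
  obtain ⟨K, hK, hK', h, hind, hcirc⟩ :=
    exists_boundedIndependent (T.rangeLen n) n (2 * code.length)
  obtain ⟨w, hw⟩ := exists_uniformAvg_le fun w : Bits (T.keyCoins n) => uniformAvg fun b : Bool =>
    uniformAvg fun r : Bits (T.domLen n) => uniformAvg fun H : Bits (T.rangeLen n) → Bits n =>
      uniformAvg fun κ : Bits n =>
        ((replacedGame T S n (T.keyGen n w).1 (T.f n (T.keyGen n w).1 r) κ b).fix H).run output
          code ⟨none, True⟩ (startState input (T.keyGen n w).1)
  obtain ⟨r, hr⟩ := exists_uniformAvg_le fun r : Bits (T.domLen n) => uniformAvg fun b : Bool =>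
    uniformAvg fun H : Bits (T.rangeLen n) → Bits n => uniformAvg fun κ : Bits n =>
      ((replacedGame T S n (T.keyGen n w).1 (T.f n (T.keyGen n w).1 r) κ b).fix H).run output
        code ⟨none, True⟩ (startState input (T.keyGen n w).1)
  have h1 : (uniformAvg fun b : Bool => uniformAvg fun H : Bits (T.rangeLen n) → Bits n =>
      uniformAvg fun κ : Bits n =>
        ((replacedGame T S n (T.keyGen n w).1 (T.f n (T.keyGen n w).1 r) κ b).fix H).run output
          code ⟨none, True⟩ (startState input (T.keyGen n w).1)) =
      uniformAvg fun i : K => uniformAvg fun z : Bits n × Bool =>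
        ((replacedGame T S n (T.keyGen n w).1 (T.f n (T.keyGen n w).1 r) z.1 z.2).fix (h i)).run
          output code ⟨none, True⟩ (startState input (T.keyGen n w).1) := by
    rw [uniformAvg_comm (α := K), uniformAvg_prod, uniformAvg_comm (α := Bits n)]
    refine congrArg _ (funext fun b => ?_)
    rw [uniformAvg_comm]
    exact congrArg _ (funext fun κ => HashedGame.avg_run_eq _ _ _ le_rfl hind _ _)
  obtain ⟨i, hi⟩ := exists_uniformAvg_le fun i : K => uniformAvg fun z : Bits n × Bool =>
    ((replacedGame T S n (T.keyGen n w).1 (T.f n (T.keyGen n w).1 r) z.1 z.2).fix (h i)).run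
      output code ⟨none, True⟩ (startState input (T.keyGen n w).1)
  obtain ⟨B, hB, hwin⟩ := exists_symAdversary hP ((hcirc i).mono hh) (T.keyGen n w).1
    (T.f n (T.keyGen n w).1 r) input output code hk
  exact ⟨B, hB, hw.trans ((uniformAvg_comm _).trans_le (hr.trans (h1.trans_le (hi.trans hwin))))⟩

theorem Game.winProb_nonneg {I : Interface} {inp out : ℕ} (G : Game I inp out)
    (A : Adversary I inp out) : 0 ≤ G.winProb A :=
  uniformAvg_nonneg fun _ => Game.run_nonneg _ _ _ _ _ _

theorem Game.winProb_le_one {I : Interface} {inp out : ℕ} (G : Game I inp out)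
    (A : Adversary I inp out) [Nonempty G.Coins] : G.winProb A ≤ 1 := by
  refine (uniformAvg_mono fun r => (Game.run_le_normSq _ _ _ _ _ _).trans (le_of_eq ?_)).trans
    (uniformAvg_const (1 : ℝ)).le
  rw [normSq, Finset.sum_eq_single fun w => decide (∃ j, A.input j = w ∧ G.input r j = true)]
  · simp [startState]
  · intro x _ hx
    simp [startState, hx]
  · simp

/-- An adversary that outputs zeros. -/
theorem exists_trivial_inverter (hP : CostBound T S n P) :
    ∃ B : Adversary noInterface (T.pkLen n + T.rangeLen n) (T.domLen n),
      B.qubits + B.code.length ≤ 1000 * (P + 1) ^ 2 := by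
  refine ⟨⟨T.pkLen n + T.rangeLen n + T.domLen n, Fin.castAddEmb _, Fin.natAddEmb _, []⟩, ?_⟩
  have := hP.length
  simp only [List.length_nil]
  nlinarith

/-- An adversary that queries the random oracle at `r` in its `j`-th step inverts `f`. -/
theorem exists_inverter_of_queryWeight (hP : CostBound T S n P)
    (input : Fin (T.pkLen n) ↪ Fin k)
    (code : List (Step (T.domLen n) n (T.rangeLen n + S.ctLen n) (S.msgLen n) k))
    (hk : k + code.length ≤ P) (hh : hashSize (T.rangeLen n) n (2 * code.length) ≤ P) (j : ℕ)
    (hj : j < code.length) :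
    ∃ B : Adversary noInterface (T.pkLen n + T.rangeLen n) (T.domLen n),
      B.qubits + B.code.length ≤ 1000 * (P + 1) ^ 2 ∧
      (uniformAvg fun w : Bits (T.keyCoins n) => uniformAvg fun b : Bool =>
        uniformAvg fun r : Bits (T.domLen n) => uniformAvg fun H : Bits (T.rangeLen n) → Bits n =>
          FixedGame.queryWeight ((hybridGame T S n (T.keyGen n w).1 (T.f n (T.keyGen n w).1 r) b id
            fun z : Bits 1 => z 0 = b).fix H)
              (fun x => T.f n (T.keyGen n w).1 x = T.f n (T.keyGen n w).1 r) code j ⟨none, True⟩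
                (startState input (T.keyGen n w).1)) ≤ (T.invGame n).winProb B := by
  have hz : (uniformAvg fun _ : Bits (T.keyCoins n) => uniformAvg fun _ : Bool =>
      uniformAvg fun _ : Bits (T.domLen n) =>
        uniformAvg fun _ : Bits (T.rangeLen n) → Bits n => (0 : ℝ)) = 0 := by
    simp only [uniformAvg_const]
  have hother : ∀ c, code[j]? = some c → (∀ e, c ≠ .oracle e) → ∀ (w : Bits (T.keyCoins n))
      (b : Bool) (r : Bits (T.domLen n)) (H : Bits (T.rangeLen n) → Bits n),
      FixedGame.queryWeight ((hybridGame T S n (T.keyGen n w).1 (T.f n (T.keyGen n w).1 r) b id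
        fun z : Bits 1 => z 0 = b).fix H)
          (fun x => T.f n (T.keyGen n w).1 x = T.f n (T.keyGen n w).1 r) code j ⟨none, True⟩
            (startState input (T.keyGen n w).1) = 0 := by
    intro c hc hne w b r H
    rw [FixedGame.queryWeight, hc]
    cases c with
    | oracle e => exact absurd rfl (hne e)
    | _ => rfl
  by_cases hc : ∃ e, code[j]? = some (.oracle e)
  swap
  · obtain ⟨B, hB⟩ := exists_trivial_inverter hP
    refine ⟨B, hB, le_of_eq_of_le ?_ (Game.winProb_nonneg _ _)⟩
    simp only [hother _ (List.getElem?_eq_getElem hj)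
      fun e he => hc ⟨e, by rw [List.getElem?_eq_getElem hj, he]⟩]
    exact hz
  obtain ⟨e, he⟩ := hc
  obtain ⟨K, hK, hK', h, hind, hcirc⟩ :=
    exists_boundedIndependent (T.rangeLen n) n (2 * code.length)
  -- the success probability for a choice of everything that is sampled
  let q : Bits (T.keyCoins n) → Bool → Bits (T.domLen n) → Bits (S.encCoins n) →
      (Bits (T.rangeLen n) → Bits n) → ℝ := fun w b r u H =>
    ((hybridGame T S n (T.keyGen n w).1 (T.f n (T.keyGen n w).1 r) b (fun _ : Bits 0 => u)
      fun z => T.f n (T.keyGen n w).1 z = T.f n (T.keyGen n w).1 r).fix H).run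
        (Function.Embedding.inl.trans e) (code.take j) ⟨none, True⟩
          (startState input (T.keyGen n w).1)
  have hq : ∀ w b r, (uniformAvg fun H : Bits (T.rangeLen n) → Bits n =>
      FixedGame.queryWeight ((hybridGame T S n (T.keyGen n w).1 (T.f n (T.keyGen n w).1 r) b id
        fun z : Bits 1 => z 0 = b).fix H)
          (fun x => T.f n (T.keyGen n w).1 x = T.f n (T.keyGen n w).1 r) code j ⟨none, True⟩
            (startState input (T.keyGen n w).1)) =
      uniformAvg fun u : Bits (S.encCoins n) => uniformAvg fun i : K => q w b r u (h i) := by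
    intro w b r
    have h1 : ∀ H : Bits (T.rangeLen n) → Bits n,
        FixedGame.queryWeight ((hybridGame T S n (T.keyGen n w).1 (T.f n (T.keyGen n w).1 r) b id
          fun z : Bits 1 => z 0 = b).fix H)
            (fun x => T.f n (T.keyGen n w).1 x = T.f n (T.keyGen n w).1 r) code j ⟨none, True⟩
              (startState input (T.keyGen n w).1) =
          uniformAvg fun u : Bits (S.encCoins n) => q w b r u H := by
      intro H
      rw [FixedGame.queryWeight, he]
      exact FixedGame.run_presample (N' := 0) (fun u _ => u)
        (fun g => congrArg _ (funext fun u => (uniformAvg_const (g u)).symm)) _ _ _ rfl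
    simp only [h1]
    rw [uniformAvg_comm]
    refine congrArg _ (funext fun u => ?_)
    exact HashedGame.avg_run_eq _ _ _ (by rw [List.length_take]; omega) hind _ _
  simp only [hq]
  obtain ⟨⟨b, u, i⟩, hi⟩ := exists_uniformAvg_le fun z : Bool × Bits (S.encCoins n) × K =>
    uniformAvg fun x : Bits (T.keyCoins n) × Bits (T.domLen n) => q x.1 z.1 x.2 z.2.1 (h z.2.2)
  obtain ⟨B, hB, hwin⟩ := exists_inverter hP ((hcirc i).mono hh) b u input
    (Function.Embedding.inl.trans e) (code.take j) (by rw [List.length_take]; omega)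
  refine ⟨B, hB, le_of_eq_of_le ?_ (hi.trans hwin)⟩
  exact uniformAvg_rearrange fun w b r u i => q w b r u (h i)

/-- The winning probability against the hybrid scheme, in terms of two adversaries of polynomially
larger size. -/
theorem exists_reductions (hP : CostBound T S n P)
    (A : Adversary ((hybrid T S).interface n) (T.pkLen n) 1) (hk : A.qubits + A.code.length ≤ P)
    (hh : hashSize (T.rangeLen n) n (2 * A.code.length) ≤ P) :
    ∃ (B : Adversary (S.interface n) 0 1)
      (C : Adversary noInterface (T.pkLen n + T.rangeLen n) (T.domLen n)),
      B.qubits + B.code.length ≤ 20000 * (P + 1) ^ 2 ∧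
      C.qubits + C.code.length ≤ 1000 * (P + 1) ^ 2 ∧
      ∀ t : ℝ, 0 < t → ((hybrid T S).ccaGame n).winProb A ≤
        (1 + t) ^ A.code.length * (S.ccaGame n).winProb B +
          4 * (1 + 1 / t) * (1 + t) ^ A.code.length * A.code.length * (T.invGame n).winProb C := by
  set code : List (Step (T.domLen n) n (T.rangeLen n + S.ctLen n) (S.msgLen n) A.qubits) :=
    A.code.map Step.ofInstr with hcode
  have hlen : code.length = A.code.length := List.length_map _
  rw [← hlen] at hk hh ⊢
  obtain ⟨B, hB, hBwin⟩ := exists_symAdversary_of_replaced hP A.input A.output code hk hh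
  -- the best of the inverters obtained from the steps of the adversary
  have hC : ∃ C : Adversary noInterface (T.pkLen n + T.rangeLen n) (T.domLen n),
      C.qubits + C.code.length ≤ 1000 * (P + 1) ^ 2 ∧ ∀ j < code.length,
      (uniformAvg fun w : Bits (T.keyCoins n) => uniformAvg fun b : Bool =>
        uniformAvg fun r : Bits (T.domLen n) => uniformAvg fun H : Bits (T.rangeLen n) → Bits n =>
          FixedGame.queryWeight ((hybridGame T S n (T.keyGen n w).1 (T.f n (T.keyGen n w).1 r) b id
            fun z : Bits 1 => z 0 = b).fix H)
              (fun x => T.f n (T.keyGen n w).1 x = T.f n (T.keyGen n w).1 r) code j ⟨none, True⟩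
                (startState A.input (T.keyGen n w).1)) ≤ (T.invGame n).winProb C := by
    by_cases h0 : code.length = 0
    · obtain ⟨C, hC⟩ := exists_trivial_inverter hP
      exact ⟨C, hC, fun j hj => absurd hj (by omega)⟩
    · obtain ⟨j, hj, hmax⟩ := Finset.exists_max_image (Finset.range code.length) (fun j =>
        uniformAvg fun w : Bits (T.keyCoins n) => uniformAvg fun b : Bool =>
        uniformAvg fun r : Bits (T.domLen n) => uniformAvg fun H : Bits (T.rangeLen n) → Bits n =>
          FixedGame.queryWeight ((hybridGame T S n (T.keyGen n w).1 (T.f n (T.keyGen n w).1 r) b id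
            fun z : Bits 1 => z 0 = b).fix H)
              (fun x => T.f n (T.keyGen n w).1 x = T.f n (T.keyGen n w).1 r) code j ⟨none, True⟩
                (startState A.input (T.keyGen n w).1)) ⟨0, by simpa using Nat.pos_of_ne_zero h0⟩
      obtain ⟨C, hC, hwin⟩ := exists_inverter_of_queryWeight hP A.input code hk hh j
        (Finset.mem_range.1 hj)
      exact ⟨C, hC, fun i hi => (hmax i (Finset.mem_range.2 hi)).trans hwin⟩
  obtain ⟨C, hC, hCwin⟩ := hC
  refine ⟨B, C, hB, hC, fun t ht => ?_⟩
  set K : ℝ := 4 * (1 + 1 / t) * (1 + t) ^ code.length with hK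
  have hhop : ∀ (w : Bits (T.keyCoins n)) (b : Bool) (r : Bits (T.domLen n)),
      (uniformAvg fun H : Bits (T.rangeLen n) → Bits n =>
        ((hybridGame T S n (T.keyGen n w).1 (T.f n (T.keyGen n w).1 r) b id fun z : Bits 1 =>
          z 0 = b).fix H).run A.output code ⟨none, True⟩ (startState A.input (T.keyGen n w).1)) ≤
      (1 + t) ^ code.length * (uniformAvg fun H : Bits (T.rangeLen n) → Bits n =>
        uniformAvg fun κ : Bits n =>
          ((replacedGame T S n (T.keyGen n w).1 (T.f n (T.keyGen n w).1 r) κ b).fix H).run A.output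
            code ⟨none, True⟩ (startState A.input (T.keyGen n w).1)) +
      K * ∑ j ∈ Finset.range code.length, uniformAvg fun H : Bits (T.rangeLen n) → Bits n =>
        FixedGame.queryWeight ((hybridGame T S n (T.keyGen n w).1 (T.f n (T.keyGen n w).1 r) b id
          fun z : Bits 1 => z 0 = b).fix H)
            (fun x => T.f n (T.keyGen n w).1 x = T.f n (T.keyGen n w).1 r) code j ⟨none, True⟩
              (startState A.input (T.keyGen n w).1) := by
    intro w b r
    set y := T.f n (T.keyGen n w).1 r with hy
    set G := hybridGame T S n (T.keyGen n w).1 y b id fun z : Bits 1 => z 0 = b with hG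
    -- the value of `H` at `y` is the key of the challenge
    rw [← uniformAvg_update y]
    simp only [← uniformAvg_update y (fun H => FixedGame.queryWeight (G.fix H) _ _ _ _ _)]
    rw [← uniformAvg_sum, ← uniformAvg_mul_left, ← uniformAvg_mul_left, ← uniformAvg_add]
    refine uniformAvg_mono fun H => ?_
    rw [← uniformAvg_sum, ← uniformAvg_mul_left, ← uniformAvg_mul_left, ← uniformAvg_add]
    refine uniformAvg_mono fun κ => ?_
    refine (FixedGame.run_le_of_agree (D := G.fix (Function.update H y κ))
      (bad := fun x => T.f n (T.keyGen n w).1 x = y) (O' := fun x => H (T.f n (T.keyGen n w).1 x))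
      (fun x hx => Function.update_of_ne hx _ _) ht code hK.ge ⟨none, True⟩ _).trans (le_of_eq ?_)
    have h1 : ({ G.fix (Function.update H y κ) with
        O := fun x => H (T.f n (T.keyGen n w).1 x) } : FixedGame _ _ _ _ _ _) =
        (replacedGame T S n (T.keyGen n w).1 y κ b).fix H := by
      have h2 : (fun c : Bits (T.rangeLen n + S.ctLen n) => encodeOption (S.dec n
          (Function.update H y κ (leftBits c)) (rightBits c))) = fun c => encodeOption (S.dec n
          (if leftBits c = y then κ else H (leftBits c)) (rightBits c)) := by
        funext c
        rw [Function.update_apply]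
      have h3 : (fun (u : Bits (S.encCoins n)) (m : Bits (S.msgLen n + S.msgLen n)) =>
          (Fin.append y (S.enc n (Function.update H y κ y) (if b then rightBits m else leftBits m)
            u) : Bits (T.rangeLen n + S.ctLen n))) = fun u m =>
          Fin.append y (S.enc n κ (if b then rightBits m else leftBits m) u) := by
        rw [Function.update_self]
      exact congrArg₂ (fun d c => (⟨S.msgSize n, fun x => H (T.f n (T.keyGen n w).1 x), d, c,
        {c | leftBits c ∈ Set.range (T.f n (T.keyGen n w).1)}, fun z => z 0 = b⟩ :
          FixedGame _ _ _ _ _ _)) h2 h3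
    rw [h1]
  have h4 := (winProb_hybrid A).trans_le (uniformAvg_mono fun w => uniformAvg_mono fun b =>
    uniformAvg_mono fun r => hhop w b r)
  simp only [uniformAvg_add, uniformAvg_mul_left, uniformAvg_sum] at h4
  have hpow : 0 ≤ (1 + t) ^ code.length := by positivity
  refine h4.trans (add_le_add (mul_le_mul_of_nonneg_left hBwin hpow) ?_)
  rw [mul_assoc K (code.length : ℝ)]
  have hK0 : 0 ≤ K := by positivity
  refine mul_le_mul_of_nonneg_left ?_ hK0
  refine (Finset.sum_le_sum fun j hj => hCwin j (Finset.mem_range.1 hj)).trans (le_of_eq ?_)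
  rw [Finset.sum_const, Finset.card_range, nsmul_eq_mul]

end Hops

/-! ### Asymptotics -/

/-- For `x = n` large and `t` inversely polynomial in `n`, the bound of `exists_reductions` exceeds
`1 / 2` by less than `x ^ (-c)`. -/
theorem reduction_bound {x p q : ℝ} {a c L : ℕ} (hx : 300 ≤ x) (hL : (L : ℝ) ≤ x ^ a) (hp1 : p ≤ 1)
    (hp : p - 1 / 2 < (x ^ (c + 1))⁻¹) (hq : q < (x ^ (2 * a + 2 * c + 2))⁻¹) {t : ℝ}
    (ht : t = (8 * x ^ (a + c + 1))⁻¹) :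
    (1 + t) ^ L * p + 4 * (1 + 1 / t) * (1 + t) ^ L * L * q - 1 / 2 < (x ^ c)⁻¹ := by
  have hx0 : 0 < x := by linarith
  have hx1 : 1 ≤ x := by linarith
  have ht0 : 0 < t := by rw [ht]; positivity
  have htx : 1 / t = 8 * x ^ (a + c + 1) := by rw [ht, one_div, inv_inv]
  set δ : ℝ := (x ^ (c + 1))⁻¹ with hδ
  have hδ0 : 0 < δ := by positivity
  have hδ1 : δ ≤ 1 := inv_le_one_of_one_le₀ (one_le_pow₀ hx1)
  have htL : t * L ≤ δ / 8 := by
    calc t * L ≤ t * x ^ a := by gcongr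
      _ = δ / 8 := by
        rw [ht, hδ, show a + c + 1 = a + (c + 1) by ring, pow_add]
        field_simp
  have hpow : (1 + t) ^ L ≤ 1 + δ / 4 := by
    have h1 : (1 + t) ^ L ≤ Real.exp (t * L) := by
      calc (1 + t) ^ L ≤ Real.exp t ^ L := by
            gcongr
            linarith [Real.add_one_le_exp t]
        _ = Real.exp (t * L) := by rw [← Real.exp_nat_mul, mul_comm]
    have h0 : 0 ≤ t * L := by positivity
    have h2 := Real.abs_exp_sub_one_le (x := t * L) (by rw [abs_of_nonneg h0]; linarith)
    rw [abs_of_nonneg h0] at h2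
    have h3 := le_abs_self (Real.exp (t * L) - 1)
    linarith
  have hpow1 : 1 ≤ (1 + t) ^ L := one_le_pow₀ (by linarith)
  have h1 : (1 + t) ^ L * p ≤ p + δ / 4 := by
    nlinarith [mul_nonneg (sub_nonneg.2 hpow1) (sub_nonneg.2 hp1)]
  have hone : (1 : ℝ) ≤ x ^ (a + c + 1) := one_le_pow₀ hx1
  have h2 : 4 * (1 + 1 / t) * (1 + t) ^ L * L ≤ 72 * (x ^ (a + c + 1) * x ^ a) := by
    have h3 : (1 + t) ^ L ≤ 2 := by linarith
    have h4 : 4 * (1 + 1 / t) ≤ 36 * x ^ (a + c + 1) := by rw [htx]; linarith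
    calc 4 * (1 + 1 / t) * (1 + t) ^ L * L ≤ 36 * x ^ (a + c + 1) * 2 * x ^ a := by gcongr
      _ = _ := by ring
  have h5 : 4 * (1 + 1 / t) * (1 + t) ^ L * L * q ≤ 72 * δ := by
    have hinv : 0 ≤ (x ^ (2 * a + 2 * c + 2))⁻¹ := by positivity
    calc 4 * (1 + 1 / t) * (1 + t) ^ L * L * q
        ≤ 4 * (1 + 1 / t) * (1 + t) ^ L * L * (x ^ (2 * a + 2 * c + 2))⁻¹ := by gcongr
      _ ≤ 72 * (x ^ (a + c + 1) * x ^ a) * (x ^ (2 * a + 2 * c + 2))⁻¹ := by gcongr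
      _ = 72 * δ := by
        have h6 : x ^ (2 * a + 2 * c + 2) = x ^ (a + c + 1) * x ^ a * x ^ (c + 1) := by ring
        rw [hδ, h6, mul_inv, mul_assoc, mul_inv_cancel_left₀ (by positivity)]
  have h6 : 300 * δ ≤ (x ^ c)⁻¹ := by
    calc 300 * δ ≤ x * δ := by gcongr
      _ = (x ^ c)⁻¹ := by
        rw [hδ, pow_succ]
        field_simp
  linarith

/-- The costs that enter the reductions are polynomially bounded. -/
theorem exists_costBound (T : TrapdoorFunction) (S : SymScheme) {q L : ℕ → ℕ} (hq : PolyBounded q)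
    (hL : PolyBounded L) : ∃ P : ℕ → ℕ, PolyBounded P ∧ ∀ n, CostBound T S n (P n) ∧ q n ≤ P n ∧
      hashSize (T.rangeLen n) n (2 * L n) ≤ P n := by
  obtain ⟨hf1, hf2, sf, hsf, hf⟩ := T.efficient_f
  obtain ⟨he1, he2, se, hse, he⟩ := S.efficient_enc
  obtain ⟨-, -, sd, hsd, hd⟩ := S.efficient_dec
  have hsum : PolyBounded fun n => (T.rangeLen n + n + 1) := (hf2.add polyBounded_id).add
    (polyBounded_const 1)
  have hhash : PolyBounded fun n => hashSize (T.rangeLen n) n (2 * L n) :=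
    ((polyBounded_const 2).mul hL).mul (hsum.mul (((hsum.mul hsum).add (polyBounded_const 1)).mul
      (polyBounded_const 22)))
  refine ⟨fun n => (T.pkLen n + T.domLen n) + T.rangeLen n + (n + S.msgLen n + S.encCoins n) +
    S.ctLen n + sf n + se n + sd n + q n + hashSize (T.rangeLen n) n (2 * L n),
    ((((((((hf1.add hf2).add he1).add he2).add hsf).add hse).add hsd).add hq).add hhash),
    fun n => ⟨⟨?_, ?_, ?_, ?_⟩, ?_, ?_⟩⟩
  · dsimp only
    omega
  · exact HasCircuit.mono (hf n) (by dsimp only; omega)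
  · exact HasCircuit.mono (he n) (by dsimp only; omega)
  · exact HasCircuit.mono (hd n) (by dsimp only; omega)
  · dsimp only
    omega
  · exact Nat.le_add_left _ _

end

end QROM

theorem mainTheorem2
    (hPRF : ∃ F : ∀ n, QROM.Bits n → QROM.Bits n → QROM.Bits n, QROM.IsQuantumPRF F)
    (T : QROM.TrapdoorFunction) (hT : T.QuantumSecure)
    (S : QROM.SymScheme) (hS : S.QuantumCCASecure) :
    (QROM.hybrid T S).QuantumCCASecure := by
  intro A hA
  obtain ⟨P, hP, hcost⟩ := QROM.exists_costBound T S hA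
    (QROM.PolyBounded.mono hA fun n => Nat.le_add_left (A n).code.length (A n).qubits)
  choose B C hB hC hwin using fun n => QROM.exists_reductions (hcost n).1 (A n) (hcost n).2.1
    (hcost n).2.2
  have hpoly : ∀ c : ℕ, QROM.PolyBounded fun n => c * (P n + 1) ^ 2 := fun c => by
    have h1 := hP.add (QROM.polyBounded_const 1)
    exact ((QROM.polyBounded_const c).mul (h1.mul h1)).mono fun n => by rw [pow_two]
  have hBneg := hS B ((hpoly 20000).mono hB)
  have hCneg := hT C ((hpoly 1000).mono hC)
  obtain ⟨a, ha⟩ := (QROM.PolyBounded.mono hA fun n =>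
    Nat.le_add_left (A n).code.length (A n).qubits).eventually_le_pow
  intro c
  filter_upwards [ha, Filter.eventually_ge_atTop 300, hBneg (c + 1),
    hCneg (2 * a + 2 * c + 2)] with n hL hn hBn hCn
  have hn' : (300 : ℝ) ≤ n := by exact_mod_cast hn
  have hinst : Nonempty (S.ccaGame n).Coins := ⟨(fun _ => false, false)⟩
  rw [sub_zero] at hCn
  exact (sub_le_sub_right (hwin n _ (by positivity)) _).trans_lt
    (QROM.reduction_bound hn' (by exact_mod_cast hL) (QROM.Game.winProb_le_one _ _) hBn hCn rfl)
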